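/- Consider the Boussinesq system on $\mathbb R^3$, $$\partial_t u+u\cdot\nabla u+\nabla P=\Delta u+\theta e_3,\qquad \operatorname{div}u=0,\qquad \partial_t\theta+u\cdot\nabla\theta=\Delta\theta,$$ with data $(u_0,\theta_0)$, where $\operatorname{div}u_0=0$ in the sense of distributions. Let $\mathbb P$ be the Leray projector. A mild solution is a pair $(u,\theta)$ of measurable functions on $(0,\infty)\times\mathbb R^3$ with, for all $t>0$, $$u(t)=e^{t\Delta}u_0+te^{t\Delta}\mathbb P(\theta_0e_3)-\int_0^te^{(t-s)\Delta}\mathbb P\nabla\cdot(u\otimes u)(s)\,ds-\int_0^t(t-s)e^{(t-s)\Delta}\mathbb P\nabla\cdot(\theta e_3\otimes u)(s)\,ds,$$ $$\theta(t)=e^{t\Delta}\theta_0-\int_0^te^{(t-s)\Delta}\nabla\cdot(\theta u)(s)\,ds,$$ where $\nabla\cdot(\theta e_3\otimes u)=(\nabla\cdot(\theta u))e_3$. Put $\|u\|_{\mathcal X}=\sup_{t>0,x}(\sqrt t+|x|)|u(t,x)|$ and $\|\theta\|_{\mathcal Y}=\sup_{t>0,x}(\sqrt t+|x|)^3|\theta(t,x)|$.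 **Theorem.** There are absolute constants $\varepsilon,M>0$ with the following property. Let $u_0$ be divergence free, and assume $$\sup_x|x||u_0(x)|<\varepsilon,\qquad \|te^{t\Delta}\mathbb P(\theta_0e_3)\|_{\mathcal X}<\varepsilon,\qquad \|e^{t\Delta}\theta_0\|_{\mathcal Y}<\varepsilon .$$ Suppose moreover that for some $a\ge1$, $b\ge3$ and $C_0>0$, for all $x\in\mathbb R^3$, $$|u_0(x)|\le C_0(1+|x|)^{-a},\qquad |\theta_0(x)|\le C_0(1+|x|)^{-b}.$$ Then there is a unique mild solution $(u,\theta)$ with $\|u\|_{\mathcal X}\le M\varepsilon$ and $\|\theta\|_{\mathcal Y}\le M\varepsilon$, and it satisfies the following. (i) If $a<3$, there is a constant $C>0$, independent of $x$ and $t$, such that for all $t>0$ and $x\in\mathbb R^3$ $$|u(t,x)|\le C\inf_{0\le\eta\le a}|x|^{-\eta}(1+t)^{(\eta-1)/2},\qquad |\theta(t,x)|\le C\inf_{0\le\eta\le b}|x|^{-\eta}(1+t)^{(\eta-3)/2}$$ (at $x=0$ only $\eta=0$ counts). (ii) If $2\le a<4$, $a\ne3$, $b\ge4$, $\int_{\mathbb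 R^3}|y||\theta_0(y)|\,dy<\infty$ (which is automatic if $b>4$) and $\int_{\mathbb R^3}\theta_0(y)\,dy=0$, there is a constant $C>0$, independent of $x$ and $t$, such that for all $t>0$ and $x\in\mathbb R^3$ $$|u(t,x)|\le C\inf_{0\le\eta\le a}(1+|x|)^{-\eta}(1+t)^{(\eta-2)/2},\qquad |\theta(t,x)|\le C\inf_{0\le\eta\le b}(1+|x|)^{-\eta}(1+t)^{(\eta-4)/2}.$$ -/

import Mathlib

open MeasureTheory
open scoped ENNReal ContDiff

namespace Boussinesq

noncomputable section

/-- The physical space `ℝ³` with its Euclidean norm. -/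
abbrev E3 : Type := EuclideanSpace ℝ (Fin 3)

/-- The vertical unit vector `(0, 0, 1)`. -/
def e3 : E3 := EuclideanSpace.single 2 1

/-- The partial derivative `∂_j f` of a scalar function on `ℝ³`. -/
def pd (j : Fin 3) (f : E3 → ℝ) (x : E3) : ℝ := fderiv ℝ f x (EuclideanSpace.single j 1)

/-- The heat kernel `G_t(x) = (4πt)^{-3/2} exp(-|x|²/(4t))`, for `t > 0`. -/
def heatKernel (t : ℝ) (x : E3) : ℝ :=
  (4 * Real.pi * t) ^ (-(3 / 2) : ℝ) * Real.exp (-‖x‖ ^ 2 / (4 * t))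

/-- The kernel `𝕂_{j,k}(t, x)` of `e^{tΔ} ℙ`, for `t > 0`, where `ℙ = Id + ∇ (-Δ)⁻¹ div` is the
Leray projector, with symbol `δ_{jk} - ξ_j ξ_k / |ξ|²`. As `e^{tΔ} (-Δ)⁻¹ = ∫_t^∞ e^{sΔ} ds` (on the
Fourier side, `e^{-t|ξ|²} / |ξ|² = ∫_t^∞ e^{-s|ξ|²} ds`), this kernel is
`δ_{jk} G_t + ∫_t^∞ ∂_j ∂_k G_s ds`, an absolutely convergent integral. -/
def oseenKernel (t : ℝ) (j k : Fin 3) (x : E3) : ℝ :=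
  (if j = k then heatKernel t x else 0) + ∫ s in Set.Ioi t, pd j (pd k (heatKernel s)) x

/-- The kernel `F_{j;h,k}(t, x) = ∂_h 𝕂_{j,k}(t, x)` of `e^{tΔ} ℙ div`. -/
def oseenDivKernel (t : ℝ) (j h k : Fin 3) (x : E3) : ℝ := pd h (oseenKernel t j k) x

/-- The heat semigroup `e^{tΔ} f`, for a scalar or vector valued `f`. -/
def heat {V : Type} [NormedAddCommGroup V] [NormedSpace ℝ V] (t : ℝ) (f : E3 → V) (x : E3) : V :=
  ∫ y, heatKernel t (x - y) • f y

/-- `e^{tΔ} ∇·w` for a vector field `w`. -/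
def heatDiv (t : ℝ) (w : E3 → E3) (x : E3) : ℝ :=
  ∫ y, ∑ h : Fin 3, pd h (heatKernel t) (x - y) * w y h

/-- `e^{tΔ} ℙ f` for a vector field `f`. -/
def heatLeray (t : ℝ) (f : E3 → E3) (x : E3) : E3 :=
  WithLp.toLp 2 fun j => ∫ y, ∑ k : Fin 3, oseenKernel t j k (x - y) * f y k

/-- `e^{tΔ} ℙ ∇·(w ⊗ v)` for two vector fields, where `∇·(w ⊗ v) = ∑_h ∂_h (v_h w)`. -/
def heatLerayDiv (t : ℝ) (w v : E3 → E3) (x : E3) : E3 :=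
  WithLp.toLp 2 fun j =>
    ∫ y, ∑ h : Fin 3, ∑ k : Fin 3, oseenDivKernel t j h k (x - y) * (w y k * v y h)

/-- `B(u, v)(t) = - ∫₀ᵗ e^{(t-s)Δ} ℙ ∇·(u ⊗ v)(s) ds`. -/
def opB (u v : ℝ → E3 → E3) (t : ℝ) (x : E3) : E3 :=
  -∫ s in (0 : ℝ)..t, heatLerayDiv (t - s) (u s) (v s) x

/-- `E(u, θ)(t) = - ∫₀ᵗ (t-s) e^{(t-s)Δ} ℙ ∇·(θ e₃ ⊗ u)(s) ds`. -/
def opE (u : ℝ → E3 → E3) (θ : ℝ → E3 → ℝ) (t : ℝ) (x : E3) : E3 :=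
  -∫ s in (0 : ℝ)..t, (t - s) • heatLerayDiv (t - s) (fun y => θ s y • e3) (u s) x

/-- `B̃(θ, u)(t) = - ∫₀ᵗ e^{(t-s)Δ} ∇·(θ u)(s) ds`. -/
def opBt (θ : ℝ → E3 → ℝ) (u : ℝ → E3 → E3) (t : ℝ) (x : E3) : ℝ :=
  -∫ s in (0 : ℝ)..t, heatDiv (t - s) (fun y => θ s y • u s y) x

/-- `‖u‖_𝒳 = sup_{t > 0, x} (√t + |x|) |u(t,x)|`; it is `∞` when `u` is not in `𝒳`. -/
def normX (u : ℝ → E3 → E3) : ℝ≥0∞ :=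
  ⨆ (t : ℝ) (_ : 0 < t) (x : E3), ENNReal.ofReal ((√t + ‖x‖) * ‖u t x‖)

/-- `‖θ‖_𝒴 = sup_{t > 0, x} (√t + |x|)³ |θ(t,x)|`; it is `∞` when `θ` is not in `𝒴`. -/
def normY (θ : ℝ → E3 → ℝ) : ℝ≥0∞ :=
  ⨆ (t : ℝ) (_ : 0 < t) (x : E3), ENNReal.ofReal ((√t + ‖x‖) ^ 3 * |θ t x|)

/-- `div u₀ = 0` in the sense of distributions. -/
def DivFree (u₀ : E3 → E3) : Prop :=
  ∀ φ : E3 → ℝ, ContDiff ℝ ∞ φ → HasCompactSupport φ → ∫ x, fderiv ℝ φ x (u₀ x) = 0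

/-- The smallness conditions on the initial data (with threshold `ε`): `u₀` is divergence free,
`sup |x| |u₀(x)| < ε`, `‖t e^{tΔ} ℙ (θ₀ e₃)‖_𝒳 < ε` and `‖e^{tΔ} θ₀‖_𝒴 < ε`. -/
structure SmallData (ε : ℝ) (u₀ : E3 → E3) (θ₀ : E3 → ℝ) : Prop where
  meas_u : AEStronglyMeasurable u₀ volume
  meas_θ : AEStronglyMeasurable θ₀ volume
  divFree : DivFree u₀
  small_u : (⨆ x : E3, ENNReal.ofReal (‖x‖ * ‖u₀ x‖)) < ENNReal.ofReal ε
  small_X : normX (fun t x => t • heatLeray t (fun y => θ₀ y • e3) x) < ENNReal.ofReal ε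
  small_Y : normY (fun t x => heat t θ₀ x) < ENNReal.ofReal ε

/-- `(u, θ)`, measurable on `(0,∞) × ℝ³`, is a mild solution of the Boussinesq system with initial
data `(u₀, θ₀)`, that is, a solution of its integral formulation. The values at times `t ≤ 0` play
no role. -/
structure IsMildSolution (u₀ : E3 → E3) (θ₀ : E3 → ℝ)
    (u : ℝ → E3 → E3) (θ : ℝ → E3 → ℝ) : Prop where
  meas_u : Measurable fun p : Set.Ioi (0 : ℝ) × E3 => u p.1 p.2
  meas_θ : Measurable fun p : Set.Ioi (0 : ℝ) × E3 => θ p.1 p.2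
  eq_u : ∀ t : ℝ, 0 < t → ∀ x : E3,
    u t x = heat t u₀ x + t • heatLeray t (fun y => θ₀ y • e3) x + opB u u t x + opE u θ t x
  eq_θ : ∀ t : ℝ, 0 < t → ∀ x : E3, θ t x = heat t θ₀ x + opBt θ u t x

/-- A mild solution that lies in `𝒳 × 𝒴`, with both norms at most `r`. -/
structure IsSmallMildSolution (r : ℝ) (u₀ : E3 → E3) (θ₀ : E3 → ℝ)
    (u : ℝ → E3 → E3) (θ : ℝ → E3 → ℝ) : Prop extends IsMildSolution u₀ θ₀ u θ where
  normX_le : normX u ≤ ENNReal.ofReal r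
  normY_le : normY θ ≤ ENNReal.ofReal r

end

end Boussinesq

namespace Boussinesq

noncomputable section

/-! ### The heat kernel and its derivatives -/

/-! Write ρ = √t + |x| for the parabolic size of a point. The kernels of the nonlinear terms, first
derivatives of the Oseen and heat kernels, are bounded by (√(t-s) + |x-y|)^{-4}, and all nonlinear
estimates come from one cut of the source at parabolic size ρ/4 (`duh_le`). Farther out, the
supremum of the source multiplies the mass of the kernel, a multiple of √t. Closer in, the parabolic
triangle inequality bounds the kernel by √t^{N-4} ρ^{-N}, which multiplies the space-time mass of
the source; N = 4 for the Oseen kernel, N ≥ 4 arbitrary for the heat kernel.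

Space-time has parabolic dimension 5, so a source σ^{-1}(κ+σ)^{-m} with σ = √s + |y| and 0 ≤ m < 4
reproduces the weight (κ+ρ)^{-m} (`duh_wt_le`). For κ = 0 and m = 1, 3 this bounds the three
bilinear operators on 𝒳 × 𝒴, and a contraction gives existence and uniqueness (`exists_fixed`,
`fixed_unique`). For κ = 1 one factor of each product can still be measured in the small scale
invariant norm, so the same iteration preserves weighted bounds of any size, as long as the operator
constants for the weights involved stay below the constant K that fixes ε. As ε must be absolute,
this is used only for the pairs of weights (1, 3) and (7/4, 15/4).

From there on no smallness is needed. A product decays faster than its factors, so inserting the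
known decay into the integral equation improves it, until the rate of the linear part is reached
(`decOn_of_fixed`, `decOn_of_fixed_of_mean_zero`). In the mean zero case 7/4 + 15/4 = 11/2 > 5 makes
θu integrable over space-time, so that the buoyancy term is O(t ρ^{-4}) for ρ ≥ 1.

For the linear part, the kernel is replaced by its value at x on a ball around the origin
(`abs_integral_sub_mean_le`); what remains are partial integrals and truncated first moments of θ₀,
recorded in `MomentBound`. If b = 3 the data need not be integrable, and the partial integrals are
bounded only because e^{tΔ}θ₀ lies in 𝒴 (`exists_mean_le`). -/

/-- The linear form with coefficients `a`. -/
def rowForm (a : Fin 3 → ℝ) : E3 →L[ℝ] ℝ := ∑ h, a h • (EuclideanSpace.proj h : E3 →L[ℝ] ℝ)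

lemma rowForm_apply (a : Fin 3 → ℝ) (v : E3) : rowForm a v = ∑ h, a h * v h := by
  simp [rowForm]

lemma rowForm_single (a : Fin 3 → ℝ) (h : Fin 3) :
    rowForm a (EuclideanSpace.single h 1) = a h := by
  simp [rowForm_apply]

lemma norm_rowForm_le (a : Fin 3 → ℝ) : ‖rowForm a‖ ≤ ∑ h, |a h| := by
  refine ContinuousLinearMap.opNorm_le_bound _ (Finset.sum_nonneg fun _ _ => abs_nonneg _) fun v => ?_
  rw [rowForm_apply, Finset.sum_mul]
  refine (norm_sum_le _ _).trans (Finset.sum_le_sum fun h _ => ?_)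
  rw [norm_mul]
  exact mul_le_mul_of_nonneg_left (PiLp.norm_apply_le v h) (abs_nonneg _)

lemma pd_eq {f : E3 → ℝ} {a : Fin 3 → ℝ} {x : E3} (h : HasFDerivAt f (rowForm a) x) (j : Fin 3) :
    pd j f x = a j := by
  rw [pd, h.fderiv, rowForm_single]

lemma abs_coord_le (x : E3) (j : Fin 3) : |x j| ≤ ‖x‖ := PiLp.norm_apply_le x j

/-- `∂_k G_t`. -/
def heatKernel₁ (k : Fin 3) (t : ℝ) (x : E3) : ℝ := -(x k) / (2 * t) * heatKernel t x

/-- `∂_j ∂_k G_t`. -/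
def heatKernel₂ (j k : Fin 3) (t : ℝ) (x : E3) : ℝ :=
  (x j * x k / (4 * t ^ 2) - (if j = k then 1 else 0) / (2 * t)) * heatKernel t x

/-- `∂_h ∂_j ∂_k G_t`. -/
def heatKernel₃ (h j k : Fin 3) (t : ℝ) (x : E3) : ℝ :=
  (-(x h * x j * x k) / (8 * t ^ 3) + ((if h = j then 1 else 0) * x k +
    (if h = k then 1 else 0) * x j + (if j = k then 1 else 0) * x h) / (4 * t ^ 2)) *
    heatKernel t x

lemma hasFDerivAt_coord (k : Fin 3) (x : E3) :
    HasFDerivAt (fun y : E3 => y k) (EuclideanSpace.proj k : E3 →L[ℝ] ℝ) x :=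
  (EuclideanSpace.proj k : E3 →L[ℝ] ℝ).hasFDerivAt

lemma hasFDerivAt_heatKernel (t : ℝ) (x : E3) :
    HasFDerivAt (heatKernel t) (rowForm fun h => heatKernel₁ h t x) x := by
  have h1 := (hasStrictFDerivAt_norm_sq x).hasFDerivAt
  have h2 := ((h1.neg.mul_const (4 * t)⁻¹).exp).const_mul ((4 * Real.pi * t) ^ (-(3 / 2) : ℝ))
  have h3 : (fun y : E3 => (4 * Real.pi * t) ^ (-(3 / 2) : ℝ) * Real.exp ((-‖y‖ ^ 2) * (4 * t)⁻¹))
      = heatKernel t := by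
    funext y; simp [heatKernel, div_eq_mul_inv]
  simp only [Pi.neg_apply] at h2
  rw [h3] at h2
  refine h2.congr_fderiv (ContinuousLinearMap.ext fun v => ?_)
  have hin : inner ℝ x v = ∑ h, x h * v h := by
    simp [PiLp.inner_apply, mul_comm]
  simp only [rowForm_apply, heatKernel₁, heatKernel, smul_apply,
    neg_apply, smul_eq_mul, innerSL_apply_apply, hin, Fin.sum_univ_three,
    nsmul_eq_mul, div_eq_mul_inv, mul_inv]
  push_cast
  ring

lemma pd_heatKernel (k : Fin 3) (t : ℝ) : pd k (heatKernel t) = heatKernel₁ k t := by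
  funext x; exact pd_eq (hasFDerivAt_heatKernel t x) k

lemma hasFDerivAt_heatKernel₁ (k : Fin 3) {t : ℝ} (ht : t ≠ 0) (x : E3) :
    HasFDerivAt (heatKernel₁ k t) (rowForm fun h => heatKernel₂ h k t x) x := by
  have h2 := (((hasFDerivAt_coord k x).neg.mul_const (2 * t)⁻¹)).mul (hasFDerivAt_heatKernel t x)
  have h3 : ((fun y : E3 => -(y k) * (2 * t)⁻¹) * heatKernel t) = heatKernel₁ k t := by
    funext y; simp [heatKernel₁, div_eq_mul_inv]
  simp only [Pi.neg_apply] at h2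
  rw [h3] at h2
  refine h2.congr_fderiv (ContinuousLinearMap.ext fun v => ?_)
  simp only [rowForm_apply, heatKernel₁, heatKernel₂, smul_apply,
    add_apply,
    neg_apply, smul_eq_mul, Fin.sum_univ_three, PiLp.proj_apply]
  fin_cases k <;> simp <;> field_simp <;> ring

lemma pd_pd_heatKernel (j k : Fin 3) {t : ℝ} (ht : t ≠ 0) (x : E3) :
    pd j (pd k (heatKernel t)) x = heatKernel₂ j k t x := by
  rw [pd_heatKernel]; exact pd_eq (hasFDerivAt_heatKernel₁ k ht x) j

lemma hasFDerivAt_heatKernel₂ (j k : Fin 3) {t : ℝ} (ht : t ≠ 0) (x : E3) :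
    HasFDerivAt (heatKernel₂ j k t) (rowForm fun h => heatKernel₃ h j k t x) x := by
  have h2 := ((((hasFDerivAt_coord j x).mul (hasFDerivAt_coord k x)).mul_const
    (4 * t ^ 2)⁻¹).sub_const ((if j = k then 1 else 0) / (2 * t))).mul (hasFDerivAt_heatKernel t x)
  have h3 : ((fun y : E3 => y j * y k * (4 * t ^ 2)⁻¹ - (if j = k then 1 else 0) / (2 * t)) *
      heatKernel t) = heatKernel₂ j k t := by
    funext y; simp [heatKernel₂, div_eq_mul_inv]
  simp only [Pi.mul_apply] at h2
  rw [h3] at h2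
  refine h2.congr_fderiv (ContinuousLinearMap.ext fun v => ?_)
  simp only [rowForm_apply, heatKernel₁, heatKernel₃, smul_apply,
    add_apply, smul_eq_mul, Fin.sum_univ_three, PiLp.proj_apply]
  fin_cases j <;> fin_cases k <;> simp <;> field_simp <;> ring

/-! ### Gaussian bounds -/

/-- With z = ρ/r one has (1 + z)^N ≤ e^{Nz}, and Nz - z²/4 ≤ N² by completing the square. The
exponent N stays free: it is later tied to the decay rates of the data. -/
lemma exp_neg_sq_le {r ρ N : ℝ} (hr : 0 < r) (hρ : 0 ≤ ρ) (hN : 0 ≤ N) :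
    Real.exp (-ρ ^ 2 / (4 * r ^ 2)) ≤ Real.exp (N ^ 2) * (r ^ N * (r + ρ) ^ (-N)) := by
  have h1 : (r + ρ) ^ N ≤ r ^ N * Real.exp (N * (ρ / r)) := by
    have : r + ρ = r * (1 + ρ / r) := by field_simp
    rw [this, Real.mul_rpow hr.le (by positivity)]
    refine mul_le_mul_of_nonneg_left ?_ (by positivity)
    rw [mul_comm N, Real.exp_mul]
    refine Real.rpow_le_rpow (by positivity) ?_ hN
    linarith [Real.add_one_le_exp (ρ / r)]
  have h2 : Real.exp (-ρ ^ 2 / (4 * r ^ 2)) * Real.exp (N * (ρ / r)) ≤ Real.exp (N ^ 2) := by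
    rw [← Real.exp_add]
    refine Real.exp_le_exp.2 ?_
    have : -ρ ^ 2 / (4 * r ^ 2) = -(ρ / r) ^ 2 / 4 := by field_simp
    rw [this]
    nlinarith [sq_nonneg (ρ / r / 2 - N)]
  have h3 : 0 < (r + ρ) ^ N := by positivity
  rw [Real.rpow_neg (by positivity), ← mul_assoc, ← div_eq_mul_inv, le_div_iff₀ h3]
  calc Real.exp (-ρ ^ 2 / (4 * r ^ 2)) * (r + ρ) ^ N
      ≤ Real.exp (-ρ ^ 2 / (4 * r ^ 2)) * (r ^ N * Real.exp (N * (ρ / r))) := by gcongr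
    _ = r ^ N * (Real.exp (-ρ ^ 2 / (4 * r ^ 2)) * Real.exp (N * (ρ / r))) := by ring
    _ ≤ r ^ N * Real.exp (N ^ 2) := by gcongr
    _ = _ := by ring

lemma heatKernel_nonneg {t : ℝ} (ht : 0 < t) (x : E3) : 0 ≤ heatKernel t x := by
  unfold heatKernel; positivity

/-- Any N may be chosen: it trades powers of √t for spatial decay at fixed parabolic degree -3. Each
derivative lowers the degree by one. Large N is what permits temperature decay of arbitrary order b.
-/
lemma heatKernel_le {t N : ℝ} (ht : 0 < t) (hN : 0 ≤ N) (x : E3) :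
    heatKernel t x ≤ Real.exp (N ^ 2) * (√t ^ (N - 3) * (√t + ‖x‖) ^ (-N)) := by
  have hs : 0 < √t := Real.sqrt_pos.2 ht
  have h0 := exp_neg_sq_le hs (norm_nonneg x) hN
  rw [Real.sq_sqrt ht.le] at h0
  have h1 : (4 * Real.pi * t) ^ (-(3 / 2) : ℝ) ≤ √t ^ (-3 : ℝ) := by
    have : √t ^ (-3 : ℝ) = t ^ (-(3 / 2) : ℝ) := by
      rw [Real.sqrt_eq_rpow, ← Real.rpow_mul ht.le]; norm_num
    rw [this]
    refine Real.rpow_le_rpow_of_nonpos ht ?_ (by norm_num)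
    nlinarith [Real.pi_gt_three]
  unfold heatKernel
  calc _ ≤ √t ^ (-3 : ℝ) * (Real.exp (N ^ 2) * (√t ^ N * (√t + ‖x‖) ^ (-N))) := by gcongr
    _ = _ := by rw [sub_eq_add_neg, Real.rpow_add hs]; ring

/-- A monomial of degree `n` times the Gaussian. -/
lemma norm_pow_mul_heatKernel_le {t N : ℝ} (ht : 0 < t) (hN : 0 ≤ N) (n : ℕ) (x : E3) :
    ‖x‖ ^ n * heatKernel t x ≤
      Real.exp ((N + n) ^ 2) * (√t ^ (N + n - 3) * (√t + ‖x‖) ^ (-N)) := by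
  have hs : 0 < √t := Real.sqrt_pos.2 ht
  have hp : 0 < √t + ‖x‖ := by positivity
  have h := heatKernel_le (N := N + n) ht (by positivity) x
  have hG := heatKernel_nonneg ht x
  have h2 : ‖x‖ ^ n ≤ (√t + ‖x‖) ^ (n : ℝ) := by
    rw [Real.rpow_natCast]; gcongr; linarith
  calc _ ≤ (√t + ‖x‖) ^ (n : ℝ) *
        (Real.exp ((N + n) ^ 2) * (√t ^ (N + n - 3) * (√t + ‖x‖) ^ (-(N + n)))) := by
        gcongr
    _ = _ := by
        have : (√t + ‖x‖) ^ (-N) = (√t + ‖x‖) ^ (n : ℝ) * (√t + ‖x‖) ^ (-(N + n)) := by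
          rw [← Real.rpow_add hp]; congr 1; ring
        rw [this]; ring

lemma sqrt_rpow_div_pow {t p : ℝ} (ht : 0 < t) (n : ℕ) :
    √t ^ p / t ^ n = √t ^ (p - 2 * n) := by
  have hs : 0 < √t := Real.sqrt_pos.2 ht
  rw [Real.rpow_sub hs, Real.rpow_mul hs.le, Real.rpow_natCast, Real.rpow_two, Real.sq_sqrt ht.le]

lemma heatKernel₁_le {t N : ℝ} (ht : 0 < t) (hN : 0 ≤ N) (k : Fin 3) (x : E3) :
    |heatKernel₁ k t x| ≤
      Real.exp ((N + 1) ^ 2) * (√t ^ (N - 4) * (√t + ‖x‖) ^ (-N)) := by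
  have h := norm_pow_mul_heatKernel_le ht hN 1 x
  have hG := heatKernel_nonneg ht x
  rw [heatKernel₁, abs_mul, abs_div, abs_neg, abs_of_nonneg hG, abs_of_pos (show 0 < 2 * t by linarith)]
  calc |x k| / (2 * t) * heatKernel t x ≤ ‖x‖ / (1 * t) * heatKernel t x := by
        gcongr
        · exact abs_coord_le x k
        · norm_num
    _ = ‖x‖ ^ 1 * heatKernel t x / t := by ring
    _ ≤ Real.exp ((N + (1 : ℕ)) ^ 2) * (√t ^ (N + (1 : ℕ) - 3) * (√t + ‖x‖) ^ (-N)) / t := by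
        gcongr
    _ = Real.exp ((N + 1) ^ 2) * ((√t ^ (N + 1 - 3) / t ^ 1) * (√t + ‖x‖) ^ (-N)) := by
        push_cast; ring
    _ = _ := by
        rw [sqrt_rpow_div_pow ht]; congr 3; push_cast; ring_nf

lemma abs_ite_le (p : Prop) [Decidable p] : |(if p then (1 : ℝ) else 0)| ≤ 1 := by
  split_ifs <;> simp

lemma heatKernel₂_le {t N : ℝ} (ht : 0 < t) (hN : 0 ≤ N) (j k : Fin 3) (x : E3) :
    |heatKernel₂ j k t x| ≤
      2 * Real.exp ((N + 2) ^ 2) * (√t ^ (N - 5) * (√t + ‖x‖) ^ (-N)) := by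
  have h0 := heatKernel_le ht hN x
  have h2 := norm_pow_mul_heatKernel_le ht hN 2 x
  have hG := heatKernel_nonneg ht x
  have hx : |x j * x k / (4 * t ^ 2) - (if j = k then 1 else 0) / (2 * t)| ≤
      ‖x‖ ^ 2 / t ^ 2 + 1 / t := by
    refine (abs_sub _ _).trans (add_le_add ?_ ?_)
    · rw [abs_div, abs_mul, abs_of_pos (show 0 < 4 * t ^ 2 by positivity), pow_two ‖x‖]
      gcongr
      · exact abs_coord_le x j
      · exact abs_coord_le x k
      · nlinarith [sq_nonneg t]
    · rw [abs_div, abs_of_pos (show 0 < 2 * t by positivity)]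
      gcongr
      · exact abs_ite_le _
      · linarith
  rw [heatKernel₂, abs_mul, abs_of_nonneg hG]
  have e1 : Real.exp (N ^ 2) ≤ Real.exp ((N + 2) ^ 2) := by
    apply Real.exp_le_exp.2; nlinarith
  calc _ ≤ (‖x‖ ^ 2 / t ^ 2 + 1 / t) * heatKernel t x := by gcongr
    _ = (‖x‖ ^ 2 * heatKernel t x) / t ^ 2 + heatKernel t x / t ^ 1 := by ring
    _ ≤ Real.exp ((N + (2 : ℕ)) ^ 2) * (√t ^ (N + (2 : ℕ) - 3) * (√t + ‖x‖) ^ (-N)) / t ^ 2 +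
        Real.exp ((N + 2) ^ 2) * (√t ^ (N - 3) * (√t + ‖x‖) ^ (-N)) / t ^ 1 := by
        gcongr; exact h0.trans (by gcongr)
    _ = Real.exp ((N + 2) ^ 2) * (√t ^ (N + 2 - 3) / t ^ 2 + √t ^ (N - 3) / t ^ 1) *
          (√t + ‖x‖) ^ (-N) := by push_cast; ring
    _ = _ := by
        rw [sqrt_rpow_div_pow ht, sqrt_rpow_div_pow ht]
        have e1 : N + 2 - 3 - 2 * ((2 : ℕ) : ℝ) = N - 5 := by push_cast; ring
        have e2 : N - 3 - 2 * ((1 : ℕ) : ℝ) = N - 5 := by push_cast; ring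
        rw [e1, e2]; ring

lemma heatKernel₃_le {t N : ℝ} (ht : 0 < t) (hN : 0 ≤ N) (h j k : Fin 3) (x : E3) :
    |heatKernel₃ h j k t x| ≤
      2 * Real.exp ((N + 3) ^ 2) * (√t ^ (N - 6) * (√t + ‖x‖) ^ (-N)) := by
  have h1 := norm_pow_mul_heatKernel_le ht hN 1 x
  have h3 := norm_pow_mul_heatKernel_le ht hN 3 x
  have hG := heatKernel_nonneg ht x
  have hd : ∀ p q r : Fin 3, |(if p = q then (1 : ℝ) else 0) * x r| ≤ ‖x‖ := fun p q r => by
    rw [abs_mul]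
    calc _ ≤ 1 * ‖x‖ := mul_le_mul (abs_ite_le _) (abs_coord_le x r) (abs_nonneg _) zero_le_one
      _ = _ := one_mul _
  have hx : |-(x h * x j * x k) / (8 * t ^ 3) + ((if h = j then 1 else 0) * x k +
      (if h = k then 1 else 0) * x j + (if j = k then 1 else 0) * x h) / (4 * t ^ 2)| ≤
      ‖x‖ ^ 3 / t ^ 3 + ‖x‖ / t ^ 2 := by
    refine (abs_add_le _ _).trans (add_le_add ?_ ?_)
    · rw [abs_div, abs_neg, abs_mul, abs_mul, abs_of_pos (show 0 < 8 * t ^ 3 by positivity),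
        show ‖x‖ ^ 3 = ‖x‖ * ‖x‖ * ‖x‖ by ring]
      gcongr
      · exact abs_coord_le x h
      · exact abs_coord_le x j
      · exact abs_coord_le x k
      · nlinarith [pow_pos ht 3]
    · rw [abs_div, abs_of_pos (show 0 < 4 * t ^ 2 by positivity),
        div_le_div_iff₀ (by positivity) (by positivity)]
      have := (abs_add_le ((if h = j then 1 else 0) * x k + (if h = k then 1 else 0) * x j)
        ((if j = k then 1 else 0) * x h)).trans
        (add_le_add (abs_add_le _ _) le_rfl)
      have h' : |(if h = j then 1 else 0) * x k + (if h = k then 1 else 0) * x j +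
        (if j = k then 1 else 0) * x h| ≤ 4 * ‖x‖ := by
        linarith [hd h j k, hd h k j, hd j k h, norm_nonneg x]
      calc _ ≤ 4 * ‖x‖ * t ^ 2 := by gcongr
        _ = _ := by ring
  rw [heatKernel₃, abs_mul, abs_of_nonneg hG]
  have e1 : Real.exp ((N + (1 : ℕ)) ^ 2) ≤ Real.exp ((N + 3) ^ 2) := by
    apply Real.exp_le_exp.2; push_cast; nlinarith
  calc _ ≤ (‖x‖ ^ 3 / t ^ 3 + ‖x‖ / t ^ 2) * heatKernel t x := by gcongr
    _ = (‖x‖ ^ 3 * heatKernel t x) / t ^ 3 + (‖x‖ ^ 1 * heatKernel t x) / t ^ 2 := by ring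
    _ ≤ Real.exp ((N + (3 : ℕ)) ^ 2) * (√t ^ (N + (3 : ℕ) - 3) * (√t + ‖x‖) ^ (-N)) / t ^ 3 +
        Real.exp ((N + 3) ^ 2) * (√t ^ (N + (1 : ℕ) - 3) * (√t + ‖x‖) ^ (-N)) / t ^ 2 := by
        gcongr ?_ / _ + ?_ / _
        exact h1.trans (by gcongr)
    _ = Real.exp ((N + 3) ^ 2) * (√t ^ (N + 3 - 3) / t ^ 3 + √t ^ (N + 1 - 3) / t ^ 2) *
          (√t + ‖x‖) ^ (-N) := by push_cast; ring
    _ = _ := by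
        rw [sqrt_rpow_div_pow ht, sqrt_rpow_div_pow ht]
        have e1 : N + 3 - 3 - 2 * ((3 : ℕ) : ℝ) = N - 6 := by push_cast; ring
        have e2 : N + 1 - 3 - 2 * ((2 : ℕ) : ℝ) = N - 6 := by push_cast; ring
        rw [e1, e2]; ring

/-! ### Model integrals -/

/-- `∫ (1 + |z|)^{-p} dz`. -/
def tailConst (p : ℝ) : ℝ := ∫ z : E3, (1 + ‖z‖) ^ (-p)

/-- `∫_{|y| < 1} |y|^{-β} dy`. -/
def ballConst (β : ℝ) : ℝ := ∫ y in Metric.ball (0 : E3) 1, ‖y‖ ^ (-β)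

lemma tailConst_nonneg (p : ℝ) : 0 ≤ tailConst p := integral_nonneg fun _ => by positivity

lemma ballConst_nonneg (β : ℝ) : 0 ≤ ballConst β := integral_nonneg fun _ => by positivity

lemma finrank_E3 : Module.finrank ℝ E3 = 3 := by simp

lemma integrable_add_norm_rpow {r p : ℝ} (hr : 0 < r) (hp : 3 < p) :
    Integrable (fun z : E3 => (r + ‖z‖) ^ (-p)) ∧
      ∫ z : E3, (r + ‖z‖) ^ (-p) = tailConst p * r ^ (3 - p) := by
  have h1 : Integrable (fun z : E3 => (1 + ‖z‖) ^ (-p)) :=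
    integrable_one_add_norm (by rw [finrank_E3]; exact_mod_cast hp)
  have e : (fun z : E3 => (r + ‖z‖) ^ (-p)) = fun z => r ^ (-p) * (1 + ‖r⁻¹ • z‖) ^ (-p) := by
    funext z
    rw [← Real.mul_rpow hr.le (by positivity), norm_smul, Real.norm_of_nonneg (by positivity)]
    congr 1; field_simp
  rw [e]
  refine ⟨(h1.comp_smul (inv_ne_zero hr.ne')).const_mul _, ?_⟩
  rw [integral_const_mul, Measure.integral_comp_smul volume (fun z : E3 => (1 + ‖z‖) ^ (-p)),
    finrank_E3, abs_of_pos (by positivity), smul_eq_mul, tailConst, sub_eq_add_neg,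
    Real.rpow_add hr]
  have : (r⁻¹ ^ 3)⁻¹ = r ^ (3 : ℝ) := by rw [inv_pow, inv_inv]; norm_cast
  rw [this]; ring

lemma integrable_add_norm_sub_rpow {r p : ℝ} (hr : 0 < r) (hp : 3 < p) (x : E3) :
    Integrable (fun y : E3 => (r + ‖x - y‖) ^ (-p)) ∧
      ∫ y : E3, (r + ‖x - y‖) ^ (-p) = tailConst p * r ^ (3 - p) := by
  obtain ⟨h1, h2⟩ := integrable_add_norm_rpow hr hp
  refine ⟨h1.comp_sub_left x, ?_⟩
  rw [integral_sub_left_eq_self (fun z : E3 => (r + ‖z‖) ^ (-p)) volume x, h2]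

lemma integrableOn_ball_norm_rpow {β R : ℝ} (hβ : β < 3) (hR : 0 < R) :
    IntegrableOn (fun y : E3 => ‖y‖ ^ (-β)) (Metric.ball 0 R) ∧
      ∫ y in Metric.ball (0 : E3) R, ‖y‖ ^ (-β) = ballConst β * R ^ (3 - β) := by
  have h1 : IntegrableOn (fun y : E3 => ‖y‖ ^ (-β)) (Metric.ball 0 R) := by
    rw [← integrable_indicator_iff Metric.isOpen_ball.measurableSet]
    have e : (Metric.ball (0 : E3) R).indicator (fun y : E3 => ‖y‖ ^ (-β)) =
        fun y => (Set.Iio R).indicator (fun s : ℝ => s ^ (-β)) ‖y‖ := by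
      funext y
      simp [Set.indicator, Metric.mem_ball]
    rw [e, integrable_fun_norm_addHaar volume, finrank_E3]
    have h2 : IntegrableOn (fun s : ℝ => s ^ (2 - β)) (Set.Ioo 0 R) :=
      (intervalIntegral.integrableOn_Ioo_rpow_iff hR).2 (by linarith)
    rw [← integrable_indicator_iff measurableSet_Ioo] at h2
    rw [← integrable_indicator_iff measurableSet_Ioi]
    refine h2.congr (Filter.Eventually.of_forall fun s => ?_)
    by_cases h0 : 0 < s
    · by_cases hs : s < R
      · simp only [Set.indicator, Set.mem_Ioo, h0, hs, and_self, if_true, Set.mem_Ioi, Set.mem_Iio,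
          smul_eq_mul]
        rw [sub_eq_add_neg, Real.rpow_add h0]; norm_cast
      · simp [Set.indicator, h0, hs]
    · simp [Set.indicator, h0]
  refine ⟨h1, ?_⟩
  have h3 := Measure.setIntegral_comp_smul_of_pos volume (fun y : E3 => ‖y‖ ^ (-β))
    (Metric.ball 0 1) hR
  rw [finrank_E3, smul_unitBall_of_pos hR] at h3
  have h4 : ∫ y in Metric.ball (0 : E3) 1, ‖R • y‖ ^ (-β) = R ^ (-β) * ballConst β := by
    rw [ballConst, ← integral_const_mul]
    refine integral_congr_ae (Filter.Eventually.of_forall fun y => ?_)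
    simp only [norm_smul, Real.norm_of_nonneg hR.le]
    rw [Real.mul_rpow hR.le (norm_nonneg _)]
  rw [h4, smul_eq_mul] at h3
  have h5 : R ^ (3 - β) = R ^ 3 * R ^ (-β) := by
    rw [sub_eq_add_neg, Real.rpow_add hR]; norm_cast
  rw [h5]
  field_simp at h3
  linarith

/-- The integrand is the exact derivative of -(2/(p-1)) (√s + c)^{1-p}; hence the habit of bringing
the time factor to √s^{-1} before integrating. -/
lemma integral_Ioi_sqrt_add_rpow {c t p : ℝ} (hc : 0 ≤ c) (ht : 0 < t) (hp : 1 < p) :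
    IntegrableOn (fun s => √s ^ (-1 : ℝ) * (√s + c) ^ (-p)) (Set.Ioi t) ∧
      ∫ s in Set.Ioi t, √s ^ (-1 : ℝ) * (√s + c) ^ (-p) = 2 / (p - 1) * (√t + c) ^ (1 - p) := by
  have hd : ∀ s : ℝ, 0 < s → HasDerivAt (fun s => -(2 / (p - 1)) * (√s + c) ^ (1 - p))
      (√s ^ (-1 : ℝ) * (√s + c) ^ (-p)) s := by
    intro s hs
    have hs' : 0 < √s := Real.sqrt_pos.2 hs
    have h := ((((hasDerivAt_id s).sqrt hs.ne').add_const c).rpow_const (p := 1 - p)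
      (Or.inl (by simp only [id]; positivity))).const_mul (-(2 / (p - 1)))
    refine h.congr_deriv ?_
    have : 1 - p - 1 = -p := by ring
    simp only [id, this]
    rw [Real.rpow_neg_one]
    have hp' : p - 1 ≠ 0 := by linarith
    field_simp; ring
  have hc' : ContinuousWithinAt (fun s => -(2 / (p - 1)) * (√s + c) ^ (1 - p)) (Set.Ici t) t :=
    (hd t ht).continuousAt.continuousWithinAt
  have hd' : ∀ s ∈ Set.Ioi t, HasDerivAt (fun s => -(2 / (p - 1)) * (√s + c) ^ (1 - p))
      (√s ^ (-1 : ℝ) * (√s + c) ^ (-p)) s := fun s hs => hd s (ht.trans hs)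
  have hn : ∀ s ∈ Set.Ioi t, 0 ≤ √s ^ (-1 : ℝ) * (√s + c) ^ (-p) := fun s _ => by positivity
  have hl : Filter.Tendsto (fun s => -(2 / (p - 1)) * (√s + c) ^ (1 - p)) Filter.atTop
      (nhds (-(2 / (p - 1)) * 0)) := by
    refine Filter.Tendsto.const_mul _ ?_
    have : Filter.Tendsto (fun s : ℝ => √s + c) Filter.atTop Filter.atTop :=
      Filter.tendsto_atTop_add_const_right _ _ Real.tendsto_sqrt_atTop
    have h2 := (tendsto_rpow_neg_atTop (y := p - 1) (by linarith)).comp this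
    simpa [Function.comp_def] using h2
  refine ⟨integrableOn_Ioi_deriv_of_nonneg hc' hd' hn hl, ?_⟩
  rw [integral_Ioi_of_hasDerivAt_of_nonneg hc' hd' hn hl]
  ring

/-! ### The Oseen kernel -/

lemma measurable_heatKernel : Measurable fun p : ℝ × E3 => heatKernel p.1 p.2 := by
  unfold heatKernel; fun_prop

lemma measurable_coord (j : Fin 3) : Measurable fun x : E3 => x j :=
  (EuclideanSpace.proj j : E3 →L[ℝ] ℝ).continuous.measurable

lemma measurable_heatKernel₁ (k : Fin 3) :
    Measurable fun p : ℝ × E3 => heatKernel₁ k p.1 p.2 := by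
  have := measurable_heatKernel
  have : ∀ j : Fin 3, Measurable fun p : ℝ × E3 => p.2 j := fun j =>
    (measurable_coord j).comp measurable_snd
  unfold heatKernel₁; fun_prop

lemma measurable_heatKernel₂ (j k : Fin 3) :
    Measurable fun p : ℝ × E3 => heatKernel₂ j k p.1 p.2 := by
  have := measurable_heatKernel
  have : ∀ j : Fin 3, Measurable fun p : ℝ × E3 => p.2 j := fun j =>
    (measurable_coord j).comp measurable_snd
  unfold heatKernel₂; fun_prop

lemma measurable_heatKernel₃ (h j k : Fin 3) :
    Measurable fun p : ℝ × E3 => heatKernel₃ h j k p.1 p.2 := by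
  have := measurable_heatKernel
  have : ∀ j : Fin 3, Measurable fun p : ℝ × E3 => p.2 j := fun j =>
    (measurable_coord j).comp measurable_snd
  unfold heatKernel₃; fun_prop

lemma oseenKernel_eq {t : ℝ} (ht : 0 < t) (j k : Fin 3) (x : E3) :
    oseenKernel t j k x =
      (if j = k then 1 else 0) * heatKernel t x + ∫ s in Set.Ioi t, heatKernel₂ j k s x := by
  rw [oseenKernel]
  congr 1
  · simp
  · exact setIntegral_congr_fun measurableSet_Ioi fun s hs =>
      pd_pd_heatKernel j k (ht.trans hs).ne' x

/-- The explicit form of `oseenDivKernel`. -/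
def oseenKernel₁ (j h k : Fin 3) (t : ℝ) (x : E3) : ℝ :=
  (if j = k then 1 else 0) * heatKernel₁ h t x + ∫ s in Set.Ioi t, heatKernel₃ h j k s x

/-- N = 4 is the order that leaves exactly √s^{-1}; for third derivatives it is N = 5. -/
lemma heatKernel₂_le' {s : ℝ} (hs : 0 < s) (j k : Fin 3) (x : E3) :
    |heatKernel₂ j k s x| ≤ 2 * Real.exp 36 * (√s ^ (-1 : ℝ) * (√s + ‖x‖) ^ (-4 : ℝ)) := by
  have h := heatKernel₂_le (N := 4) hs (by norm_num) j k x
  norm_num at h ⊢; exact h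

lemma heatKernel₃_le' {s : ℝ} (hs : 0 < s) (h j k : Fin 3) (x : E3) :
    |heatKernel₃ h j k s x| ≤ 2 * Real.exp 64 * (√s ^ (-1 : ℝ) * (√s + ‖x‖) ^ (-5 : ℝ)) := by
  have h := heatKernel₃_le (N := 5) hs (by norm_num) h j k x
  norm_num at h ⊢; exact h

lemma integrableOn_heatKernel₂ {t : ℝ} (ht : 0 < t) (j k : Fin 3) (x : E3) :
    IntegrableOn (fun s => heatKernel₂ j k s x) (Set.Ioi t) :=
  ((integral_Ioi_sqrt_add_rpow (p := 4) (norm_nonneg x) ht (by norm_num)).1.const_mul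
    (2 * Real.exp 36)).mono'
    ((measurable_heatKernel₂ j k).comp measurable_prodMk_right).aestronglyMeasurable
    ((ae_restrict_iff' measurableSet_Ioi).2 (Filter.Eventually.of_forall fun s hs =>
      heatKernel₂_le' (ht.trans hs) j k x))

lemma integrableOn_heatKernel₃ {t : ℝ} (ht : 0 < t) (h j k : Fin 3) (x : E3) :
    IntegrableOn (fun s => heatKernel₃ h j k s x) (Set.Ioi t) :=
  ((integral_Ioi_sqrt_add_rpow (p := 5) (norm_nonneg x) ht (by norm_num)).1.const_mul
    (2 * Real.exp 64)).mono'
    ((measurable_heatKernel₃ h j k).comp measurable_prodMk_right).aestronglyMeasurable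
    ((ae_restrict_iff' measurableSet_Ioi).2 (Filter.Eventually.of_forall fun s hs =>
      heatKernel₃_le' (ht.trans hs) h j k x))

lemma hasFDerivAt_oseenKernel {t : ℝ} (ht : 0 < t) (j k : Fin 3) (x : E3) :
    HasFDerivAt (oseenKernel t j k) (rowForm fun h => oseenKernel₁ j h k t x) x := by
  have hmeas : ∀ x : E3, AEStronglyMeasurable (fun s => rowForm fun h => heatKernel₃ h j k s x)
      (volume.restrict (Set.Ioi t)) := fun x => by
    refine Measurable.aestronglyMeasurable ?_
    unfold rowForm
    refine Finset.measurable_sum _ fun h _ => Measurable.smul_const ?_ _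
    exact (measurable_heatKernel₃ h j k).comp measurable_prodMk_right
  have key : HasFDerivAt (fun x => ∫ s in Set.Ioi t, heatKernel₂ j k s x)
      (∫ s in Set.Ioi t, rowForm fun h => heatKernel₃ h j k s x) x := by
    refine hasFDerivAt_integral_of_dominated_of_fderiv_le (s := Set.univ)
      (F' := fun x s => rowForm fun h => heatKernel₃ h j k s x)
      -- The kernel bound with ‖y‖ replaced by 0: a majorant uniform in the base point.
      (bound := fun s => ∑ _h : Fin 3, 2 * Real.exp 64 * (√s ^ (-1 : ℝ) * (√s + 0) ^ (-5 : ℝ)))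
      Filter.univ_mem
      (Filter.Eventually.of_forall fun y => (integrableOn_heatKernel₂ ht j k y).1)
      (integrableOn_heatKernel₂ ht j k x) (hmeas x) ?_ ?_ ?_
    · refine (ae_restrict_iff' measurableSet_Ioi).2 (Filter.Eventually.of_forall fun s hs y _ => ?_)
      refine (norm_rowForm_le _).trans (Finset.sum_le_sum fun h _ => ?_)
      have hs' : 0 < √s := Real.sqrt_pos.2 (ht.trans hs)
      refine (heatKernel₃_le' (ht.trans hs) h j k y).trans ?_
      gcongr ?_ * (?_ * ?_)
      refine Real.rpow_le_rpow_of_nonpos (by positivity) ?_ (by norm_num)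
      gcongr; positivity
    · exact integrable_finsetSum _ fun h _ =>
        (integral_Ioi_sqrt_add_rpow (p := 5) le_rfl ht (by norm_num)).1.const_mul _
    · exact (ae_restrict_iff' measurableSet_Ioi).2 (Filter.Eventually.of_forall fun s hs y _ =>
        hasFDerivAt_heatKernel₂ j k (ht.trans hs).ne' y)
  have h1 := ((hasFDerivAt_heatKernel t x).const_mul (if j = k then (1 : ℝ) else 0)).add key
  have e : oseenKernel t j k = (fun x => (if j = k then (1 : ℝ) else 0) * heatKernel t x) +
      fun x => ∫ s in Set.Ioi t, heatKernel₂ j k s x := by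
    funext x; exact oseenKernel_eq ht j k x
  rw [e]
  refine h1.congr_fderiv ?_
  have h2 : (∫ s in Set.Ioi t, rowForm fun h => heatKernel₃ h j k s x) =
      rowForm fun h => ∫ s in Set.Ioi t, heatKernel₃ h j k s x := by
    unfold rowForm
    rw [integral_finsetSum _ fun h _ => (integrableOn_heatKernel₃ ht h j k x).smul_const _]
    exact Finset.sum_congr rfl fun h _ => integral_smul_const _ _
  rw [h2]
  simp only [rowForm, Finset.smul_sum, oseenKernel₁, add_smul, Finset.sum_add_distrib, mul_smul]

lemma oseenDivKernel_eq {t : ℝ} (ht : 0 < t) (j h k : Fin 3) (x : E3) :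
    oseenDivKernel t j h k x = oseenKernel₁ j h k t x := by
  rw [oseenDivKernel, pd_eq (hasFDerivAt_oseenKernel ht j k x)]

/-- A common constant for the pointwise bounds on the Oseen kernel. -/
def oseenConst : ℝ := 3 * Real.exp 64

lemma oseenConst_pos : 0 < oseenConst := by unfold oseenConst; positivity

/-- Integrating the second derivatives of the heat kernel over s > t keeps the degree -3 but loses
the fast spatial decay. The power 3 is just not integrable at infinity, unlike the power 4 of the
first derivatives; this shapes the linear estimates for the velocity. -/
lemma oseenKernel_le {t : ℝ} (ht : 0 < t) (j k : Fin 3) (x : E3) :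
    |oseenKernel t j k x| ≤ oseenConst * (√t + ‖x‖) ^ (-3 : ℝ) := by
  have h0 := heatKernel_le (N := 3) ht (by norm_num) x
  rw [sub_self, Real.rpow_zero, one_mul] at h0
  obtain ⟨hi, he⟩ := integral_Ioi_sqrt_add_rpow (p := 4) (norm_nonneg x) ht (by norm_num)
  have h1 : ‖∫ s in Set.Ioi t, heatKernel₂ j k s x‖ ≤
      ∫ s in Set.Ioi t, 2 * Real.exp 36 * (√s ^ (-1 : ℝ) * (√s + ‖x‖) ^ (-4 : ℝ)) :=
    norm_integral_le_of_norm_le (hi.const_mul _) ((ae_restrict_iff' measurableSet_Ioi).2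
      (Filter.Eventually.of_forall fun s hs => heatKernel₂_le' (ht.trans hs) j k x))
  rw [integral_const_mul, he, Real.norm_eq_abs, show (1 - 4 : ℝ) = -3 by norm_num] at h1
  rw [oseenKernel_eq ht]
  have e1 : Real.exp (3 ^ 2) ≤ Real.exp 64 := Real.exp_le_exp.2 (by norm_num)
  have e2 : Real.exp 36 ≤ Real.exp 64 := Real.exp_le_exp.2 (by norm_num)
  have hp : 0 ≤ (√t + ‖x‖) ^ (-3 : ℝ) := by positivity
  refine (abs_add_le _ _).trans ?_
  rw [abs_mul, abs_of_nonneg (heatKernel_nonneg ht x)]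
  have h3 := mul_le_mul (abs_ite_le (j = k)) h0 (heatKernel_nonneg ht x) zero_le_one
  have h4 := mul_le_mul_of_nonneg_right e1 hp
  have h5 := mul_le_mul_of_nonneg_right e2 hp
  have h6 := mul_nonneg (Real.exp_pos 64).le hp
  unfold oseenConst
  linarith

lemma oseenKernel₁_le {t : ℝ} (ht : 0 < t) (j h k : Fin 3) (x : E3) :
    |oseenKernel₁ j h k t x| ≤ oseenConst * (√t + ‖x‖) ^ (-4 : ℝ) := by
  have h0 := heatKernel₁_le (N := 4) ht (by norm_num) h x
  rw [sub_self, Real.rpow_zero, one_mul] at h0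
  obtain ⟨hi, he⟩ := integral_Ioi_sqrt_add_rpow (p := 5) (norm_nonneg x) ht (by norm_num)
  have h1 : ‖∫ s in Set.Ioi t, heatKernel₃ h j k s x‖ ≤
      ∫ s in Set.Ioi t, 2 * Real.exp 64 * (√s ^ (-1 : ℝ) * (√s + ‖x‖) ^ (-5 : ℝ)) :=
    norm_integral_le_of_norm_le (hi.const_mul _) ((ae_restrict_iff' measurableSet_Ioi).2
      (Filter.Eventually.of_forall fun s hs => heatKernel₃_le' (ht.trans hs) h j k x))
  rw [integral_const_mul, he, Real.norm_eq_abs, show (1 - 5 : ℝ) = -4 by norm_num] at h1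
  have e1 : Real.exp ((4 + 1) ^ 2) ≤ Real.exp 64 := Real.exp_le_exp.2 (by norm_num)
  have hp : 0 ≤ (√t + ‖x‖) ^ (-4 : ℝ) := by positivity
  refine (abs_add_le _ _).trans ?_
  rw [abs_mul]
  have h3 := mul_le_mul (abs_ite_le (j = k)) h0 (abs_nonneg _) zero_le_one
  have h4 := mul_le_mul_of_nonneg_right e1 hp
  have h6 := mul_nonneg (Real.exp_pos 64).le hp
  unfold oseenConst
  linarith

lemma measurable_setIntegral_Ioi {f : ℝ → E3 → ℝ} (hf : Measurable fun p : ℝ × E3 => f p.1 p.2) :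
    Measurable fun p : ℝ × E3 => ∫ s in Set.Ioi p.1, f s p.2 := by
  have e : (fun p : ℝ × E3 => ∫ s in Set.Ioi p.1, f s p.2) =
      fun p => ∫ s, (if p.1 < s then f s p.2 else 0) := by
    funext p
    rw [← integral_indicator measurableSet_Ioi]
    rfl
  rw [e]
  have : Measurable fun q : (ℝ × E3) × ℝ => if q.1.1 < q.2 then f q.2 q.1.2 else 0 :=
    Measurable.ite (measurableSet_lt (by fun_prop) (by fun_prop))
      (hf.comp (measurable_snd.prodMk (measurable_snd.comp measurable_fst))) measurable_const
  exact this.stronglyMeasurable.integral_prod_right'.measurable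

lemma measurable_oseenKernel₁ (j h k : Fin 3) :
    Measurable fun p : ℝ × E3 => oseenKernel₁ j h k p.1 p.2 :=
  ((measurable_heatKernel₁ h).const_mul _).add (measurable_setIntegral_Ioi (measurable_heatKernel₃ h j k))

/-- The explicit form of `oseenKernel`. -/
def oseenKernel₀ (j k : Fin 3) (t : ℝ) (x : E3) : ℝ :=
  (if j = k then 1 else 0) * heatKernel t x + ∫ s in Set.Ioi t, heatKernel₂ j k s x

lemma measurable_oseenKernel₀ (j k : Fin 3) :
    Measurable fun p : ℝ × E3 => oseenKernel₀ j k p.1 p.2 :=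
  (measurable_heatKernel.const_mul _).add (measurable_setIntegral_Ioi (measurable_heatKernel₂ j k))

/-! ### Scalar Duhamel integrals -/

/-- `∫₀ᵗ ∫ k(t-s, x-y) f(s, y) dy ds`. -/
def duh (k f : ℝ → E3 → ℝ) (t : ℝ) (x : E3) : ℝ := ∫ s in (0 : ℝ)..t, ∫ y, k (t - s) (x - y) * f s y

/-- Joint measurability on `(0,∞) × ℝ³`. -/
def Meas {V : Type} [MeasurableSpace V] (f : ℝ → E3 → V) : Prop :=
  Measurable fun p : Set.Ioi (0 : ℝ) × E3 => f p.1 p.2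

/-- Solutions are measurable only for positive times, while the parametric integrals are measured on
the whole line. -/
lemma Meas.extend {f : ℝ → E3 → ℝ} (hf : Meas f) :
    Measurable fun p : ℝ × E3 => if 0 < p.1 then f p.1 p.2 else 0 := by
  have hS : MeasurableSet {p : ℝ × E3 | 0 < p.1} := measurableSet_lt measurable_const measurable_fst
  refine measurable_of_restrict_of_restrict_compl hS ?_ ?_
  · have h1 : Measurable fun p : {p : ℝ × E3 | 0 < p.1} =>
        ((⟨p.1.1, p.2⟩, p.1.2) : Set.Ioi (0 : ℝ) × E3) :=
      (Measurable.subtype_mk (measurable_fst.comp measurable_subtype_coe)).prodMk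
        (measurable_snd.comp measurable_subtype_coe)
    convert hf.comp h1 using 1
    funext p
    have hp : 0 < p.1.1 := p.2
    simp [Set.domRestrict, hp]
  · convert measurable_const (a := (0 : ℝ)) using 1
    funext p
    have hp : ¬ 0 < p.1.1 := p.2
    simp [Set.domRestrict, hp]

lemma Meas.slice {V : Type} [MeasurableSpace V] {f : ℝ → E3 → V} (hf : Meas f) {s : ℝ}
    (hs : 0 < s) : Measurable (f s) :=
  hf.comp (measurable_prodMk_left (x := (⟨s, hs⟩ : Set.Ioi (0 : ℝ))))

lemma measurable_inner_integral {k f : ℝ → E3 → ℝ} (hk : Measurable fun p : ℝ × E3 => k p.1 p.2)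
    (hf : Meas f) :
    Measurable fun q : (ℝ × E3) × ℝ => ∫ y, k (q.1.1 - q.2) (q.1.2 - y) *
      (if 0 < q.2 then f q.2 y else 0) := by
  have h1 : Measurable fun q : ((ℝ × E3) × ℝ) × E3 => k (q.1.1.1 - q.1.2) (q.1.1.2 - q.2) *
      (if 0 < q.1.2 then f q.1.2 q.2 else 0) := by
    refine Measurable.mul ?_ ?_
    · exact hk.comp ((by fun_prop : Measurable fun q : ((ℝ × E3) × ℝ) × E3 =>
        ((q.1.1.1 - q.1.2, q.1.1.2 - q.2) : ℝ × E3)))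
    · exact hf.extend.comp ((by fun_prop : Measurable fun q : ((ℝ × E3) × ℝ) × E3 =>
        ((q.1.2, q.2) : ℝ × E3)))
  exact h1.stronglyMeasurable.integral_prod_right'.measurable

/-- The variable interval becomes a cut-off, so that measurability of integrals with parameters
applies. -/
lemma duh_eq {k f : ℝ → E3 → ℝ} {t : ℝ} (ht : 0 < t) (x : E3) :
    duh k f t x = ∫ s, if 0 < s ∧ s ≤ t then ∫ y, k (t - s) (x - y) *
      (if 0 < s then f s y else 0) else 0 := by
  rw [duh, intervalIntegral.integral_of_le ht.le, ← integral_indicator measurableSet_Ioc]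
  refine integral_congr_ae (Filter.Eventually.of_forall fun s => ?_)
  simp only [Set.indicator, Set.mem_Ioc]
  by_cases hs : 0 < s ∧ s ≤ t <;> simp [hs]

lemma Meas.duh {k f : ℝ → E3 → ℝ} (hk : Measurable fun p : ℝ × E3 => k p.1 p.2) (hf : Meas f) :
    Meas (duh k f) := by
  have h1 : Measurable fun q : (ℝ × E3) × ℝ => if 0 < q.2 ∧ q.2 ≤ q.1.1 then
      ∫ y, k (q.1.1 - q.2) (q.1.2 - y) * (if 0 < q.2 then f q.2 y else 0) else 0 := by
    refine Measurable.ite ?_ (measurable_inner_integral hk hf) measurable_const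
    exact (measurableSet_lt measurable_const measurable_snd).inter
      (measurableSet_le measurable_snd (measurable_fst.comp measurable_fst))
  have h2 := (h1.stronglyMeasurable.integral_prod_right' (ν := volume)).measurable
  have h3 : Measurable fun p : Set.Ioi (0 : ℝ) × E3 => ((p.1 : ℝ), p.2) := by fun_prop
  unfold Meas
  convert h2.comp h3 using 1
  funext p
  exact duh_eq p.1.2 p.2

/-- A kernel comparable to `t^e` times a first order derivative of the heat kernel; the exponent `N`
measures the off-diagonal decay. -/
structure KernelBound (k : ℝ → E3 → ℝ) (e : ℕ) (N C : ℝ) : Prop where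
  meas : Measurable fun p : ℝ × E3 => k p.1 p.2
  pos : 0 < C
  four_le : 4 ≤ N
  le_four : ∀ r : ℝ, 0 < r → ∀ z, |k r z| ≤ C * r ^ e * (√r + ‖z‖) ^ (-4 : ℝ)
  le_N : ∀ r : ℝ, 0 < r → ∀ z, |k r z| ≤ C * r ^ e * (√r ^ (N - 4) * (√r + ‖z‖) ^ (-N))

/-- The splitting of a source `f` on `(0,t) × ℝ³` at the parabolic distance `(√t + |x|) / 4`:
far from the origin it is bounded by `Γ`, close to it by `g(s) h(y)`. -/
structure SplitBound (f : ℝ → E3 → ℝ) (t : ℝ) (x : E3) (Γ : ℝ) (g : ℝ → ℝ) (h : E3 → ℝ) : Prop where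
  nonneg : 0 ≤ Γ
  g_nonneg : ∀ s, 0 ≤ g s
  h_nonneg : ∀ y, 0 ≤ h y
  g_int : IntervalIntegrable g volume 0 t
  h_int : IntegrableOn h (Metric.ball 0 (√t + ‖x‖))
  far : ∀ s, 0 < s → s < t → ∀ y, y ≠ 0 → (√t + ‖x‖) / 4 ≤ √s + ‖y‖ → |f s y| ≤ Γ
  near : ∀ s, 0 < s → s < t → ∀ y, y ≠ 0 → √s + ‖y‖ < (√t + ‖x‖) / 4 → |f s y| ≤ g s * h y

/-- Together with |x| ≤ |x-y| + |y|, this is the triangle inequality for the parabolic size. -/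
lemma sqrt_le_sqrt_sub_add {s t : ℝ} (hs : 0 ≤ s) (hst : s ≤ t) : √t ≤ √(t - s) + √s := by
  have h1 := Real.sqrt_nonneg (t - s)
  have h2 := Real.sqrt_nonneg s
  refine Real.sqrt_le_iff.2 ⟨by positivity, ?_⟩
  nlinarith [Real.sq_sqrt hs, Real.sq_sqrt (sub_nonneg.2 hst), mul_nonneg h1 h2]

/-- The constant in `duh_le`. -/
def duhConst (N : ℝ) : ℝ := 2 * tailConst 4 + (4 / 3) ^ N

lemma duhConst_pos (N : ℝ) : 0 < duhConst N := by
  have := tailConst_nonneg 4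
  unfold duhConst; positivity

section

variable {k f : ℝ → E3 → ℝ} {e : ℕ} {N C : ℝ} {t : ℝ} {x : E3} {Γ : ℝ} {g : ℝ → ℝ} {h : E3 → ℝ}

/-- If √s + |y| < (√t + |x|)/4, the parabolic triangle inequality gives √(t-s) + |x-y| ≥ (3/4)(√t +
|x|), and the decay of order N can be evaluated at (t, x). Otherwise the source is at most Γ and the
kernel is kept. The point y = 0 is left out because h will be a negative power of ‖y‖, whose value
at 0 carries no information. -/
lemma integrand_le (hk : KernelBound k e N C) (ht : 0 < t) (hf : SplitBound f t x Γ g h) {s : ℝ}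
    (hs : 0 < s) (hst : s < t) {y : E3} (hy : y ≠ 0) :
    |k (t - s) (x - y) * f s y| ≤ C * t ^ e * (Γ * (√(t - s) + ‖x - y‖) ^ (-4 : ℝ) +
      (4 / 3) ^ N * √t ^ (N - 4) * (√t + ‖x‖) ^ (-N) * g s *
        (Metric.ball 0 (√t + ‖x‖)).indicator h y) := by
  have hr : 0 < t - s := sub_pos.2 hst
  have hC := hk.pos
  have h4 := hk.four_le
  have hst' : √t > 0 := Real.sqrt_pos.2 ht
  have hΓ := hf.nonneg
  have hg := hf.g_nonneg s
  have hind : 0 ≤ (Metric.ball (0 : E3) (√t + ‖x‖)).indicator h y :=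
    Set.indicator_nonneg (fun y _ => hf.h_nonneg y) y
  have hre : (t - s) ^ e ≤ t ^ e := by gcongr; linarith
  rw [abs_mul]
  by_cases hσ : (√t + ‖x‖) / 4 ≤ √s + ‖y‖
  · calc _ ≤ C * (t - s) ^ e * (√(t - s) + ‖x - y‖) ^ (-4 : ℝ) * Γ := by
          gcongr
          · exact hk.le_four _ hr _
          · exact hf.far s hs hst y hy hσ
      _ ≤ C * t ^ e * (Γ * (√(t - s) + ‖x - y‖) ^ (-4 : ℝ) + 0) := by
          rw [add_zero, mul_comm Γ, ← mul_assoc]; gcongr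
      _ ≤ _ := by gcongr; positivity
  · push Not at hσ
    have hyb : y ∈ Metric.ball (0 : E3) (√t + ‖x‖) := by
      rw [mem_ball_zero_iff]
      have := Real.sqrt_nonneg s
      have : 0 ≤ √t + ‖x‖ := by positivity
      linarith
    have h1 : 3 / 4 * (√t + ‖x‖) ≤ √(t - s) + ‖x - y‖ := by
      have h2 := sqrt_le_sqrt_sub_add hs.le hst.le
      have h3 := norm_sub_norm_le x y
      linarith
    have h2 : (√(t - s) + ‖x - y‖) ^ (-N) ≤ (4 / 3) ^ N * (√t + ‖x‖) ^ (-N) := by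
      calc _ ≤ (3 / 4 * (√t + ‖x‖)) ^ (-N) :=
            Real.rpow_le_rpow_of_nonpos (by positivity) h1 (by linarith)
        _ = _ := by
            rw [Real.mul_rpow (by norm_num) (by positivity), Real.rpow_neg (by norm_num),
              ← Real.inv_rpow (by norm_num)]
            norm_num
    have h3 : √(t - s) ^ (N - 4) ≤ √t ^ (N - 4) :=
      Real.rpow_le_rpow (Real.sqrt_nonneg _) (Real.sqrt_le_sqrt (by linarith)) (by linarith)
    rw [Set.indicator_of_mem hyb]
    have hh := hf.h_nonneg y
    calc _ ≤ C * (t - s) ^ e * (√(t - s) ^ (N - 4) * (√(t - s) + ‖x - y‖) ^ (-N)) * (g s * h y) := by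
          gcongr
          · exact hk.le_N _ hr _
          · exact hf.near s hs hst y hy hσ
      _ ≤ C * t ^ e * (√t ^ (N - 4) * ((4 / 3) ^ N * (√t + ‖x‖) ^ (-N))) * (g s * h y) := by
          gcongr
      _ = C * t ^ e * (0 + (4 / 3) ^ N * √t ^ (N - 4) * (√t + ‖x‖) ^ (-N) * g s * h y) := by ring
      _ ≤ _ := by gcongr; positivity

lemma majorant_integral (C e' Γ' c : ℝ) (hf : SplitBound f t x Γ g h) {s : ℝ} (hst : s < t) :
    Integrable (fun y => C * e' * (Γ' * (√(t - s) + ‖x - y‖) ^ (-4 : ℝ) +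
      c * (Metric.ball 0 (√t + ‖x‖)).indicator h y)) ∧
    ∫ y, C * e' * (Γ' * (√(t - s) + ‖x - y‖) ^ (-4 : ℝ) +
      c * (Metric.ball 0 (√t + ‖x‖)).indicator h y) =
      C * e' * (Γ' * (tailConst 4 * (t - s) ^ (-(1 / 2) : ℝ)) +
        c * ∫ y in Metric.ball 0 (√t + ‖x‖), h y) := by
  have hr : 0 < t - s := sub_pos.2 hst
  obtain ⟨i1, j1⟩ := integrable_add_norm_sub_rpow (Real.sqrt_pos.2 hr) (by norm_num : (3 : ℝ) < 4) x
  have i2 := (integrable_indicator_iff Metric.isOpen_ball.measurableSet).2 hf.h_int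
  refine ⟨((i1.const_mul _).add (i2.const_mul _)).const_mul _, ?_⟩
  rw [integral_const_mul, integral_add (i1.const_mul _) (i2.const_mul _), integral_const_mul,
    integral_const_mul, j1, integral_indicator Metric.isOpen_ball.measurableSet]
  congr 4
  rw [Real.sqrt_eq_rpow, ← Real.rpow_mul hr.le]; norm_num

lemma integrable_integrand (hk : KernelBound k e N C) (ht : 0 < t) (hm : Meas f)
    (hf : SplitBound f t x Γ g h) {s : ℝ} (hs : 0 < s) (hst : s < t) :
    Integrable fun y => k (t - s) (x - y) * f s y := by
  refine (majorant_integral C (t ^ e) Γ _ hf hst).1.mono' ?_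
    ((Measure.ae_ne volume (0 : E3)).mono fun y hy => integrand_le hk ht hf hs hst hy)
  refine (Measurable.mul ?_ (hm.slice hs)).aestronglyMeasurable
  exact hk.meas.comp (by fun_prop : Measurable fun y : E3 => ((t - s, x - y) : ℝ × E3))

lemma inner_le (hk : KernelBound k e N C) (ht : 0 < t)
    (hf : SplitBound f t x Γ g h) {s : ℝ} (hs : 0 < s) (hst : s < t) :
    ‖∫ y, k (t - s) (x - y) * f s y‖ ≤ C * t ^ e * (Γ * (tailConst 4 * (t - s) ^ (-(1 / 2) : ℝ)) +
        (4 / 3) ^ N * √t ^ (N - 4) * (√t + ‖x‖) ^ (-N) * g s *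
          ∫ y in Metric.ball 0 (√t + ‖x‖), h y) := by
  obtain ⟨i, j⟩ := majorant_integral C (t ^ e) Γ
    ((4 / 3) ^ N * √t ^ (N - 4) * (√t + ‖x‖) ^ (-N) * g s) hf hst
  refine (norm_integral_le_of_norm_le i ((Measure.ae_ne volume (0 : E3)).mono fun y hy =>
    integrand_le hk ht hf hs hst hy)).trans j.le

lemma outer_majorant (C e' Γ' c d : ℝ) (hg : IntervalIntegrable g volume 0 t) :
    IntervalIntegrable (fun s => C * e' * (Γ' * (tailConst 4 * (t - s) ^ (-(1 / 2) : ℝ)) +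
        c * g s * d)) volume 0 t ∧
    ∫ s in (0 : ℝ)..t, C * e' * (Γ' * (tailConst 4 * (t - s) ^ (-(1 / 2) : ℝ)) + c * g s * d) =
      C * e' * (Γ' * (tailConst 4 * (2 * √t)) + c * (∫ s in (0 : ℝ)..t, g s) * d) := by
  have i0 : IntervalIntegrable (fun s : ℝ => s ^ (-(1 / 2) : ℝ)) volume 0 t :=
    intervalIntegral.intervalIntegrable_rpow' (by norm_num)
  have i1 : IntervalIntegrable (fun s : ℝ => (t - s) ^ (-(1 / 2) : ℝ)) volume 0 t := by
    have := (i0.comp_sub_left t).symm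
    simpa using this
  have j1 : ∫ s in (0 : ℝ)..t, (t - s) ^ (-(1 / 2) : ℝ) = 2 * √t := by
    rw [intervalIntegral.integral_comp_sub_left (fun s : ℝ => s ^ (-(1 / 2) : ℝ)) t, sub_self,
      sub_zero, integral_rpow (Or.inl (by norm_num)), Real.sqrt_eq_rpow]
    norm_num; ring
  have i2 := ((i1.const_mul (tailConst 4)).const_mul Γ').add ((hg.const_mul c).mul_const d)
  refine ⟨i2.const_mul _, ?_⟩
  rw [intervalIntegral.integral_const_mul, intervalIntegral.integral_add
    ((i1.const_mul (tailConst 4)).const_mul Γ') ((hg.const_mul c).mul_const d),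
    intervalIntegral.integral_const_mul, intervalIntegral.integral_const_mul, j1,
    intervalIntegral.integral_mul_const, intervalIntegral.integral_const_mul]

lemma intervalIntegrable_inner (hk : KernelBound k e N C) (ht : 0 < t) (hm : Meas f)
    (hf : SplitBound f t x Γ g h) :
    IntervalIntegrable (fun s => ∫ y, k (t - s) (x - y) * f s y) volume 0 t := by
  rw [intervalIntegrable_iff_integrableOn_Ioc_of_le ht.le]
  have h0 := (outer_majorant C (t ^ e) Γ ((4 / 3) ^ N * √t ^ (N - 4) * (√t + ‖x‖) ^ (-N))
    (∫ y in Metric.ball 0 (√t + ‖x‖), h y) hf.g_int).1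
  rw [intervalIntegrable_iff_integrableOn_Ioc_of_le ht.le] at h0
  refine h0.mono' ?_ ?_
  · have h1 : Measurable fun s : ℝ => ∫ y, k (t - s) (x - y) * (if 0 < s then f s y else 0) :=
      (measurable_inner_integral hk.meas hm).comp
        (by fun_prop : Measurable fun s : ℝ => (((t, x), s) : (ℝ × E3) × ℝ))
    refine h1.aestronglyMeasurable.congr ?_
    refine (ae_restrict_iff' measurableSet_Ioc).2 (Filter.Eventually.of_forall fun s hs => ?_)
    have hs' : 0 < s := hs.1
    simp [hs']
  · refine (ae_restrict_iff' measurableSet_Ioc).2 ((Measure.ae_ne volume t).mono fun s hne hs => ?_)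
    exact inner_le hk ht hf hs.1 (lt_of_le_of_ne hs.2 hne)

/-- In the far part the space integral of the kernel bound is a multiple of (t-s)^{-1/2}, which
integrates to 2√t. In the near part the kernel bound no longer depends on (s, y), and the masses of
g and h factor out. -/
lemma duh_le (hk : KernelBound k e N C) (ht : 0 < t) (hf : SplitBound f t x Γ g h) :
    |duh k f t x| ≤ C * duhConst N * t ^ e * (Γ * √t + √t ^ (N - 4) * (√t + ‖x‖) ^ (-N) *
      (∫ s in (0 : ℝ)..t, g s) * ∫ y in Metric.ball 0 (√t + ‖x‖), h y) := by
  obtain ⟨i, j⟩ := outer_majorant C (t ^ e) Γ ((4 / 3) ^ N * √t ^ (N - 4) * (√t + ‖x‖) ^ (-N))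
    (∫ y in Metric.ball 0 (√t + ‖x‖), h y) hf.g_int
  have h1 : |duh k f t x| ≤ _ := (intervalIntegral.norm_integral_le_of_norm_le ht.le
    ((Measure.ae_ne volume t).mono fun s hne hs =>
      inner_le hk ht hf hs.1 (lt_of_le_of_ne hs.2 hne)) i).trans j.le
  refine h1.trans ?_
  have hC := hk.pos
  have hΓ := hf.nonneg
  have hG : 0 ≤ ∫ s in (0 : ℝ)..t, g s :=
    intervalIntegral.integral_nonneg ht.le fun s _ => hf.g_nonneg s
  have hH : 0 ≤ ∫ y in Metric.ball 0 (√t + ‖x‖), h y := integral_nonneg fun y => hf.h_nonneg y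
  have hT := tailConst_nonneg 4
  set G := ∫ s in (0 : ℝ)..t, g s
  set H := ∫ y in Metric.ball 0 (√t + ‖x‖), h y
  have e1 : C * duhConst N * t ^ e * (Γ * √t + √t ^ (N - 4) * (√t + ‖x‖) ^ (-N) * G * H) =
      C * t ^ e * (duhConst N * (Γ * √t) +
        duhConst N * (√t ^ (N - 4) * (√t + ‖x‖) ^ (-N) * G * H)) := by ring
  rw [e1]
  gcongr C * t ^ e * (?_ + ?_)
  · calc _ = 2 * tailConst 4 * (Γ * √t) := by ring
      _ ≤ _ := by
        gcongr
        have : (0 : ℝ) < (4 / 3) ^ N := by positivity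
        unfold duhConst; linarith
  · calc _ = (4 / 3) ^ N * (√t ^ (N - 4) * (√t + ‖x‖) ^ (-N) * G * H) := by ring
      _ ≤ _ := by
        gcongr
        unfold duhConst; linarith

/-- Linearity rests on the absolute convergence supplied by the split bounds, which may differ for
the two sources. -/
lemma duh_sub {f' : ℝ → E3 → ℝ} {Γ' : ℝ} {g' : ℝ → ℝ} {h' : E3 → ℝ} (hk : KernelBound k e N C)
    (ht : 0 < t) (hm : Meas f) (hf : SplitBound f t x Γ g h)
    (hm' : Meas f') (hf' : SplitBound f' t x Γ' g' h') :
    duh k f t x - duh k f' t x = duh k (fun s y => f s y - f' s y) t x := by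
  unfold duh
  rw [← intervalIntegral.integral_sub (intervalIntegrable_inner hk ht hm hf)
    (intervalIntegrable_inner hk ht hm' hf')]
  rw [intervalIntegral.integral_of_le ht.le, intervalIntegral.integral_of_le ht.le]
  refine setIntegral_congr_ae measurableSet_Ioc ((Measure.ae_ne volume t).mono fun s hne hs => ?_)
  have hst := lt_of_le_of_ne hs.2 hne
  rw [← integral_sub (integrable_integrand hk ht hm hf hs.1 hst)
    (integrable_integrand hk ht hm' hf' hs.1 hst)]
  simp only [mul_sub]

end

/-! ### Sources of the form `σ⁻¹ (κ + σ)^{-m}` with `σ = √s + |y|` -/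

/-- The weight `(κ + √s + |y|)^{-m}`. -/
def wt (κ m s : ℝ) (y : E3) : ℝ := (κ + (√s + ‖y‖)) ^ (-m)

lemma wt_nonneg {κ : ℝ} (hκ : 0 ≤ κ) (m s : ℝ) (y : E3) : 0 ≤ wt κ m s y := by
  unfold wt; positivity

/-- Far from the origin both weights are comparable to their values at (t, x), up to powers of 4.
Near it, the source is compared with the pure power σ^{-1-m}, which is integrable in parabolic
dimension 5 exactly when m < 4. -/
lemma splitBound_wt {f : ℝ → E3 → ℝ} {κ m A t : ℝ} (hκ : 0 ≤ κ) (hm : 0 ≤ m) (hm4 : m < 4)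
    (hA : 0 ≤ A) (ht : 0 < t) (x : E3)
    (hf : ∀ s, 0 < s → ∀ y, |f s y| ≤ A * (wt 0 1 s y * wt κ m s y)) :
    SplitBound f t x (A * (4 * 4 ^ m * ((√t + ‖x‖) ^ (-1 : ℝ) * wt κ m t x)))
      (fun s => A * (√t + ‖x‖) ^ m * wt κ m t x * √s ^ (-(2 * (m + 1) / 5)))
      (fun y => ‖y‖ ^ (-(3 * (m + 1) / 5))) := by
  have hst : 0 < √t := Real.sqrt_pos.2 ht
  have hρ : 0 < √t + ‖x‖ := by positivity
  have hw := wt_nonneg hκ m t x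
  refine ⟨by positivity, fun s => by positivity, fun y => by positivity, ?_, ?_, ?_, ?_⟩
  · refine IntervalIntegrable.const_mul ?_ _
    have : ∀ s : ℝ, s ∈ Set.uIoc 0 t → s ^ (-((m + 1) / 5)) = √s ^ (-(2 * (m + 1) / 5)) := fun s hs => by
      rw [Set.uIoc_of_le ht.le] at hs
      rw [Real.sqrt_eq_rpow, ← Real.rpow_mul hs.1.le]; congr 1; ring
    refine IntervalIntegrable.congr (f := fun s => s ^ (-((m + 1) / 5))) this ?_
    exact intervalIntegral.intervalIntegrable_rpow' (by linarith)
  · exact (integrableOn_ball_norm_rpow (by linarith) hρ).1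
  · intro s hs hst' y hy hσ
    have hσ0 : 0 < √s := Real.sqrt_pos.2 hs
    refine (hf s hs y).trans (mul_le_mul_of_nonneg_left ?_ hA)
    have h1 : wt 0 1 s y ≤ 4 * (√t + ‖x‖) ^ (-1 : ℝ) := by
      rw [wt, zero_add, Real.rpow_neg_one, Real.rpow_neg_one]
      rw [← inv_inv (4 : ℝ), ← mul_inv]
      exact inv_anti₀ (by positivity) (by linarith)
    have h2 : wt κ m s y ≤ 4 ^ m * wt κ m t x := by
      unfold wt
      have e : (4 : ℝ) ^ m = (4⁻¹) ^ (-m) := by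
        rw [Real.rpow_neg (by norm_num), Real.inv_rpow (by norm_num), inv_inv]
      rw [e, ← Real.mul_rpow (by norm_num) (by positivity)]
      refine Real.rpow_le_rpow_of_nonpos (by positivity) ?_ (by linarith)
      linarith
    calc _ ≤ (4 * (√t + ‖x‖) ^ (-1 : ℝ)) * (4 ^ m * wt κ m t x) :=
          mul_le_mul h1 h2 (wt_nonneg hκ _ _ _) (by positivity)
      _ = _ := by ring
  · intro s hs hst' y hy hσ
    have hσ0 : 0 < √s := Real.sqrt_pos.2 hs
    have hy0 : 0 < ‖y‖ := norm_pos_iff.2 hy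
    refine (hf s hs y).trans ?_
    have hσ' : 0 < √s + ‖y‖ := by positivity
    -- This is monotonicity of σ ↦ σ/(κ+σ), raised to the power m.
    have h1 : wt κ m s y ≤ (√s + ‖y‖) ^ (-m) * ((√t + ‖x‖) ^ m * wt κ m t x) := by
      unfold wt
      rw [Real.rpow_neg (by positivity), Real.rpow_neg (by positivity), Real.rpow_neg (by positivity),
        ← div_eq_mul_inv, ← one_div, ← one_div, div_mul_div_comm, div_le_div_iff₀ (by positivity)
        (by positivity), one_mul, one_mul, ← Real.mul_rpow (by positivity) (by positivity),
        ← Real.mul_rpow (by positivity) (by positivity)]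
      refine Real.rpow_le_rpow (by positivity) ?_ hm
      nlinarith
    -- The power m + 1 is shared between √s and ‖y‖ in the ratio 2 : 3 of their parabolic
    -- dimensions, so the same condition m + 1 < 5 makes both factors integrable.
    have h2 : wt 0 1 s y * (√s + ‖y‖) ^ (-m) ≤
        √s ^ (-(2 * (m + 1) / 5)) * ‖y‖ ^ (-(3 * (m + 1) / 5)) := by
      rw [wt, zero_add, ← Real.rpow_add hσ',
        show -1 + -m = -(2 * (m + 1) / 5) + -(3 * (m + 1) / 5) by ring, Real.rpow_add hσ']
      refine mul_le_mul ?_ ?_ (by positivity) (by positivity)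
      · exact Real.rpow_le_rpow_of_nonpos (by positivity) (by linarith) (by linarith)
      · exact Real.rpow_le_rpow_of_nonpos (by positivity) (by linarith) (by linarith)
    have h0 := wt_nonneg le_rfl 1 s y
    calc A * (wt 0 1 s y * wt κ m s y)
        ≤ A * (wt 0 1 s y * ((√s + ‖y‖) ^ (-m) * ((√t + ‖x‖) ^ m * wt κ m t x))) := by gcongr
      _ = A * ((wt 0 1 s y * (√s + ‖y‖) ^ (-m)) * ((√t + ‖x‖) ^ m * wt κ m t x)) := by ring
      _ ≤ A * ((√s ^ (-(2 * (m + 1) / 5)) * ‖y‖ ^ (-(3 * (m + 1) / 5))) *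
            ((√t + ‖x‖) ^ m * wt κ m t x)) := by gcongr
      _ = _ := by ring

/-- The constant in `duh_wt_le`. -/
def wtConst (m : ℝ) : ℝ := duhConst 4 * (4 * 4 ^ m + 5 / (4 - m) * ballConst (3 * (m + 1) / 5))

lemma wtConst_pos {m : ℝ} (hm4 : m < 4) : 0 < wtConst m := by
  have h1 := duhConst_pos 4
  have h2 := ballConst_nonneg (3 * (m + 1) / 5)
  have : 0 < 4 - m := by linarith
  unfold wtConst; positivity

lemma integral_sqrt_rpow {t q : ℝ} (ht : 0 < t) (hq : q < 2) :
    IntervalIntegrable (fun s => √s ^ (-q)) volume 0 t ∧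
    ∫ s in (0 : ℝ)..t, √s ^ (-q) = 2 / (2 - q) * √t ^ (2 - q) := by
  have h1 : ∀ s : ℝ, 0 < s → √s ^ (-q) = s ^ (-q / 2) := fun s hs => by
    rw [Real.sqrt_eq_rpow, ← Real.rpow_mul hs.le]; congr 1; ring
  have h2 : IntervalIntegrable (fun s : ℝ => s ^ (-q / 2)) volume 0 t :=
    intervalIntegral.intervalIntegrable_rpow' (by linarith)
  refine ⟨h2.congr fun s hs => ?_, ?_⟩
  · rw [Set.uIoc_of_le ht.le] at hs; exact (h1 s hs.1).symm
  · have : ∫ s in (0 : ℝ)..t, √s ^ (-q) = ∫ s in (0 : ℝ)..t, s ^ (-q / 2) := by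
      rw [intervalIntegral.integral_of_le ht.le, intervalIntegral.integral_of_le ht.le]
      exact setIntegral_congr_fun measurableSet_Ioc fun s hs => h1 s hs.1
    rw [this, integral_rpow (Or.inl (by linarith)), Real.zero_rpow (by linarith), sub_zero,
      Real.sqrt_eq_rpow, ← Real.rpow_mul ht.le]
    have e : 1 / 2 * (2 - q) = -q / 2 + 1 := by ring
    have : 2 - q ≠ 0 := by linarith
    have h' : -q / 2 + 1 = (2 - q) / 2 := by ring
    rw [e, h']; field_simp

/-- By homogeneity the powers of √t + ‖x‖ in the near term cancel (`h3`), and the weight at (t, x)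
is all that is left, times t^e. -/
lemma duh_wt_le {k f : ℝ → E3 → ℝ} {e : ℕ} {C κ m A t : ℝ} (hk : KernelBound k e 4 C)
    (hκ : 0 ≤ κ) (hm : 0 ≤ m) (hm4 : m < 4) (hA : 0 ≤ A) (ht : 0 < t) (x : E3)
    (hf : ∀ s, 0 < s → ∀ y, |f s y| ≤ A * (wt 0 1 s y * wt κ m s y)) :
    |duh k f t x| ≤ C * wtConst m * A * t ^ e * wt κ m t x := by
  have hst : 0 < √t := Real.sqrt_pos.2 ht
  have hρ : 0 < √t + ‖x‖ := by positivity
  have hw := wt_nonneg hκ m t x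
  have hC := hk.pos
  have hD := duhConst_pos 4
  have hB := ballConst_nonneg (3 * (m + 1) / 5)
  have h4m : 0 < 4 - m := by linarith
  refine (duh_le hk ht (splitBound_wt hκ hm hm4 hA ht x hf)).trans ?_
  rw [intervalIntegral.integral_const_mul, (integral_sqrt_rpow ht (by linarith)).2,
    (integrableOn_ball_norm_rpow (by linarith) hρ).2, sub_self, Real.rpow_zero, one_mul]
  have h1 : (√t + ‖x‖) ^ (-1 : ℝ) * √t ≤ 1 := by
    rw [Real.rpow_neg_one, ← div_eq_inv_mul, div_le_one hρ]
    linarith [norm_nonneg x]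
  have h2 : √t ^ (2 - 2 * (m + 1) / 5) ≤ (√t + ‖x‖) ^ (2 - 2 * (m + 1) / 5) :=
    Real.rpow_le_rpow hst.le (by linarith [norm_nonneg x]) (by linarith)
  have h3 : (√t + ‖x‖) ^ (-4 : ℝ) * (√t + ‖x‖) ^ m * (√t + ‖x‖) ^ (2 - 2 * (m + 1) / 5) *
      (√t + ‖x‖) ^ (3 - 3 * (m + 1) / 5) = 1 := by
    rw [← Real.rpow_add hρ, ← Real.rpow_add hρ, ← Real.rpow_add hρ]
    rw [show -4 + m + (2 - 2 * (m + 1) / 5) + (3 - 3 * (m + 1) / 5) = 0 by ring, Real.rpow_zero]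
  have h5 : 2 / (2 - 2 * (m + 1) / 5) = 5 / (4 - m) := by
    rw [div_eq_div_iff (by linarith) (by linarith)]; ring
  rw [h5]
  calc _ = C * duhConst 4 * t ^ e * A * wt κ m t x * (4 * 4 ^ m * ((√t + ‖x‖) ^ (-1 : ℝ) * √t) +
        5 / (4 - m) * ballConst (3 * (m + 1) / 5) * ((√t + ‖x‖) ^ (-4 : ℝ) * (√t + ‖x‖) ^ m *
        √t ^ (2 - 2 * (m + 1) / 5) * (√t + ‖x‖) ^ (3 - 3 * (m + 1) / 5))) := by ring
    _ ≤ C * duhConst 4 * t ^ e * A * wt κ m t x * (4 * 4 ^ m * 1 +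
        5 / (4 - m) * ballConst (3 * (m + 1) / 5) * ((√t + ‖x‖) ^ (-4 : ℝ) * (√t + ‖x‖) ^ m *
        (√t + ‖x‖) ^ (2 - 2 * (m + 1) / 5) * (√t + ‖x‖) ^ (3 - 3 * (m + 1) / 5))) := by
        gcongr
    _ = _ := by rw [h3, wtConst]; ring

/-! ### The bilinear operators -/

/-- `-∫₀ᵗ (t-s)^e e^{(t-s)Δ} ℙ ∇·(w ⊗ v)(s) ds`. -/
def opG (e : ℕ) (w v : ℝ → E3 → E3) (t : ℝ) (x : E3) : E3 :=
  -∫ s in (0 : ℝ)..t, (t - s) ^ e • heatLerayDiv (t - s) (w s) (v s) x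

lemma opB_eq (u v : ℝ → E3 → E3) : opB u v = opG 0 u v := by
  funext t x; simp [opB, opG]

lemma opE_eq (u : ℝ → E3 → E3) (θ : ℝ → E3 → ℝ) :
    opE u θ = opG 1 (fun s y => θ s y • e3) u := by
  funext t x; simp [opE, opG]

/-- The scalar kernels of `opG`. -/
def opKernel (e : ℕ) (j h k : Fin 3) (r : ℝ) (z : E3) : ℝ := r ^ e * oseenKernel₁ j h k r z

lemma kernelBound_opKernel (e : ℕ) (j h k : Fin 3) :
    KernelBound (opKernel e j h k) e 4 oseenConst := by
  have hb : ∀ r : ℝ, 0 < r → ∀ z, |opKernel e j h k r z| ≤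
      oseenConst * r ^ e * (√r + ‖z‖) ^ (-4 : ℝ) := fun r hr z => by
    rw [opKernel, abs_mul, abs_of_pos (pow_pos hr e)]
    calc _ ≤ r ^ e * (oseenConst * (√r + ‖z‖) ^ (-4 : ℝ)) := by
          gcongr; exact oseenKernel₁_le hr j h k z
      _ = _ := by ring
  refine ⟨?_, oseenConst_pos, le_rfl, hb, fun r hr z => ?_⟩
  · exact (measurable_fst.pow_const e).mul (measurable_oseenKernel₁ j h k)
  · rw [sub_self, Real.rpow_zero, one_mul]; exact hb r hr z

lemma kernelBound_heatKernel₁ (h : Fin 3) {N : ℝ} (hN : 4 ≤ N) :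
    KernelBound (heatKernel₁ h) 0 N (Real.exp ((N + 1) ^ 2)) := by
  refine ⟨measurable_heatKernel₁ h, Real.exp_pos _, hN, fun r hr z => ?_, fun r hr z => ?_⟩
  · have h0 := heatKernel₁_le (N := 4) hr (by norm_num) h z
    rw [sub_self, Real.rpow_zero, one_mul] at h0
    rw [pow_zero, mul_one]
    refine h0.trans (mul_le_mul_of_nonneg_right (Real.exp_le_exp.2 ?_) (by positivity))
    gcongr
  · rw [pow_zero, mul_one]
    exact heatKernel₁_le hr (by linarith) h z

/-- The product bound `|w| |v| ≤ A σ⁻¹ (κ + σ)^{-m}`. -/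
def ProdBound {V W : Type} [NormedAddCommGroup V] [NormedAddCommGroup W] (κ m A : ℝ)
    (w : ℝ → E3 → V) (v : ℝ → E3 → W) : Prop :=
  ∀ s, 0 < s → ∀ y, ‖w s y‖ * ‖v s y‖ ≤ A * (wt 0 1 s y * wt κ m s y)

/-- The range of admissible parameters. -/
structure Admissible (κ m A : ℝ) : Prop where
  κ_nonneg : 0 ≤ κ
  m_nonneg : 0 ≤ m
  m_lt : m < 4
  A_nonneg : 0 ≤ A

lemma Meas.coord {w : ℝ → E3 → E3} (hw : Meas w) (k : Fin 3) : Meas fun s y => w s y k :=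
  (measurable_coord k).comp hw

lemma Meas.mul {f g : ℝ → E3 → ℝ} (hf : Meas f) (hg : Meas g) : Meas fun s y => f s y * g s y :=
  Measurable.mul hf hg

lemma Meas.of_coord {w : ℝ → E3 → E3} (h : ∀ k, Meas fun s y => w s y k) : Meas w := by
  unfold Meas at h ⊢
  have h1 := (PiLp.continuous_toLp 2 fun _ : Fin 3 => ℝ).measurable.comp (measurable_pi_iff.2 h)
  exact h1

lemma norm_le_sum_coord (x : E3) : ‖x‖ ≤ ∑ j, |x j| := by
  rw [EuclideanSpace.norm_eq, Fin.sum_univ_three, Fin.sum_univ_three]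
  have h0 := abs_nonneg (x 0)
  have h1 := abs_nonneg (x 1)
  have h2 := abs_nonneg (x 2)
  refine Real.sqrt_le_iff.2 ⟨by positivity, ?_⟩
  simp only [Real.norm_eq_abs]
  nlinarith [mul_nonneg h0 h1, mul_nonneg h0 h2, mul_nonneg h1 h2]

lemma abs_coord_mul_le (w v : E3) (k h : Fin 3) : |w k * v h| ≤ ‖w‖ * ‖v‖ := by
  rw [abs_mul]
  exact mul_le_mul (abs_coord_le w k) (abs_coord_le v h) (abs_nonneg _) (norm_nonneg _)

section

variable {w v : ℝ → E3 → E3} {κ m A t : ℝ} {e : ℕ}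

lemma ProdBound.coord (hp : ProdBound κ m A w v) (k h : Fin 3) :
    ∀ s, 0 < s → ∀ y, |w s y k * v s y h| ≤ A * (wt 0 1 s y * wt κ m s y) :=
  fun s hs y => (abs_coord_mul_le _ _ k h).trans (hp s hs y)

lemma ProdBound.split (ha : Admissible κ m A) (hp : ProdBound κ m A w v) (ht : 0 < t) (x : E3)
    (k h : Fin 3) :
    ∃ Γ g h', SplitBound (fun s y => w s y k * v s y h) t x Γ g h' :=
  ⟨_, _, _, splitBound_wt ha.κ_nonneg ha.m_nonneg ha.m_lt ha.A_nonneg ht x (hp.coord k h)⟩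

lemma heatLerayDiv_coord (hw : Meas w) (hv : Meas v) (ha : Admissible κ m A)
    (hp : ProdBound κ m A w v) {s : ℝ} (hs : 0 < s) (hst : s < t) (x : E3) (j : Fin 3) :
    ((t - s) ^ e • heatLerayDiv (t - s) (w s) (v s) x) j =
      ∑ h, ∑ k, ∫ y, opKernel e j h k (t - s) (x - y) * (w s y k * v s y h) := by
  have ht : 0 < t := hs.trans hst
  have hr : 0 < t - s := sub_pos.2 hst
  have hi : ∀ h k, Integrable fun y => opKernel e j h k (t - s) (x - y) * (w s y k * v s y h) :=
    fun h k => by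
      obtain ⟨_, _, _, hsp⟩ := hp.split ha ht x k h
      exact integrable_integrand (kernelBound_opKernel e j h k) ht
        ((hw.coord k).mul (hv.coord h)) hsp hs hst
  have h1 : ((t - s) ^ e • heatLerayDiv (t - s) (w s) (v s) x) j = (t - s) ^ e *
      ∫ y, ∑ h, ∑ k, oseenDivKernel (t - s) j h k (x - y) * (w s y k * v s y h) := by
    simp [heatLerayDiv]
  rw [h1, ← integral_const_mul]
  have h2 : ∀ y, (t - s) ^ e * ∑ h, ∑ k, oseenDivKernel (t - s) j h k (x - y) *
      (w s y k * v s y h) = ∑ h, ∑ k, opKernel e j h k (t - s) (x - y) * (w s y k * v s y h) := by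
    intro y
    simp only [Finset.mul_sum, opKernel, oseenDivKernel_eq hr, mul_assoc]
  simp only [h2]
  rw [integral_finsetSum _ fun h _ => integrable_finsetSum _ fun k _ => hi h k]
  exact Finset.sum_congr rfl fun h _ => integral_finsetSum _ fun k _ => hi h k

/-- Absolute convergence of each scalar Duhamel integral allows sums and integrals to be exchanged;
all later estimates are scalar. The endpoint s = t, where the kernels are not controlled, is
discarded as a null set. -/
lemma opG_coord (hw : Meas w) (hv : Meas v) (ha : Admissible κ m A)
    (hp : ProdBound κ m A w v) (ht : 0 < t) (x : E3) (j : Fin 3) :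
    opG e w v t x j =
      -∑ h, ∑ k, duh (opKernel e j h k) (fun s y => w s y k * v s y h) t x := by
  have hi : ∀ j h k, IntegrableOn (fun s => ∫ y, opKernel e j h k (t - s) (x - y) *
      (w s y k * v s y h)) (Set.Ioc 0 t) := fun j h k => by
    obtain ⟨_, _, _, hsp⟩ := hp.split ha ht x k h
    exact (intervalIntegrable_iff_integrableOn_Ioc_of_le ht.le).1
      (intervalIntegrable_inner (kernelBound_opKernel e j h k) ht ((hw.coord k).mul (hv.coord h))
        hsp)
  have hc : ∀ j, (fun s => ∑ h, ∑ k, ∫ y, opKernel e j h k (t - s) (x - y) * (w s y k * v s y h))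
      =ᵐ[volume.restrict (Set.Ioc 0 t)]
      fun s => ((t - s) ^ e • heatLerayDiv (t - s) (w s) (v s) x) j := fun j =>
    (ae_restrict_iff' measurableSet_Ioc).2 ((Measure.ae_ne volume t).mono fun s hne hs =>
      (heatLerayDiv_coord hw hv ha hp hs.1 (lt_of_le_of_ne hs.2 hne) x j).symm)
  have hj : ∀ j, IntegrableOn (fun s => ((t - s) ^ e • heatLerayDiv (t - s) (w s) (v s) x) j)
      (Set.Ioc 0 t) := fun j =>
    (integrable_finsetSum _ fun h _ => integrable_finsetSum _ fun k _ => hi j h k).congr (hc j)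
  rw [opG, intervalIntegral.integral_of_le ht.le, PiLp.neg_apply, eval_integral_piLp hj,
    ← integral_congr_ae (hc j), integral_finsetSum _ fun h _ => integrable_finsetSum _ fun k _ => hi j h k]
  congr 1
  refine Finset.sum_congr rfl fun h _ => ?_
  rw [integral_finsetSum _ fun k _ => hi j h k]
  refine Finset.sum_congr rfl fun k _ => ?_
  rw [duh, intervalIntegral.integral_of_le ht.le]

lemma Meas.opG (hw : Meas w) (hv : Meas v) (ha : Admissible κ m A)
    (hp : ProdBound κ m A w v) : Meas (opG e w v) := by
  refine Meas.of_coord fun j => ?_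
  have h1 : Meas fun t x => -∑ h, ∑ k, Boussinesq.duh (opKernel e j h k)
      (fun s y => w s y k * v s y h) t x := by
    refine Measurable.neg (Finset.measurable_sum _ fun h _ => Finset.measurable_sum _ fun k _ => ?_)
    exact Meas.duh (kernelBound_opKernel e j h k).meas ((hw.coord k).mul (hv.coord h))
  unfold Meas at h1 ⊢
  convert h1 using 1
  funext p
  exact opG_coord hw hv ha hp p.1.2 p.2 j

lemma norm_opG_le (hw : Meas w) (hv : Meas v) (ha : Admissible κ m A)
    (hp : ProdBound κ m A w v) (ht : 0 < t) (x : E3) {Q : ℝ}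
    (hQ : ∀ j h k, |duh (opKernel e j h k) (fun s y => w s y k * v s y h) t x| ≤ Q) :
    ‖opG e w v t x‖ ≤ 27 * Q := by
  refine (norm_le_sum_coord _).trans ?_
  have h1 : ∀ j, |opG e w v t x j| ≤ 9 * Q := fun j => by
    rw [opG_coord hw hv ha hp ht x j, abs_neg]
    refine (Finset.abs_sum_le_sum_abs _ _).trans ?_
    have h2 : ∀ h, |∑ k, duh (opKernel e j h k) (fun s y => w s y k * v s y h) t x| ≤ 3 * Q :=
      fun h => by
        refine (Finset.abs_sum_le_sum_abs _ _).trans ?_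
        rw [Fin.sum_univ_three]
        linarith [hQ j h 0, hQ j h 1, hQ j h 2]
    rw [Fin.sum_univ_three]
    linarith [h2 0, h2 1, h2 2]
  rw [Fin.sum_univ_three]
  linarith [h1 0, h1 1, h1 2]

/-- The constant in the bounds of the bilinear operators. -/
def opConst (m : ℝ) : ℝ := 27 * (oseenConst * wtConst m)

lemma opConst_pos {m : ℝ} (hm : m < 4) : 0 < opConst m := by
  have := oseenConst_pos
  have := wtConst_pos hm
  unfold opConst; positivity

lemma norm_opG_wt_le (hw : Meas w) (hv : Meas v) (ha : Admissible κ m A)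
    (hp : ProdBound κ m A w v) (ht : 0 < t) (x : E3) :
    ‖opG e w v t x‖ ≤ opConst m * A * t ^ e * wt κ m t x := by
  refine (norm_opG_le hw hv ha hp ht x fun j h k => duh_wt_le (kernelBound_opKernel e j h k)
    ha.κ_nonneg ha.m_nonneg ha.m_lt ha.A_nonneg ht x (hp.coord k h)).trans (le_of_eq ?_)
  rw [opConst]; ring

/-- Bilinearity in the form used for contractions. The mixed pair of w' and v also needs a product
bound, since it appears as an intermediate term. -/
lemma opG_sub {w' v' : ℝ → E3 → E3} {A₁ A₂ : ℝ} (hw : Meas w) (hv : Meas v)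
    (hw' : Meas w') (hv' : Meas v') (ha : Admissible κ m A) (hp : ProdBound κ m A w v)
    (hp₁ : ProdBound κ m A w' v) (hp₂ : ProdBound κ m A w' v')
    (ha₁ : Admissible κ m A₁) (hd₁ : ProdBound κ m A₁ (fun s y => w s y - w' s y) v)
    (ha₂ : Admissible κ m A₂) (hd₂ : ProdBound κ m A₂ w' (fun s y => v s y - v' s y))
    (ht : 0 < t) (x : E3) :
    opG e w v t x - opG e w' v' t x =
      opG e (fun s y => w s y - w' s y) v t x + opG e w' (fun s y => v s y - v' s y) t x := by
  have m1 : Meas fun s y => w s y - w' s y := Measurable.sub hw hw'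
  have m2 : Meas fun s y => v s y - v' s y := Measurable.sub hv hv'
  have key : ∀ j h k, duh (opKernel e j h k) (fun s y => w s y k * v s y h) t x -
      duh (opKernel e j h k) (fun s y => w' s y k * v' s y h) t x =
      duh (opKernel e j h k) (fun s y => (w s y - w' s y) k * v s y h) t x +
      duh (opKernel e j h k) (fun s y => w' s y k * (v s y - v' s y) h) t x := by
    intro j h k
    have k1 := kernelBound_opKernel e j h k
    obtain ⟨_, _, _, s0⟩ := hp.split ha ht x k h
    obtain ⟨_, _, _, s1⟩ := hp₁.split ha ht x k h
    obtain ⟨_, _, _, s2⟩ := hp₂.split ha ht x k h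
    have a1 := duh_sub k1 ht ((hw.coord k).mul (hv.coord h)) s0 ((hw'.coord k).mul (hv.coord h)) s1
    have a2 := duh_sub k1 ht ((hw'.coord k).mul (hv.coord h)) s1
      ((hw'.coord k).mul (hv'.coord h)) s2
    simp only [PiLp.sub_apply, sub_mul, mul_sub]
    rw [← a1, ← a2]; ring
  ext j
  rw [PiLp.sub_apply, PiLp.add_apply, opG_coord hw hv ha hp ht, opG_coord hw' hv' ha hp₂ ht,
    opG_coord m1 hv ha₁ hd₁ ht, opG_coord hw' m2 ha₂ hd₂ ht, ← neg_add, ← Finset.sum_add_distrib,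
    sub_eq_add_neg, ← neg_add, neg_inj, ← sub_eq_add_neg, ← Finset.sum_sub_distrib]
  refine Finset.sum_congr rfl fun h _ => ?_
  rw [← Finset.sum_add_distrib, ← Finset.sum_sub_distrib]
  exact Finset.sum_congr rfl fun k _ => key j h k

end

/-! ### The scalar operator -/

section

variable {θ : ℝ → E3 → ℝ} {v : ℝ → E3 → E3} {κ m A t : ℝ}

lemma ProdBound.coord_smul (hp : ProdBound κ m A θ v) (h : Fin 3) :
    ∀ s, 0 < s → ∀ y, |θ s y * v s y h| ≤ A * (wt 0 1 s y * wt κ m s y) :=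
  fun s hs y => by
    rw [abs_mul]
    exact (mul_le_mul_of_nonneg_left (abs_coord_le _ h) (abs_nonneg _)).trans (hp s hs y)

lemma ProdBound.split_smul (ha : Admissible κ m A) (hp : ProdBound κ m A θ v) (ht : 0 < t) (x : E3)
    (h : Fin 3) :
    ∃ Γ g h', SplitBound (fun s y => θ s y * v s y h) t x Γ g h' :=
  ⟨_, _, _, splitBound_wt ha.κ_nonneg ha.m_nonneg ha.m_lt ha.A_nonneg ht x (hp.coord_smul h)⟩

lemma opBt_eq (hθ : Meas θ) (hv : Meas v) (ha : Admissible κ m A)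
    (hp : ProdBound κ m A θ v) (ht : 0 < t) (x : E3) :
    opBt θ v t x = -∑ h, duh (heatKernel₁ h) (fun s y => θ s y * v s y h) t x := by
  have hk := fun h => kernelBound_heatKernel₁ h le_rfl
  have hi : ∀ h, IntegrableOn (fun s => ∫ y, heatKernel₁ h (t - s) (x - y) *
      (θ s y * v s y h)) (Set.Ioc 0 t) := fun h => by
    obtain ⟨_, _, _, hsp⟩ := hp.split_smul ha ht x h
    exact (intervalIntegrable_iff_integrableOn_Ioc_of_le ht.le).1
      (intervalIntegrable_inner (hk h) ht (hθ.mul (hv.coord h)) hsp)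
  rw [opBt, intervalIntegral.integral_of_le ht.le]
  congr 1
  have h1 : ∫ s in Set.Ioc 0 t, heatDiv (t - s) (fun y => θ s y • v s y) x =
      ∫ s in Set.Ioc 0 t, ∑ h, ∫ y, heatKernel₁ h (t - s) (x - y) * (θ s y * v s y h) := by
    refine setIntegral_congr_ae measurableSet_Ioc ((Measure.ae_ne volume t).mono fun s hne hs => ?_)
    have hst := lt_of_le_of_ne hs.2 hne
    rw [heatDiv, ← integral_finsetSum]
    · simp [pd_heatKernel]
    · intro h _
      obtain ⟨_, _, _, hsp⟩ := hp.split_smul ha ht x h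
      exact integrable_integrand (hk h) ht (hθ.mul (hv.coord h)) hsp hs.1 hst
  rw [h1, integral_finsetSum _ fun h _ => hi h]
  refine Finset.sum_congr rfl fun h _ => ?_
  rw [duh, intervalIntegral.integral_of_le ht.le]

lemma Meas.opBt (hθ : Meas θ) (hv : Meas v) (ha : Admissible κ m A)
    (hp : ProdBound κ m A θ v) : Meas (opBt θ v) := by
  have h1 : Meas fun t x => -∑ h, Boussinesq.duh (heatKernel₁ h)
      (fun s y => θ s y * v s y h) t x := by
    refine Measurable.neg (Finset.measurable_sum _ fun h _ => ?_)
    exact Meas.duh (measurable_heatKernel₁ h) (hθ.mul (hv.coord h))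
  unfold Meas at h1 ⊢
  convert h1 using 1
  funext p
  exact opBt_eq hθ hv ha hp p.1.2 p.2

lemma abs_opBt_le (hθ : Meas θ) (hv : Meas v) (ha : Admissible κ m A)
    (hp : ProdBound κ m A θ v) (ht : 0 < t) (x : E3) {Q : ℝ}
    (hQ : ∀ h, |duh (heatKernel₁ h) (fun s y => θ s y * v s y h) t x| ≤ Q) :
    |opBt θ v t x| ≤ 3 * Q := by
  rw [opBt_eq hθ hv ha hp ht x, abs_neg]
  refine (Finset.abs_sum_le_sum_abs _ _).trans ?_
  rw [Fin.sum_univ_three]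
  linarith [hQ 0, hQ 1, hQ 2]

lemma abs_opBt_wt_le (hθ : Meas θ) (hv : Meas v) (ha : Admissible κ m A)
    (hp : ProdBound κ m A θ v) (ht : 0 < t) (x : E3) :
    |opBt θ v t x| ≤ opConst m * A * wt κ m t x := by
  have hA := ha.A_nonneg
  have hw := wt_nonneg ha.κ_nonneg m t x
  have hc := wtConst_pos ha.m_lt
  refine (abs_opBt_le hθ hv ha hp ht x fun h => duh_wt_le (kernelBound_heatKernel₁ h le_rfl)
    ha.κ_nonneg ha.m_nonneg ha.m_lt ha.A_nonneg ht x (hp.coord_smul h)).trans ?_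
  have e1 : Real.exp ((4 + 1) ^ 2) ≤ oseenConst := by
    have : Real.exp ((4 + 1) ^ 2) ≤ Real.exp 64 := Real.exp_le_exp.2 (by norm_num)
    unfold oseenConst; linarith [Real.exp_pos 64]
  calc 3 * (Real.exp ((4 + 1) ^ 2) * wtConst m * A * t ^ 0 * wt κ m t x)
      = 3 * (Real.exp ((4 + 1) ^ 2) * wtConst m * A * wt κ m t x) := by ring
    _ ≤ 27 * (oseenConst * wtConst m * A * wt κ m t x) := by
        gcongr; norm_num
    _ = _ := by rw [opConst]; ring

lemma opBt_sub {θ' : ℝ → E3 → ℝ} {v' : ℝ → E3 → E3} {A₁ A₂ : ℝ} (hθ : Meas θ) (hv : Meas v)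
    (hθ' : Meas θ') (hv' : Meas v') (ha : Admissible κ m A) (hp : ProdBound κ m A θ v)
    (hp₁ : ProdBound κ m A θ' v) (hp₂ : ProdBound κ m A θ' v')
    (ha₁ : Admissible κ m A₁) (hd₁ : ProdBound κ m A₁ (fun s y => θ s y - θ' s y) v)
    (ha₂ : Admissible κ m A₂) (hd₂ : ProdBound κ m A₂ θ' (fun s y => v s y - v' s y))
    (ht : 0 < t) (x : E3) :
    opBt θ v t x - opBt θ' v' t x =
      opBt (fun s y => θ s y - θ' s y) v t x + opBt θ' (fun s y => v s y - v' s y) t x := by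
  have m1 : Meas fun s y => θ s y - θ' s y := Measurable.sub hθ hθ'
  have m2 : Meas fun s y => v s y - v' s y := Measurable.sub hv hv'
  rw [opBt_eq hθ hv ha hp ht, opBt_eq hθ' hv' ha hp₂ ht, opBt_eq m1 hv ha₁ hd₁ ht,
    opBt_eq hθ' m2 ha₂ hd₂ ht, ← neg_add, ← Finset.sum_add_distrib,
    sub_eq_add_neg, ← neg_add, neg_inj, ← sub_eq_add_neg, ← Finset.sum_sub_distrib]
  refine Finset.sum_congr rfl fun h _ => ?_
  have k1 := kernelBound_heatKernel₁ h le_rfl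
  obtain ⟨_, _, _, s0⟩ := hp.split_smul ha ht x h
  obtain ⟨_, _, _, s1⟩ := hp₁.split_smul ha ht x h
  obtain ⟨_, _, _, s2⟩ := hp₂.split_smul ha ht x h
  have a1 := duh_sub k1 ht (hθ.mul (hv.coord h)) s0 (hθ'.mul (hv.coord h)) s1
  have a2 := duh_sub k1 ht (hθ'.mul (hv.coord h)) s1 (hθ'.mul (hv'.coord h)) s2
  simp only [PiLp.sub_apply, sub_mul, mul_sub]
  rw [← a1, ← a2]; ring

end

/-! ### The linear evolution -/

/-- The constant in `norm_heat_le`. -/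
def heatConst (N : ℝ) : ℝ := Real.exp 16 * tailConst 4 + Real.exp (N ^ 2) * (4 / 3) ^ N

lemma heatConst_pos (N : ℝ) : 0 < heatConst N := by
  have := tailConst_nonneg 4
  unfold heatConst; positivity

lemma heatKernel_le_four {t : ℝ} (ht : 0 < t) (z : E3) :
    heatKernel t z ≤ Real.exp 16 * (√t * (√t + ‖z‖) ^ (-4 : ℝ)) := by
  have h := heatKernel_le (N := 4) ht (by norm_num) z
  rw [show (4 : ℝ) - 3 = 1 by norm_num, Real.rpow_one] at h
  convert h using 3; norm_num

lemma sqrt_mul_sqrt_rpow {t : ℝ} (ht : 0 < t) : √t * √t ^ ((3 : ℝ) - 4) = 1 := by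
  have := Real.sqrt_pos.2 ht
  rw [show (3 : ℝ) - 4 = -1 by norm_num, Real.rpow_neg_one]
  exact mul_inv_cancel₀ this.ne'

lemma off_diagonal_le {ρ c N : ℝ} (hρ : 0 < ρ) (hN : 0 ≤ N) (hc : 3 / 4 * ρ ≤ c) :
    c ^ (-N) ≤ (4 / 3) ^ N * ρ ^ (-N) := by
  calc _ ≤ (3 / 4 * ρ) ^ (-N) := Real.rpow_le_rpow_of_nonpos (by positivity) hc (by linarith)
    _ = _ := by
      rw [Real.mul_rpow (by norm_num) hρ.le, Real.rpow_neg (by norm_num),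
        ← Real.inv_rpow (by norm_num)]
      norm_num

/-- The cut of `duh_le` without the time variable. Far out the kernel is taken with order 4, where
its mass does not depend on t; close to the origin the order N is left to the application. -/
lemma norm_heat_le {V : Type} [NormedAddCommGroup V] [NormedSpace ℝ V] {f : E3 → V} {t N Γ : ℝ}
    {h : E3 → ℝ} (ht : 0 < t) (x : E3) (hN : 3 ≤ N) (hΓ : 0 ≤ Γ) (hh : ∀ y, 0 ≤ h y)
    (hi : IntegrableOn h (Metric.ball 0 (√t + ‖x‖)))
    (hfar : ∀ y, y ≠ 0 → (√t + ‖x‖) / 4 ≤ ‖y‖ → ‖f y‖ ≤ Γ)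
    (hnear : ∀ y, y ≠ 0 → ‖y‖ < (√t + ‖x‖) / 4 → ‖f y‖ ≤ h y) :
    ‖heat t f x‖ ≤ heatConst N * (Γ + √t ^ (N - 3) * (√t + ‖x‖) ^ (-N) *
      ∫ y in Metric.ball 0 (√t + ‖x‖), h y) := by
  have hst := Real.sqrt_pos.2 ht
  have hρ : 0 < √t + ‖x‖ := by positivity
  set c := Real.exp (N ^ 2) * (√t ^ (N - 3) * ((4 / 3) ^ N * (√t + ‖x‖) ^ (-N))) with hc
  have hc0 : 0 ≤ c := by positivity
  obtain ⟨i1, j1⟩ := integrable_add_norm_sub_rpow hst (by norm_num : (3 : ℝ) < 4) x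
  have i2 := (integrable_indicator_iff Metric.isOpen_ball.measurableSet).2 hi
  have i3 := (i1.const_mul (Real.exp 16 * √t * Γ)).add (i2.const_mul c)
  have hle : ∀ y, y ≠ 0 → ‖heatKernel t (x - y) • f y‖ ≤
      Real.exp 16 * √t * Γ * (√t + ‖x - y‖) ^ (-4 : ℝ) +
        c * (Metric.ball 0 (√t + ‖x‖)).indicator h y := by
    intro y hy
    have hG := heatKernel_nonneg ht (x - y)
    have hind : 0 ≤ (Metric.ball (0 : E3) (√t + ‖x‖)).indicator h y :=
      Set.indicator_nonneg (fun y _ => hh y) y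
    rw [norm_smul, Real.norm_of_nonneg hG]
    by_cases hyb : (√t + ‖x‖) / 4 ≤ ‖y‖
    · calc _ ≤ Real.exp 16 * (√t * (√t + ‖x - y‖) ^ (-4 : ℝ)) * Γ :=
            mul_le_mul (heatKernel_le_four ht _) (hfar y hy hyb) (norm_nonneg _) (by positivity)
        _ = Real.exp 16 * √t * Γ * (√t + ‖x - y‖) ^ (-4 : ℝ) + 0 := by ring
        _ ≤ _ := by gcongr; positivity
    · push Not at hyb
      have hmem : y ∈ Metric.ball (0 : E3) (√t + ‖x‖) := by
        rw [mem_ball_zero_iff]; linarith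
      rw [Set.indicator_of_mem hmem]
      have h1 : 3 / 4 * (√t + ‖x‖) ≤ √t + ‖x - y‖ := by
        have h3 := norm_sub_norm_le x y
        linarith
      calc _ ≤ Real.exp (N ^ 2) * (√t ^ (N - 3) * (√t + ‖x - y‖) ^ (-N)) * h y :=
            mul_le_mul (heatKernel_le ht (by linarith) _) (hnear y hy hyb) (norm_nonneg _)
              (by positivity)
        _ ≤ c * h y := by
            refine mul_le_mul_of_nonneg_right ?_ (hh y)
            rw [hc]; gcongr
            exact off_diagonal_le (N := N) hρ (by linarith) h1
        _ ≤ _ := le_add_of_nonneg_left (by positivity)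
  refine (norm_integral_le_of_norm_le i3 ((Measure.ae_ne volume 0).mono hle)).trans ?_
  have e : ∫ y, (Real.exp 16 * √t * Γ * (√t + ‖x - y‖) ^ (-4 : ℝ) +
        c * (Metric.ball 0 (√t + ‖x‖)).indicator h y) =
      Real.exp 16 * √t * Γ * (tailConst 4 * √t ^ ((3 : ℝ) - 4)) +
        c * ∫ y in Metric.ball 0 (√t + ‖x‖), h y := by
    rw [integral_add (i1.const_mul _) (i2.const_mul _), integral_const_mul, integral_const_mul,
      j1, integral_indicator Metric.isOpen_ball.measurableSet]
  refine e.le.trans ?_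
  have hH : 0 ≤ ∫ y in Metric.ball 0 (√t + ‖x‖), h y := integral_nonneg hh
  set H := ∫ y in Metric.ball 0 (√t + ‖x‖), h y
  have hT := tailConst_nonneg 4
  calc _ = Real.exp 16 * tailConst 4 * Γ * (√t * √t ^ ((3 : ℝ) - 4)) + Real.exp (N ^ 2) * (4 / 3) ^ N *
        (√t ^ (N - 3) * (√t + ‖x‖) ^ (-N) * H) := by rw [hc]; ring
    _ = Real.exp 16 * tailConst 4 * Γ + Real.exp (N ^ 2) * (4 / 3) ^ N *
        (√t ^ (N - 3) * (√t + ‖x‖) ^ (-N) * H) := by rw [sqrt_mul_sqrt_rpow ht, mul_one]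
    _ ≤ heatConst N * Γ + heatConst N * (√t ^ (N - 3) * (√t + ‖x‖) ^ (-N) * H) := by
        have p1 : 0 ≤ Real.exp (N ^ 2) * (4 / 3 : ℝ) ^ N := by positivity
        have p2 : 0 ≤ Real.exp 16 * tailConst 4 := by positivity
        gcongr <;> unfold heatConst <;> linarith
    _ = _ := by ring

/-- The constant in `norm_heat_decay_le`. -/
def heatDecayConst (a β : ℝ) : ℝ := heatConst (a + 3 - β) * (4 ^ a + ballConst β)

lemma heatDecayConst_pos (a β : ℝ) : 0 < heatDecayConst a β := by
  have := ballConst_nonneg β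
  have := heatConst_pos (a + 3 - β)
  unfold heatDecayConst; positivity

/-- The rate a is used outside the ball and the locally integrable rate β < 3 inside. The order N =
a + 3 - β is the one for which the inner part also carries (√t + ‖x‖)^{-a}. With a = β = 1 this is
the scale invariant estimate in 𝒳. -/
lemma norm_heat_decay_le {V : Type} [NormedAddCommGroup V] [NormedSpace ℝ V] {f : E3 → V}
    {t a β A : ℝ} (ht : 0 < t) (x : E3) (ha : 0 ≤ a) (hβ : β < 3) (hβa : β ≤ a) (hA : 0 ≤ A)
    (hfa : ∀ y, y ≠ 0 → ‖f y‖ ≤ A * ‖y‖ ^ (-a)) (hfβ : ∀ y, y ≠ 0 → ‖f y‖ ≤ A * ‖y‖ ^ (-β)) :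
    ‖heat t f x‖ ≤ heatDecayConst a β * A * ((1 + √t ^ (a - β)) * (√t + ‖x‖) ^ (-a)) := by
  have hst := Real.sqrt_pos.2 ht
  have hρ : 0 < √t + ‖x‖ := by positivity
  obtain ⟨i1, j1⟩ := integrableOn_ball_norm_rpow hβ hρ
  have hB := ballConst_nonneg β
  have hH := heatConst_pos (a + 3 - β)
  refine (norm_heat_le (N := a + 3 - β) (Γ := A * (4 ^ a * (√t + ‖x‖) ^ (-a))) ht x (by linarith)
    (by positivity) (fun y => by positivity) (i1.const_mul A) (fun y hy hyr => ?_)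
    (fun y hy _ => hfβ y hy)).trans ?_
  · refine (hfa y hy).trans ?_
    gcongr
    calc ‖y‖ ^ (-a) ≤ ((√t + ‖x‖) / 4) ^ (-a) :=
          Real.rpow_le_rpow_of_nonpos (by positivity) hyr (by linarith)
      _ = _ := by
          rw [Real.div_rpow hρ.le (by norm_num), Real.rpow_neg (by norm_num : (0 : ℝ) ≤ 4)]
          field_simp
  · rw [integral_const_mul, j1]
    have e1 : (√t + ‖x‖) ^ (-(a + 3 - β)) * (√t + ‖x‖) ^ (3 - β) = (√t + ‖x‖) ^ (-a) := by
      rw [← Real.rpow_add hρ]; congr 1; ring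
    have e2 : a + 3 - β - 3 = a - β := by ring
    rw [e2]
    calc _ = heatConst (a + 3 - β) * A * (4 ^ a * (√t + ‖x‖) ^ (-a) + ballConst β * √t ^ (a - β) *
          ((√t + ‖x‖) ^ (-(a + 3 - β)) * (√t + ‖x‖) ^ (3 - β))) := by ring
      _ = heatConst (a + 3 - β) * A * (4 ^ a * 1 + ballConst β * √t ^ (a - β)) *
            (√t + ‖x‖) ^ (-a) := by rw [e1]; ring
      _ ≤ heatConst (a + 3 - β) * A * (4 ^ a * (1 + √t ^ (a - β)) + ballConst β *
            (1 + √t ^ (a - β))) * (√t + ‖x‖) ^ (-a) := by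
          have : 0 ≤ √t ^ (a - β) := by positivity
          gcongr <;> linarith
      _ = _ := by unfold heatDecayConst; ring

/-- Inside the ball the mean value inequality gives |P(x-y) - P(x)| ≤ D‖y‖, so only the first moment
of θ enters; outside, q dominates. The kernel P is kept general to cover both the heat and the Oseen
kernel. -/
lemma abs_integral_sub_mean_le {P : E3 → ℝ} {P' : E3 → E3 →L[ℝ] ℝ} {θ q : E3 → ℝ} {x : E3}
    {R D B₀ : ℝ} (hP : ∀ z, HasFDerivAt P (P' z) z)
    (hD : ∀ z, ‖z - x‖ < R → ‖P' z‖ ≤ D) (hθ : AEStronglyMeasurable θ volume)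
    (hb : ∀ y, |θ y| ≤ B₀) (hq : Integrable q) (hq0 : ∀ y, 0 ≤ q y)
    (hfar : ∀ y, R ≤ ‖y‖ → |P (x - y) * θ y| ≤ q y) :
    |(∫ y, P (x - y) * θ y) - P x * ∫ y in Metric.ball 0 R, θ y| ≤
      D * (∫ y in Metric.ball 0 R, ‖y‖ * |θ y|) + ∫ y, q y := by
  have hB : MeasurableSet (Metric.ball (0 : E3) R) := Metric.isOpen_ball.measurableSet
  have hfin : volume (Metric.ball (0 : E3) R) ≠ ⊤ := measure_ball_lt_top.ne
  have hPc : Continuous P := continuous_iff_continuousAt.2 fun z => (hP z).continuousAt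
  have hmv : ∀ y ∈ Metric.ball (0 : E3) R, |P (x - y) - P x| ≤ D * ‖y‖ := by
    intro y hy
    rw [mem_ball_zero_iff] at hy
    have hR : 0 < R := (norm_nonneg y).trans_lt hy
    have := (convex_ball x R).norm_image_sub_le_of_norm_hasFDerivWithin_le (f := P) (f' := P') (C := D)
      (x := x) (y := x - y) (fun z _ => (hP z).hasFDerivWithinAt)
      (fun z hz => hD z (by rwa [mem_ball_iff_norm] at hz)) (Metric.mem_ball_self hR)
      (by rw [mem_ball_iff_norm]; simpa using hy)
    simpa using this
  have hD0 : ∀ y ∈ Metric.ball (0 : E3) R, 0 ≤ D := fun y hy => by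
    rw [mem_ball_zero_iff] at hy
    have hR : 0 < R := (norm_nonneg y).trans_lt hy
    exact (norm_nonneg _).trans (hD x (by simpa using hR))
  have hfm : AEStronglyMeasurable (fun y => P (x - y) * θ y) volume :=
    (by fun_prop : Continuous fun y => P (x - y)).aestronglyMeasurable.mul hθ
  have hθi : IntegrableOn θ (Metric.ball 0 R) :=
    Measure.integrableOn_of_bounded hfin hθ ((ae_restrict_iff' hB).2
      (Filter.Eventually.of_forall fun y _ => hb y))
  have hmi : IntegrableOn (fun y => ‖y‖ * |θ y|) (Metric.ball 0 R) := by
    refine Measure.integrableOn_of_bounded (M := R * B₀) hfin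
      (continuous_norm.aestronglyMeasurable.mul hθ.norm) ((ae_restrict_iff' hB).2
      (Filter.Eventually.of_forall fun y hy => ?_))
    rw [mem_ball_zero_iff] at hy
    rw [Real.norm_of_nonneg (by positivity)]
    exact mul_le_mul hy.le (hb y) (abs_nonneg _) ((norm_nonneg y).trans hy.le)
  have hdi : IntegrableOn (fun y => (P (x - y) - P x) * θ y) (Metric.ball 0 R) := by
    refine (hmi.const_mul D).mono' ?_ ((ae_restrict_iff' hB).2
      (Filter.Eventually.of_forall fun y hy => ?_))
    · exact ((by fun_prop : Continuous fun y => P (x - y) - P x).aestronglyMeasurable.mul hθ).restrict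
    · rw [norm_mul, ← mul_assoc]
      exact mul_le_mul_of_nonneg_right (hmv y hy) (abs_nonneg _)
  have hfi : IntegrableOn (fun y => P (x - y) * θ y) (Metric.ball 0 R) := by
    refine (hdi.add (hθi.const_mul (P x))).congr (Filter.Eventually.of_forall fun y => ?_)
    simp only [Pi.add_apply]; ring
  have hfc : IntegrableOn (fun y => P (x - y) * θ y) (Metric.ball 0 R)ᶜ := by
    refine hq.integrableOn.mono' hfm.restrict ((ae_restrict_iff' hB.compl).2
      (Filter.Eventually.of_forall fun y hy => hfar y ?_))
    simpa using hy
  have hfull : Integrable fun y => P (x - y) * θ y := by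
    rw [← integrableOn_univ, ← Set.union_compl_self (Metric.ball (0 : E3) R)]
    exact hfi.union hfc
  have e1 : (∫ y, P (x - y) * θ y) - P x * ∫ y in Metric.ball 0 R, θ y =
      (∫ y in Metric.ball 0 R, (P (x - y) - P x) * θ y) +
        ∫ y in (Metric.ball 0 R)ᶜ, P (x - y) * θ y := by
    rw [← integral_add_compl hB hfull, ← integral_const_mul]
    have : ∫ y in Metric.ball 0 R, (P (x - y) - P x) * θ y =
        (∫ y in Metric.ball 0 R, P (x - y) * θ y) - ∫ y in Metric.ball 0 R, P x * θ y := by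
      rw [← integral_sub hfi (hθi.const_mul _)]
      simp only [sub_mul]
    rw [this]; ring
  rw [e1]
  refine (abs_add_le _ _).trans (add_le_add ?_ ?_)
  · rw [← integral_const_mul, ← Real.norm_eq_abs]
    refine norm_integral_le_of_norm_le (hmi.const_mul D) ((ae_restrict_iff' hB).2
      (Filter.Eventually.of_forall fun y hy => ?_))
    rw [norm_mul, ← mul_assoc]
    exact mul_le_mul_of_nonneg_right (hmv y hy) (abs_nonneg _)
  · rw [← Real.norm_eq_abs]
    refine (norm_integral_le_of_norm_le hq.integrableOn ((ae_restrict_iff' hB.compl).2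
      (Filter.Eventually.of_forall fun y hy => hfar y (by simpa using hy)))).trans ?_
    exact setIntegral_le_integral hq (Filter.Eventually.of_forall hq0)

lemma heat_sub_mean_le {θ : E3 → ℝ} {t N Γ B₀ : ℝ} (ht : 0 < t) (x : E3) (hN : 4 ≤ N) (hΓ : 0 ≤ Γ)
    (hθ : AEStronglyMeasurable θ volume) (hb : ∀ y, |θ y| ≤ B₀)
    (hfar : ∀ y, (√t + ‖x‖) / 4 ≤ ‖y‖ → |θ y| ≤ Γ) :
    |heat t θ x - heatKernel t x * ∫ y in Metric.ball 0 ((√t + ‖x‖) / 4), θ y| ≤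
      3 * Real.exp ((N + 1) ^ 2) * (4 / 3) ^ N * (√t ^ (N - 4) * (√t + ‖x‖) ^ (-N)) *
        (∫ y in Metric.ball 0 ((√t + ‖x‖) / 4), ‖y‖ * |θ y|) + Real.exp 16 * tailConst 4 * Γ := by
  have hst := Real.sqrt_pos.2 ht
  have hρ : 0 < √t + ‖x‖ := by positivity
  obtain ⟨i1, j1⟩ := integrable_add_norm_sub_rpow hst (by norm_num : (3 : ℝ) < 4) x
  have key := abs_integral_sub_mean_le (P := heatKernel t)
    (D := 3 * Real.exp ((N + 1) ^ 2) * (4 / 3) ^ N * (√t ^ (N - 4) * (√t + ‖x‖) ^ (-N)))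
    (q := fun y => Real.exp 16 * √t * Γ * (√t + ‖x - y‖) ^ (-4 : ℝ)) (x := x)
    (R := (√t + ‖x‖) / 4) (hasFDerivAt_heatKernel t) (fun z hz => ?_) hθ hb (i1.const_mul _)
    (fun y => by positivity) (fun y hy => ?_)
  · rw [integral_const_mul, j1] at key
    have e : Real.exp 16 * √t * Γ * (tailConst 4 * √t ^ ((3 : ℝ) - 4)) =
        Real.exp 16 * tailConst 4 * Γ * (√t * √t ^ ((3 : ℝ) - 4)) := by ring
    rw [e, sqrt_mul_sqrt_rpow ht, mul_one] at key
    simpa only [heat, smul_eq_mul] using key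
  · have h1 : 3 / 4 * (√t + ‖x‖) ≤ √t + ‖z‖ := by
      have h3 := norm_sub_norm_le x z
      rw [norm_sub_rev] at h3
      linarith
    refine (norm_rowForm_le _).trans ?_
    have h2 : ∀ h, |heatKernel₁ h t z| ≤ Real.exp ((N + 1) ^ 2) * (√t ^ (N - 4) *
        ((4 / 3) ^ N * (√t + ‖x‖) ^ (-N))) := fun h =>
      (heatKernel₁_le (N := N) ht (by linarith) h z).trans (by
        gcongr; exact off_diagonal_le (N := N) hρ (by linarith) h1)
    rw [Fin.sum_univ_three]
    linarith [h2 0, h2 1, h2 2]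
  · rw [abs_mul, abs_of_nonneg (heatKernel_nonneg ht _)]
    calc _ ≤ Real.exp 16 * (√t * (√t + ‖x - y‖) ^ (-4 : ℝ)) * Γ :=
          mul_le_mul (heatKernel_le_four ht _) (hfar y hy) (abs_nonneg _) (by positivity)
      _ = _ := by ring

/-! ### Linear estimates for the temperature -/

/-- Decay, first moment and mean of the initial temperature; `j = 1` encodes a vanishing mean and
a finite first moment. -/
structure MomentBound (θ : E3 → ℝ) (j A : ℝ) : Prop where
  meas : AEStronglyMeasurable θ volume
  j_nonneg : 0 ≤ j
  j_le : j ≤ 1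
  A_nonneg : 0 ≤ A
  bdd : ∀ y, |θ y| ≤ A
  decay : ∀ y, y ≠ 0 → |θ y| ≤ A * ‖y‖ ^ (-(3 + j))
  moment : ∀ R, 0 < R → ∫ y in Metric.ball 0 R, ‖y‖ * |θ y| ≤ A * R ^ (1 - j)
  mean : ∀ R, 0 < R → |∫ y in Metric.ball 0 R, θ y| ≤ A * R ^ (-j)

lemma div_four_rpow_neg {ρ p : ℝ} (hρ : 0 < ρ) : (ρ / 4) ^ (-p) = 4 ^ p * ρ ^ (-p) := by
  rw [Real.div_rpow hρ.le (by norm_num), Real.rpow_neg (by norm_num : (0 : ℝ) ≤ 4)]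
  field_simp

lemma MomentBound.mean_le {θ : E3 → ℝ} {j A ρ : ℝ} (h : MomentBound θ j A) (hρ : 0 < ρ) :
    |∫ y in Metric.ball 0 (ρ / 4), θ y| ≤ 4 * A * ρ ^ (-j) := by
  have hA := h.A_nonneg
  refine (h.mean (ρ / 4) (by positivity)).trans ?_
  rw [div_four_rpow_neg hρ]
  have : (4 : ℝ) ^ j ≤ 4 ^ (1 : ℝ) := Real.rpow_le_rpow_of_exponent_le (by norm_num) h.j_le
  rw [Real.rpow_one] at this
  calc _ ≤ A * (4 * ρ ^ (-j)) := by gcongr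
    _ = _ := by ring

lemma MomentBound.moment_le {θ : E3 → ℝ} {j A ρ : ℝ} (h : MomentBound θ j A) (hρ : 0 < ρ) :
    ∫ y in Metric.ball 0 (ρ / 4), ‖y‖ * |θ y| ≤ A * ρ ^ (1 - j) := by
  have hA := h.A_nonneg
  refine (h.moment (ρ / 4) (by positivity)).trans ?_
  gcongr
  · linarith [h.j_le]
  · linarith

/-- The constant in `abs_heat_moment_le`. -/
def heatMomentConst (b j : ℝ) : ℝ := 4 * Real.exp ((b - j) ^ 2) +
  3 * Real.exp ((b + 1 - j + 1) ^ 2) * (4 / 3) ^ (b + 1 - j) + Real.exp 16 * tailConst 4 * 4 ^ b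

/-- The mean term takes the kernel at order b - j and the gradient term at order b + 1 - j. These
compensate the factors ρ^{-j} and ρ^{1-j} from the mean and the moment, so both terms become
√t^{b-(3+j)} ρ^{-b}; the outer region gives ρ^{-b} alone. -/
lemma abs_heat_moment_le {θ : E3 → ℝ} {j A b t : ℝ} (h : MomentBound θ j A) (ht : 0 < t) (x : E3)
    (hb : 3 + j ≤ b) (hfar : ∀ y, y ≠ 0 → |θ y| ≤ A * ‖y‖ ^ (-b)) :
    |heat t θ x| ≤ heatMomentConst b j * A * ((1 + √t ^ (b - (3 + j))) * (√t + ‖x‖) ^ (-b)) := by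
  have hst := Real.sqrt_pos.2 ht
  have hρ : 0 < √t + ‖x‖ := by positivity
  have hj := h.j_nonneg
  have hj1 := h.j_le
  have hA := h.A_nonneg
  have hT := tailConst_nonneg 4
  have h1 := heat_sub_mean_le (θ := θ) (N := b + 1 - j) (Γ := A * (4 ^ b * (√t + ‖x‖) ^ (-b))) ht x
    (by linarith) (by positivity) h.meas h.bdd (fun y hy => ?_)
  · have h2 : |heatKernel t x * ∫ y in Metric.ball 0 ((√t + ‖x‖) / 4), θ y| ≤
        Real.exp ((b - j) ^ 2) * (√t ^ (b - j - 3) * (√t + ‖x‖) ^ (-(b - j))) *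
          (4 * A * (√t + ‖x‖) ^ (-j)) := by
      rw [abs_mul, abs_of_nonneg (heatKernel_nonneg ht x)]
      exact mul_le_mul (heatKernel_le ht (by linarith) x) (h.mean_le hρ) (abs_nonneg _)
        (by positivity)
    have h3 : 3 * Real.exp ((b + 1 - j + 1) ^ 2) * (4 / 3) ^ (b + 1 - j) *
        (√t ^ (b + 1 - j - 4) * (√t + ‖x‖) ^ (-(b + 1 - j))) *
        (∫ y in Metric.ball 0 ((√t + ‖x‖) / 4), ‖y‖ * |θ y|) ≤
        3 * Real.exp ((b + 1 - j + 1) ^ 2) * (4 / 3) ^ (b + 1 - j) *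
        (√t ^ (b + 1 - j - 4) * (√t + ‖x‖) ^ (-(b + 1 - j))) * (A * (√t + ‖x‖) ^ (1 - j)) := by
      gcongr; exact h.moment_le hρ
    have e1 : (√t + ‖x‖) ^ (-(b - j)) * (√t + ‖x‖) ^ (-j) = (√t + ‖x‖) ^ (-b) := by
      rw [← Real.rpow_add hρ]; congr 1; ring
    have e2 : (√t + ‖x‖) ^ (-(b + 1 - j)) * (√t + ‖x‖) ^ (1 - j) = (√t + ‖x‖) ^ (-b) := by
      rw [← Real.rpow_add hρ]; congr 1; ring
    rw [show b - j - 3 = b - (3 + j) by ring] at h2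
    rw [show b + 1 - j - 4 = b - (3 + j) by ring] at h1 h3
    have h4 : |heat t θ x| ≤ |heat t θ x - heatKernel t x *
        ∫ y in Metric.ball 0 ((√t + ‖x‖) / 4), θ y| +
        |heatKernel t x * ∫ y in Metric.ball 0 ((√t + ‖x‖) / 4), θ y| := by
      have := abs_add_le (heat t θ x - heatKernel t x *
        ∫ y in Metric.ball 0 ((√t + ‖x‖) / 4), θ y) (heatKernel t x *
        ∫ y in Metric.ball 0 ((√t + ‖x‖) / 4), θ y)
      rwa [sub_add_cancel] at this
    refine (h4.trans (add_le_add (h1.trans (add_le_add_left h3 _)) h2)).trans ?_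
    set S := √t ^ (b - (3 + j))
    have hS : 0 ≤ S := by positivity
    have hw : 0 ≤ (√t + ‖x‖) ^ (-b) := by positivity
    calc _ = (√t + ‖x‖) ^ (-b) * A * (Real.exp 16 * tailConst 4 * 4 ^ b * 1) +
          3 * Real.exp ((b + 1 - j + 1) ^ 2) * (4 / 3) ^ (b + 1 - j) * S * A *
            ((√t + ‖x‖) ^ (-(b + 1 - j)) * (√t + ‖x‖) ^ (1 - j)) +
          4 * Real.exp ((b - j) ^ 2) * S * A *
            ((√t + ‖x‖) ^ (-(b - j)) * (√t + ‖x‖) ^ (-j)) := by ring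
      _ = (√t + ‖x‖) ^ (-b) * A * (Real.exp 16 * tailConst 4 * 4 ^ b * 1 +
          3 * Real.exp ((b + 1 - j + 1) ^ 2) * (4 / 3) ^ (b + 1 - j) * S +
          4 * Real.exp ((b - j) ^ 2) * S) := by rw [e1, e2]; ring
      _ ≤ (√t + ‖x‖) ^ (-b) * A * (Real.exp 16 * tailConst 4 * 4 ^ b * (1 + S) +
          3 * Real.exp ((b + 1 - j + 1) ^ 2) * (4 / 3) ^ (b + 1 - j) * (1 + S) +
          4 * Real.exp ((b - j) ^ 2) * (1 + S)) := by
          gcongr <;> linarith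
      _ = _ := by unfold heatMomentConst; ring
  · have hy0 : y ≠ 0 := by
      rintro rfl
      rw [norm_zero] at hy; linarith
    refine (hfar y hy0).trans ?_
    rw [← div_four_rpow_neg hρ]
    gcongr ?_ * ?_
    exact Real.rpow_le_rpow_of_nonpos (by positivity) hy (by linarith)

/-- The product is at most the larger pure power. This separates weights centred at two different
points into a sum of integrable weights with one centre each. -/
lemma rpow_mul_rpow_le_add {α β p q : ℝ} (hα : 0 < α) (hβ : 0 < β) (hp : 0 ≤ p) (hq : 0 ≤ q) :
    α ^ (-p) * β ^ (-q) ≤ α ^ (-(p + q)) + β ^ (-(p + q)) := by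
  rw [neg_add, Real.rpow_add hα, Real.rpow_add hβ]
  rcases le_total α β with h | h
  · have : β ^ (-q) ≤ α ^ (-q) := Real.rpow_le_rpow_of_nonpos hα h (by linarith)
    have h2 : 0 ≤ β ^ (-p) * β ^ (-q) := by positivity
    have h3 : α ^ (-p) * β ^ (-q) ≤ α ^ (-p) * α ^ (-q) := by gcongr
    linarith
  · have : α ^ (-p) ≤ β ^ (-p) := Real.rpow_le_rpow_of_nonpos hβ h (by linarith)
    have h2 : 0 ≤ α ^ (-p) * α ^ (-q) := by positivity
    have h3 : α ^ (-p) * β ^ (-q) ≤ β ^ (-p) * β ^ (-q) := by gcongr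
    linarith

/-- The constant in `abs_oseen_moment_le`. -/
def oseenMomentConst (a j : ℝ) : ℝ := oseenConst * (4 + 3 * (4 / 3) ^ (4 : ℝ) +
  2 * 4 ^ a * 5 ^ (3 + j - a) * tailConst (3 + (3 + j - a)))

/-- The bound of power 3 on the Oseen kernel is not integrable, so a supremum of θ in the outer
region is not enough. The rate of θ is split as 3 + j = a + δ: the part a produces (√t + ‖x‖)^{-a},
the part δ > 0 restores integrability at the price of √t^{-δ}. This is the origin of the restriction
a < 3 + j. -/
lemma abs_oseen_moment_le {θ : E3 → ℝ} {j A a t : ℝ} (h : MomentBound θ j A) (ht : 0 < t) (x : E3)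
    (ha : 0 ≤ a) (haj : a < 3 + j) (i k : Fin 3) :
    |∫ y, oseenKernel t i k (x - y) * θ y| ≤
      oseenMomentConst a j * A * (√t ^ (a - (3 + j)) * (√t + ‖x‖) ^ (-a)) := by
  have hst := Real.sqrt_pos.2 ht
  have hρ : 0 < √t + ‖x‖ := by positivity
  have hj := h.j_nonneg
  have hj1 := h.j_le
  have hA := h.A_nonneg
  have ho := oseenConst_pos
  set δ := 3 + j - a with hδ
  have hδ0 : 0 < δ := by linarith
  have hT := tailConst_nonneg (3 + δ)
  obtain ⟨i1, j1⟩ := integrable_add_norm_sub_rpow hst (by linarith : 3 < 3 + δ) x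
  obtain ⟨i2, j2⟩ := integrable_add_norm_rpow hst (by linarith : 3 < 3 + δ)
  have key := abs_integral_sub_mean_le (P := oseenKernel t i k) (x := x) (R := (√t + ‖x‖) / 4)
    (D := 3 * oseenConst * ((4 / 3) ^ (4 : ℝ) * (√t + ‖x‖) ^ (-4 : ℝ)))
    (q := fun y => oseenConst * A * (4 ^ a * (√t + ‖x‖) ^ (-a)) * 5 ^ δ *
      ((√t + ‖x - y‖) ^ (-(3 + δ)) + (√t + ‖y‖) ^ (-(3 + δ))))
    (hasFDerivAt_oseenKernel ht i k) (fun z hz => ?_) h.meas h.bdd ((i1.add i2).const_mul _)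
    (fun y => by positivity) (fun y hy => ?_)
  · rw [integral_const_mul, integral_add i1 i2, j1, j2, show 3 - (3 + δ) = -δ by ring] at key
    have h2 : |oseenKernel t i k x * ∫ y in Metric.ball 0 ((√t + ‖x‖) / 4), θ y| ≤
        oseenConst * (√t + ‖x‖) ^ (-3 : ℝ) * (4 * A * (√t + ‖x‖) ^ (-j)) := by
      rw [abs_mul]
      exact mul_le_mul (oseenKernel_le ht i k x) (h.mean_le hρ) (abs_nonneg _) (by positivity)
    have h3 : 3 * oseenConst * ((4 / 3) ^ (4 : ℝ) * (√t + ‖x‖) ^ (-4 : ℝ)) *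
        (∫ y in Metric.ball 0 ((√t + ‖x‖) / 4), ‖y‖ * |θ y|) ≤
        3 * oseenConst * ((4 / 3) ^ (4 : ℝ) * (√t + ‖x‖) ^ (-4 : ℝ)) *
          (A * (√t + ‖x‖) ^ (1 - j)) := by
      gcongr; exact h.moment_le hρ
    have e1 : (√t + ‖x‖) ^ (-3 : ℝ) * (√t + ‖x‖) ^ (-j) = (√t + ‖x‖) ^ (-δ) * (√t + ‖x‖) ^ (-a) := by
      rw [← Real.rpow_add hρ, ← Real.rpow_add hρ]; congr 1; rw [hδ]; ring
    have e2 : (√t + ‖x‖) ^ (-4 : ℝ) * (√t + ‖x‖) ^ (1 - j) =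
        (√t + ‖x‖) ^ (-δ) * (√t + ‖x‖) ^ (-a) := by
      rw [← Real.rpow_add hρ, ← Real.rpow_add hρ]; congr 1; rw [hδ]; ring
    have e3 : (√t + ‖x‖) ^ (-δ) ≤ √t ^ (-δ) :=
      Real.rpow_le_rpow_of_nonpos hst (by linarith [norm_nonneg x]) (by linarith)
    have h4 := abs_add_le ((∫ y, oseenKernel t i k (x - y) * θ y) - oseenKernel t i k x *
        ∫ y in Metric.ball 0 ((√t + ‖x‖) / 4), θ y) (oseenKernel t i k x *
        ∫ y in Metric.ball 0 ((√t + ‖x‖) / 4), θ y)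
    rw [sub_add_cancel] at h4
    refine (h4.trans (add_le_add (key.trans (add_le_add_left h3 _)) h2)).trans ?_
    rw [show a - (3 + j) = -δ by rw [hδ]; ring]
    calc _ = oseenConst * A * (2 * 4 ^ a * 5 ^ δ * tailConst (3 + δ) * (√t ^ (-δ) *
            (√t + ‖x‖) ^ (-a)) + 3 * (4 / 3) ^ (4 : ℝ) * ((√t + ‖x‖) ^ (-4 : ℝ) *
            (√t + ‖x‖) ^ (1 - j)) + 4 * ((√t + ‖x‖) ^ (-3 : ℝ) * (√t + ‖x‖) ^ (-j))) := by ring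
      _ ≤ oseenConst * A * (2 * 4 ^ a * 5 ^ δ * tailConst (3 + δ) * (√t ^ (-δ) *
            (√t + ‖x‖) ^ (-a)) + 3 * (4 / 3) ^ (4 : ℝ) * (√t ^ (-δ) * (√t + ‖x‖) ^ (-a)) +
            4 * (√t ^ (-δ) * (√t + ‖x‖) ^ (-a))) := by
          rw [e1, e2]; gcongr
      _ = _ := by unfold oseenMomentConst; ring
  · have h1 : 3 / 4 * (√t + ‖x‖) ≤ √t + ‖z‖ := by
      have h3 := norm_sub_norm_le x z
      rw [norm_sub_rev] at h3
      linarith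
    refine (norm_rowForm_le _).trans ?_
    have h2 : ∀ h, |oseenKernel₁ i h k t z| ≤ oseenConst *
        ((4 / 3) ^ (4 : ℝ) * (√t + ‖x‖) ^ (-4 : ℝ)) := fun h =>
      (oseenKernel₁_le ht i h k z).trans (by
        gcongr ?_ * ?_; exact off_diagonal_le (N := 4) hρ (by norm_num) h1)
    rw [Fin.sum_univ_three]
    linarith [h2 0, h2 1, h2 2]
  · have hy0 : y ≠ 0 := by
      rintro rfl
      rw [norm_zero] at hy; linarith
    have hyp : 0 < ‖y‖ := norm_pos_iff.2 hy0
    rw [abs_mul]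
    have g1 : ‖y‖ ^ (-a) ≤ 4 ^ a * (√t + ‖x‖) ^ (-a) := by
      rw [← div_four_rpow_neg hρ]
      exact Real.rpow_le_rpow_of_nonpos (by positivity) hy (by linarith)
    -- In the outer region √t ≤ 4‖y‖, hence √t + ‖y‖ ≤ 5‖y‖.
    have g2 : ‖y‖ ^ (-δ) ≤ 5 ^ δ * (√t + ‖y‖) ^ (-δ) := by
      have : ((√t + ‖y‖) / 5) ^ (-δ) = 5 ^ δ * (√t + ‖y‖) ^ (-δ) := by
        rw [Real.div_rpow (by positivity) (by norm_num), Real.rpow_neg (by norm_num : (0 : ℝ) ≤ 5)]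
        field_simp
      rw [← this]
      refine Real.rpow_le_rpow_of_nonpos (by positivity) ?_ (by linarith)
      linarith [norm_nonneg x]
    have g3 := rpow_mul_rpow_le_add (α := √t + ‖x - y‖) (β := √t + ‖y‖) (p := 3) (q := δ)
      (by positivity) (by positivity) (by norm_num) hδ0.le
    calc _ ≤ oseenConst * (√t + ‖x - y‖) ^ (-3 : ℝ) * (A * ‖y‖ ^ (-(3 + j))) :=
          mul_le_mul (oseenKernel_le ht i k _) (h.decay y hy0) (abs_nonneg _) (by positivity)
      _ = oseenConst * (√t + ‖x - y‖) ^ (-3 : ℝ) * (A * (‖y‖ ^ (-a) * ‖y‖ ^ (-δ))) := by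
          rw [← Real.rpow_add hyp, hδ]; congr 4; ring
      _ ≤ oseenConst * (√t + ‖x - y‖) ^ (-3 : ℝ) * (A * ((4 ^ a * (√t + ‖x‖) ^ (-a)) *
            (5 ^ δ * (√t + ‖y‖) ^ (-δ)))) := by gcongr
      _ = oseenConst * A * (4 ^ a * (√t + ‖x‖) ^ (-a)) * 5 ^ δ *
            ((√t + ‖x - y‖) ^ (-3 : ℝ) * (√t + ‖y‖) ^ (-δ)) := by ring
      _ ≤ _ := by gcongr

/-- The constant in `abs_oseen_bdd_le`. -/
def oseenBddConst : ℝ := oseenConst * (ballConst 1 + 4 * tailConst 4)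

/-- One has t (√t + |z|)^{-3} ≤ |z|^{-1} for all t, and |z|^{-1} convolved with (1 + |y|)^{-3} is
bounded: the singularity is integrable and the total power at infinity is 4. This handles ρ ≤ 1,
where the bound of `abs_oseen_moment_le` degenerates. -/
lemma abs_oseen_bdd_le {θ : E3 → ℝ} {A t : ℝ} (ht : 0 < t) (x : E3) (hA : 0 ≤ A)
    (hθ : ∀ y, |θ y| ≤ A * (1 + ‖y‖) ^ (-3 : ℝ)) (i k : Fin 3) :
    |t * ∫ y, oseenKernel t i k (x - y) * θ y| ≤ oseenBddConst * A := by
  have hst := Real.sqrt_pos.2 ht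
  have ho := oseenConst_pos
  obtain ⟨i1, j1⟩ := integrable_add_norm_sub_rpow one_pos (by norm_num : (3 : ℝ) < 4) x
  obtain ⟨i2, j2⟩ := integrable_add_norm_rpow one_pos (by norm_num : (3 : ℝ) < 4)
  obtain ⟨i3, j3⟩ := integrableOn_ball_norm_rpow (β := 1) (by norm_num) one_pos
  rw [← integrable_indicator_iff Metric.isOpen_ball.measurableSet] at i3
  rw [← integral_indicator Metric.isOpen_ball.measurableSet] at j3
  have i3' := i3.comp_sub_left x
  have j3' := integral_sub_left_eq_self
    ((Metric.ball (0 : E3) 1).indicator fun y => ‖y‖ ^ (-1 : ℝ)) volume x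
  simp only [Real.one_rpow, mul_one] at j1 j2 j3
  rw [j3] at j3'
  have i5 : Integrable fun y : E3 => 2 * ((1 + ‖x - y‖) ^ (-4 : ℝ) + (1 + ‖y‖) ^ (-4 : ℝ)) :=
    (i1.add i2).const_mul 2
  have i4 : Integrable fun y => oseenConst * A *
      ((Metric.ball (0 : E3) 1).indicator (fun y => ‖y‖ ^ (-1 : ℝ)) (x - y) +
        2 * ((1 + ‖x - y‖) ^ (-4 : ℝ) + (1 + ‖y‖) ^ (-4 : ℝ))) := (i3'.add i5).const_mul _
  rw [← integral_const_mul]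
  have hle : ∀ y, y ≠ x → ‖t * (oseenKernel t i k (x - y) * θ y)‖ ≤ oseenConst * A *
      ((Metric.ball (0 : E3) 1).indicator (fun y => ‖y‖ ^ (-1 : ℝ)) (x - y) +
        2 * ((1 + ‖x - y‖) ^ (-4 : ℝ) + (1 + ‖y‖) ^ (-4 : ℝ))) := by
    intro y hy
    have hz : 0 < ‖x - y‖ := norm_pos_iff.2 (sub_ne_zero.2 hy.symm)
    have h1 : t * (√t + ‖x - y‖) ^ (-3 : ℝ) ≤ ‖x - y‖ ^ (-1 : ℝ) := by
      have e : t = √t ^ (2 : ℝ) := by rw [Real.rpow_two, Real.sq_sqrt ht.le]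
      have e2 : (√t + ‖x - y‖) ^ (-3 : ℝ) =
          (√t + ‖x - y‖) ^ (-2 : ℝ) * (√t + ‖x - y‖) ^ (-1 : ℝ) := by
        rw [← Real.rpow_add (by positivity)]; norm_num
      have e3 : (√t + ‖x - y‖) ^ (-2 : ℝ) ≤ √t ^ (-2 : ℝ) :=
        Real.rpow_le_rpow_of_nonpos hst (by linarith) (by norm_num)
      have e4 : (√t + ‖x - y‖) ^ (-1 : ℝ) ≤ ‖x - y‖ ^ (-1 : ℝ) :=
        Real.rpow_le_rpow_of_nonpos hz (by linarith) (by norm_num)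
      calc t * (√t + ‖x - y‖) ^ (-3 : ℝ) ≤ √t ^ (2 : ℝ) * (√t ^ (-2 : ℝ) * ‖x - y‖ ^ (-1 : ℝ)) := by
            rw [e2]; nth_rw 1 [e]; gcongr
        _ = _ := by
            rw [← mul_assoc, ← Real.rpow_add hst]; norm_num
    have h2 : ‖x - y‖ ^ (-1 : ℝ) * (1 + ‖y‖) ^ (-3 : ℝ) ≤
        (Metric.ball (0 : E3) 1).indicator (fun y => ‖y‖ ^ (-1 : ℝ)) (x - y) +
        2 * ((1 + ‖x - y‖) ^ (-4 : ℝ) + (1 + ‖y‖) ^ (-4 : ℝ)) := by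
      have hpos : 0 ≤ (1 + ‖x - y‖) ^ (-4 : ℝ) + (1 + ‖y‖) ^ (-4 : ℝ) := by positivity
      by_cases hzb : x - y ∈ Metric.ball (0 : E3) 1
      · rw [Set.indicator_of_mem hzb]
        have : (1 + ‖y‖) ^ (-3 : ℝ) ≤ 1 :=
          Real.rpow_le_one_of_one_le_of_nonpos (by linarith [norm_nonneg y]) (by norm_num)
        have h0 : 0 ≤ ‖x - y‖ ^ (-1 : ℝ) := by positivity
        nlinarith
      · rw [Set.indicator_of_notMem hzb, zero_add]
        rw [mem_ball_zero_iff, not_lt] at hzb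
        have h3 : ‖x - y‖ ^ (-1 : ℝ) ≤ 2 * (1 + ‖x - y‖) ^ (-1 : ℝ) := by
          rw [Real.rpow_neg_one, Real.rpow_neg_one, ← div_eq_mul_inv, inv_eq_one_div,
            div_le_div_iff₀ hz (by positivity)]
          linarith
        have h4 := rpow_mul_rpow_le_add (α := 1 + ‖x - y‖) (β := 1 + ‖y‖) (p := 1) (q := 3)
          (by positivity) (by positivity) (by norm_num) (by norm_num)
        norm_num only at h4
        calc _ ≤ 2 * (1 + ‖x - y‖) ^ (-1 : ℝ) * (1 + ‖y‖) ^ (-3 : ℝ) := by gcongr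
          _ = 2 * ((1 + ‖x - y‖) ^ (-1 : ℝ) * (1 + ‖y‖) ^ (-3 : ℝ)) := by ring
          _ ≤ _ := by gcongr
    rw [norm_mul, norm_mul, Real.norm_of_nonneg ht.le]
    calc _ ≤ t * ((oseenConst * (√t + ‖x - y‖) ^ (-3 : ℝ)) * (A * (1 + ‖y‖) ^ (-3 : ℝ))) := by
          gcongr
          · exact oseenKernel_le ht i k _
          · exact hθ y
      _ = oseenConst * A * ((t * (√t + ‖x - y‖) ^ (-3 : ℝ)) * (1 + ‖y‖) ^ (-3 : ℝ)) := by ring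
      _ ≤ oseenConst * A * (‖x - y‖ ^ (-1 : ℝ) * (1 + ‖y‖) ^ (-3 : ℝ)) := by gcongr
      _ ≤ _ := by gcongr
  refine (norm_integral_le_of_norm_le i4 ((Measure.ae_ne volume x).mono hle)).trans (le_of_eq ?_)
  rw [integral_const_mul]
  have e : ∫ y, ((Metric.ball (0 : E3) 1).indicator (fun y => ‖y‖ ^ (-1 : ℝ)) (x - y) +
        2 * ((1 + ‖x - y‖) ^ (-4 : ℝ) + (1 + ‖y‖) ^ (-4 : ℝ))) = ballConst 1 + 4 * tailConst 4 := by
    rw [integral_add i3' i5, integral_const_mul, integral_add i1 i2, j3', j1,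
      j2]
    ring
  rw [e, oseenBddConst]; ring

lemma norm_heatLeray_le {θ : E3 → ℝ} {t Q : ℝ} (x : E3)
    (hQ : ∀ i, |∫ y, oseenKernel t i 2 (x - y) * θ y| ≤ Q) :
    ‖heatLeray t (fun y => θ y • e3) x‖ ≤ 3 * Q := by
  refine (norm_le_sum_coord _).trans ?_
  have h : ∀ i, heatLeray t (fun y => θ y • e3) x i = ∫ y, oseenKernel t i 2 (x - y) * θ y := by
    intro i
    simp [heatLeray, e3]
  simp only [h]
  rw [Fin.sum_univ_three]
  linarith [hQ 0, hQ 1, hQ 2]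

/-- A bound on `e^{tΔ} θ` at the origin controls the partial integrals of `θ`. -/
lemma exists_mean_le {θ : E3 → ℝ} {A B ε : ℝ} (hθ : AEStronglyMeasurable θ volume) (hA : 0 ≤ A)
    (hb : ∀ y, |θ y| ≤ B) (hd : ∀ y, y ≠ 0 → |θ y| ≤ A * ‖y‖ ^ (-3 : ℝ))
    (hm : ∀ R, 0 < R → ∫ y in Metric.ball 0 R, ‖y‖ * |θ y| ≤ A * R)
    (hY : ∀ t, 0 < t → √t ^ 3 * |heat t θ 0| ≤ ε) :
    ∃ A', ∀ R, 0 < R → |∫ y in Metric.ball 0 R, θ y| ≤ A' := by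
  refine ⟨(ε + 3 * Real.exp ((4 + 1) ^ 2) * (4 / 3) ^ (4 : ℝ) * A / 4 +
    Real.exp 16 * tailConst 4 * A * 64) / (4 * Real.pi) ^ (-(3 / 2) : ℝ), fun R hR => ?_⟩
  -- At time 16 R² and x = 0 the ball of `heat_sub_mean_le` has radius exactly R, and the heat
  -- kernel at the origin is a multiple of R^{-3}, the size that the hypothesis `hY` compensates.
  have ht : 0 < 16 * R ^ 2 := by positivity
  have hs : √(16 * R ^ 2) = 4 * R := by
    rw [show 16 * R ^ 2 = (4 * R) ^ 2 by ring, Real.sqrt_sq (by positivity)]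
  have hG : heatKernel (16 * R ^ 2) 0 = (4 * Real.pi) ^ (-(3 / 2) : ℝ) / (4 * R) ^ 3 := by
    rw [heatKernel, norm_zero, Real.mul_rpow (by positivity) (by positivity)]
    have : (16 * R ^ 2) ^ (-(3 / 2) : ℝ) = ((4 * R) ^ 3)⁻¹ := by
      rw [show 16 * R ^ 2 = (4 * R) ^ (2 : ℝ) by rw [Real.rpow_two]; ring, ← Real.rpow_mul (by positivity)]
      rw [show (2 : ℝ) * -(3 / 2) = -(3 : ℕ) by norm_num, Real.rpow_neg (by positivity),
        Real.rpow_natCast]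
    rw [this]; simp [div_eq_mul_inv]
  have h1 := heat_sub_mean_le (θ := θ) (N := 4) (Γ := A * R ^ (-3 : ℝ)) ht 0 le_rfl (by positivity)
    hθ hb (fun y hy => ?_)
  · rw [hs, norm_zero, add_zero, show 4 * R / 4 = R by ring, hG, sub_self, Real.rpow_zero,
      one_mul] at h1
    have h2 := hY _ ht
    rw [hs] at h2
    set I := ∫ y in Metric.ball 0 R, θ y
    set H := heat (16 * R ^ 2) θ 0
    have hc : (0 : ℝ) < (4 * Real.pi) ^ (-(3 / 2) : ℝ) := by positivity
    set c : ℝ := (4 * Real.pi) ^ (-(3 / 2) : ℝ)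
    have h3 := hm R hR
    have hR3 : (0 : ℝ) < (4 * R) ^ 3 := by positivity
    rw [le_div_iff₀ hc]
    have e4 : (4 * R) ^ (-4 : ℝ) = ((4 * R) ^ 4)⁻¹ := by
      rw [Real.rpow_neg (by positivity)]; norm_cast
    have e3 : R ^ (-3 : ℝ) = (R ^ 3)⁻¹ := by
      rw [Real.rpow_neg (by positivity)]; norm_cast
    rw [e4, e3] at h1
    have h4 : |c / (4 * R) ^ 3 * I| ≤ |H| + |H - c / (4 * R) ^ 3 * I| := by
      have := abs_sub H (H - c / (4 * R) ^ 3 * I)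
      rwa [sub_sub_cancel] at this
    have h5 : |c / (4 * R) ^ 3 * I| = |I| * c / (4 * R) ^ 3 := by
      rw [abs_mul, abs_of_pos (by positivity)]; ring
    have h6 : 3 * Real.exp ((4 + 1) ^ 2) * (4 / 3) ^ (4 : ℝ) * ((4 * R) ^ 4)⁻¹ *
        (∫ y in Metric.ball 0 R, ‖y‖ * |θ y|) ≤
        3 * Real.exp ((4 + 1) ^ 2) * (4 / 3) ^ (4 : ℝ) * ((4 * R) ^ 4)⁻¹ * (A * R) := by gcongr
    have h7 : |I| * c / (4 * R) ^ 3 ≤ |H| + (3 * Real.exp ((4 + 1) ^ 2) * (4 / 3) ^ (4 : ℝ) *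
        ((4 * R) ^ 4)⁻¹ * (A * R) + Real.exp 16 * tailConst 4 * (A * (R ^ 3)⁻¹)) := by
      rw [← h5]; linarith
    rw [div_le_iff₀ hR3] at h7
    refine h7.trans ?_
    have e : (|H| + (3 * Real.exp ((4 + 1) ^ 2) * (4 / 3) ^ (4 : ℝ) *
        ((4 * R) ^ 4)⁻¹ * (A * R) + Real.exp 16 * tailConst 4 * (A * (R ^ 3)⁻¹))) * (4 * R) ^ 3 =
        (4 * R) ^ 3 * |H| + 3 * Real.exp ((4 + 1) ^ 2) * (4 / 3) ^ (4 : ℝ) * A / 4 +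
          Real.exp 16 * tailConst 4 * A * 64 := by
      field_simp; ring
    rw [e]; gcongr
  · rw [hs, norm_zero, add_zero, show 4 * R / 4 = R by ring] at hy
    have hy0 : y ≠ 0 := by
      rintro rfl
      rw [norm_zero] at hy; linarith
    refine (hd y hy0).trans ?_
    gcongr ?_ * ?_
    exact Real.rpow_le_rpow_of_nonpos hR hy (by norm_num)

/-! ### Measurability of the linear evolution -/

lemma meas_heat {V : Type} [NormedAddCommGroup V] [NormedSpace ℝ V] [MeasurableSpace V]
    [BorelSpace V] [SecondCountableTopology V] {f : E3 → V} (hf : AEStronglyMeasurable f volume) :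
    Meas fun t x => heat t f x := by
  have h1 : StronglyMeasurable fun q : (ℝ × E3) × E3 => heatKernel q.1.1 (q.1.2 - q.2) • hf.mk f q.2 := by
    refine StronglyMeasurable.smul (Measurable.stronglyMeasurable ?_)
      (hf.stronglyMeasurable_mk.comp_measurable measurable_snd)
    exact measurable_heatKernel.comp (by fun_prop : Measurable fun q : (ℝ × E3) × E3 =>
      ((q.1.1, q.1.2 - q.2) : ℝ × E3))
  have h2 := (h1.integral_prod_right' (ν := volume)).measurable
  have h3 : Measurable fun p : Set.Ioi (0 : ℝ) × E3 => ((p.1 : ℝ), p.2) := by fun_prop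
  unfold Meas
  convert h2.comp h3 using 1
  funext p
  refine integral_congr_ae (hf.ae_eq_mk.mono fun y hy => ?_)
  simp only [hy]

lemma meas_heatLeray {θ : E3 → ℝ} (hθ : AEStronglyMeasurable θ volume) :
    Meas fun t x => t • heatLeray t (fun y => θ y • e3) x := by
  refine Meas.of_coord fun i => ?_
  have h1 : Measurable fun q : (ℝ × E3) × E3 =>
      oseenKernel₀ i 2 q.1.1 (q.1.2 - q.2) * hθ.mk θ q.2 := by
    refine Measurable.mul ?_ (hθ.stronglyMeasurable_mk.measurable.comp measurable_snd)
    exact (measurable_oseenKernel₀ i 2).comp (by fun_prop : Measurable fun q : (ℝ × E3) × E3 =>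
      ((q.1.1, q.1.2 - q.2) : ℝ × E3))
  have h2 := (h1.stronglyMeasurable.integral_prod_right' (ν := volume)).measurable
  have h3 : Measurable fun p : Set.Ioi (0 : ℝ) × E3 => ((p.1 : ℝ), p.2) := by fun_prop
  have h4 : Measurable fun p : Set.Ioi (0 : ℝ) × E3 => (p.1 : ℝ) := by fun_prop
  unfold Meas
  convert h4.mul (h2.comp h3) using 1
  funext p
  have hp : (0 : ℝ) < p.1 := p.1.2
  have : heatLeray p.1 (fun y => θ y • e3) p.2 i = ∫ y, oseenKernel p.1 i 2 (p.2 - y) * θ y := by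
    simp [heatLeray, e3]
  simp only [Pi.mul_apply, Function.comp, PiLp.smul_apply, this, smul_eq_mul]
  congr 1
  refine integral_congr_ae (hθ.ae_eq_mk.mono fun y hy => ?_)
  simp only [← hy, oseenKernel_eq hp, oseenKernel₀]

/-! ### Picard iteration -/

/-- The weighted bound `|u(s,y)| ≤ A (κ + √s + |y|)^{-m}`. -/
def Bd {V : Type} [NormedAddCommGroup V] (κ m A : ℝ) (u : ℝ → E3 → V) : Prop :=
  ∀ s, 0 < s → ∀ y, ‖u s y‖ ≤ A * wt κ m s y

/-- Pairs of measurable functions in the ball of radius `R` of `𝒳 × 𝒴`. -/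
structure Small (R : ℝ) (u : ℝ → E3 → E3) (θ : ℝ → E3 → ℝ) : Prop where
  meas_u : Meas u
  meas_θ : Meas θ
  bd_u : Bd 0 1 R u
  bd_θ : Bd 0 3 R θ

lemma norm_smul_e3 (c : ℝ) : ‖c • e3‖ = ‖c‖ := by
  simp [e3, norm_smul]

lemma Meas.smul_e3 {θ : ℝ → E3 → ℝ} (h : Meas θ) : Meas fun s y => θ s y • e3 :=
  Measurable.smul_const h e3

section

variable {V W : Type} [NormedAddCommGroup V] [NormedAddCommGroup W]

lemma Bd.prod_left {κ m A R : ℝ} {w : ℝ → E3 → V} {v : ℝ → E3 → W} (hR : 0 ≤ R)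
    (hw : Bd 0 1 R w) (hv : Bd κ m A v) : ProdBound κ m (R * A) w v := by
  intro s hs y
  have h1 := wt_nonneg le_rfl 1 s y
  calc _ ≤ (R * wt 0 1 s y) * (A * wt κ m s y) :=
        mul_le_mul (hw s hs y) (hv s hs y) (norm_nonneg _) (by positivity)
    _ = _ := by ring

lemma Bd.prod_right {κ m A R : ℝ} {w : ℝ → E3 → V} {v : ℝ → E3 → W} (hR : 0 ≤ R)
    (hw : Bd κ m A w) (hv : Bd 0 1 R v) : ProdBound κ m (R * A) w v := by
  intro s hs y
  rw [mul_comm]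
  exact (hv.prod_left hR hw) s hs y

lemma Bd.smul_e3 {κ m A : ℝ} {θ : ℝ → E3 → ℝ} (h : Bd κ m A θ) :
    Bd κ m A fun s y => θ s y • e3 := fun s hs y => by
  rw [norm_smul_e3]; exact h s hs y

/-- The factor t - s ≤ t of the buoyancy operator costs two powers of the weight; hence a velocity
weight m is always paired with a temperature weight m + 2. -/
lemma mul_wt_add_two_le {κ m t : ℝ} (hκ : 0 ≤ κ) (ht : 0 < t) (x : E3) :
    t * wt κ (m + 2) t x ≤ wt κ m t x := by
  have hst := Real.sqrt_pos.2 ht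
  have hp : 0 < κ + (√t + ‖x‖) := by positivity
  have e : t = √t ^ (2 : ℝ) := by rw [Real.rpow_two, Real.sq_sqrt ht.le]
  have h1 : √t ^ (2 : ℝ) ≤ (κ + (√t + ‖x‖)) ^ (2 : ℝ) :=
    Real.rpow_le_rpow hst.le (by linarith [norm_nonneg x]) (by norm_num)
  unfold wt
  calc _ ≤ (κ + (√t + ‖x‖)) ^ (2 : ℝ) * (κ + (√t + ‖x‖)) ^ (-(m + 2)) := by
        nth_rw 1 [e]; gcongr
    _ = _ := by rw [← Real.rpow_add hp]; congr 1; ring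

end

section

variable {u u' : ℝ → E3 → E3} {θ θ' : ℝ → E3 → ℝ} {R K : ℝ}

/-- One factor is measured by the scale invariant radius R, the other by A. The result is linear in
A, so smallness of R alone controls weighted bounds of any size. -/
lemma bd_opB (hz : Small R u θ) (hR : 0 ≤ R) {κ m A : ℝ} (hκ : 0 ≤ κ) (hm : 0 ≤ m) (hm4 : m < 4)
    (hK : opConst m ≤ K) (hA : 0 ≤ A) (hu : Bd κ m A u) : Bd κ m (K * R * A) (opB u u) := by
  intro t ht x
  have hw := wt_nonneg hκ m t x
  rw [opB_eq]
  refine (norm_opG_wt_le hz.meas_u hz.meas_u ⟨hκ, hm, hm4, by positivity⟩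
    (hz.bd_u.prod_left hR hu) ht x).trans ?_
  rw [pow_zero, mul_one, ← mul_assoc]
  gcongr

/-- The restriction m < 2 keeps the temperature weight m + 2 below 4. -/
lemma bd_opE (hz : Small R u θ) (hR : 0 ≤ R) {κ m A : ℝ} (hκ : 0 ≤ κ) (hm : 0 ≤ m) (hm2 : m < 2)
    (hK : opConst (m + 2) ≤ K) (hA : 0 ≤ A) (hθ : Bd κ (m + 2) A θ) :
    Bd κ m (K * R * A) (opE u θ) := by
  intro t ht x
  have hw := wt_nonneg hκ m t x
  rw [opE_eq]
  refine (norm_opG_wt_le hz.meas_θ.smul_e3 hz.meas_u ⟨hκ, by linarith, by linarith, by positivity⟩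
    (hθ.smul_e3.prod_right hR hz.bd_u) ht x).trans ?_
  have h0 := opConst_pos (m := m + 2) (by linarith)
  calc _ = opConst (m + 2) * (R * A) * (t * wt κ (m + 2) t x) := by ring
    _ ≤ K * (R * A) * wt κ m t x := by
        have := mul_wt_add_two_le (m := m) hκ ht x
        have h1 := wt_nonneg hκ (m + 2) t x
        have h2 := h0.trans_le hK
        gcongr
    _ = _ := by ring

lemma bd_opBt (hz : Small R u θ) (hR : 0 ≤ R) {κ m A : ℝ} (hκ : 0 ≤ κ) (hm : 0 ≤ m) (hm4 : m < 4)
    (hK : opConst m ≤ K) (hA : 0 ≤ A) (hθ : Bd κ m A θ) : Bd κ m (K * R * A) (opBt θ u) := by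
  intro t ht x
  have hw := wt_nonneg hκ m t x
  refine (abs_opBt_wt_le hz.meas_θ hz.meas_u ⟨hκ, hm, hm4, by positivity⟩
    (hθ.prod_right hR hz.bd_u) ht x).trans ?_
  rw [← mul_assoc]
  gcongr

lemma bd_opB_sub (hz : Small R u θ) (hz' : Small R u' θ') (hR : 0 ≤ R) {δ : ℝ} (hδ : 0 ≤ δ)
    (hK : opConst 1 ≤ K) (hu : Bd 0 1 δ fun s y => u s y - u' s y) :
    Bd 0 1 (2 * K * R * δ) fun t x => opB u u t x - opB u' u' t x := by
  intro t ht x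
  have hw := wt_nonneg le_rfl 1 t x
  have m1 : Meas fun s y => u s y - u' s y := Measurable.sub hz.meas_u hz'.meas_u
  have a : ∀ A : ℝ, 0 ≤ A → Admissible 0 1 A := fun A hA => ⟨le_rfl, by norm_num, by norm_num, hA⟩
  have p1 := hu.prod_right hR hz.bd_u
  have p2 := hz'.bd_u.prod_left hR hu
  simp only [opB_eq]
  rw [opG_sub hz.meas_u hz.meas_u hz'.meas_u hz'.meas_u (a _ (by positivity))
    (hz.bd_u.prod_left hR hz.bd_u) (hz'.bd_u.prod_left hR hz.bd_u)
    (hz'.bd_u.prod_left hR hz'.bd_u) (a _ (by positivity)) p1 (a _ (by positivity)) p2 ht x]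
  have b1 := norm_opG_wt_le (e := 0) m1 hz.meas_u (a _ (by positivity)) p1 ht x
  have b2 := norm_opG_wt_le (e := 0) hz'.meas_u m1 (a _ (by positivity)) p2 ht x
  rw [pow_zero, mul_one] at b1 b2
  have b3 : opConst 1 * (R * δ) * wt 0 1 t x ≤ K * (R * δ) * wt 0 1 t x := by gcongr
  refine (norm_add_le _ _).trans ?_
  linarith

lemma bd_opE_sub (hz : Small R u θ) (hz' : Small R u' θ') (hR : 0 ≤ R) {δ : ℝ} (hδ : 0 ≤ δ)
    (hK : opConst 3 ≤ K) (hu : Bd 0 1 δ fun s y => u s y - u' s y)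
    (hθ : Bd 0 3 δ fun s y => θ s y - θ' s y) :
    Bd 0 1 (2 * K * R * δ) fun t x => opE u θ t x - opE u' θ' t x := by
  intro t ht x
  have hw := wt_nonneg le_rfl 3 t x
  have m1 : Meas fun s y => u s y - u' s y := Measurable.sub hz.meas_u hz'.meas_u
  have m2 : Meas fun s y => θ s y • e3 - θ' s y • e3 :=
    Measurable.sub hz.meas_θ.smul_e3 hz'.meas_θ.smul_e3
  have a : ∀ A : ℝ, 0 ≤ A → Admissible 0 3 A := fun A hA => ⟨le_rfl, by norm_num, by norm_num, hA⟩
  have hθ' : Bd 0 3 δ fun s y => θ s y • e3 - θ' s y • e3 := fun s hs y => by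
    simp only [← sub_smul, norm_smul_e3]; exact hθ s hs y
  have p1 := hθ'.prod_right hR hz.bd_u
  have p2 := hz'.bd_θ.smul_e3.prod_right hδ hu
  simp only [opE_eq]
  rw [opG_sub hz.meas_θ.smul_e3 hz.meas_u hz'.meas_θ.smul_e3 hz'.meas_u (a _ (by positivity))
    (hz.bd_θ.smul_e3.prod_right hR hz.bd_u) (hz'.bd_θ.smul_e3.prod_right hR hz.bd_u)
    (hz'.bd_θ.smul_e3.prod_right hR hz'.bd_u) (a _ (by positivity)) p1 (a _ (by positivity)) p2 ht x]
  have b1 := norm_opG_wt_le (e := 1) m2 hz.meas_u (a _ (by positivity)) p1 ht x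
  have b2 := norm_opG_wt_le (e := 1) hz'.meas_θ.smul_e3 m1 (a _ (by positivity)) p2 ht x
  have h0 := opConst_pos (m := 3) (by norm_num)
  have b3 : opConst 3 * (R * δ) * (t * wt 0 3 t x) ≤ K * (R * δ) * wt 0 1 t x := by
    have := mul_wt_add_two_le (κ := 0) (m := 1) le_rfl ht x
    rw [show (1 : ℝ) + 2 = 3 by norm_num] at this
    have h2 := h0.trans_le hK
    gcongr
  refine (norm_add_le _ _).trans ?_
  linarith

lemma bd_opBt_sub (hz : Small R u θ) (hz' : Small R u' θ') (hR : 0 ≤ R) {δ : ℝ} (hδ : 0 ≤ δ)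
    (hK : opConst 3 ≤ K) (hu : Bd 0 1 δ fun s y => u s y - u' s y)
    (hθ : Bd 0 3 δ fun s y => θ s y - θ' s y) :
    Bd 0 3 (2 * K * R * δ) fun t x => opBt θ u t x - opBt θ' u' t x := by
  intro t ht x
  have hw := wt_nonneg le_rfl 3 t x
  have m1 : Meas fun s y => u s y - u' s y := Measurable.sub hz.meas_u hz'.meas_u
  have m2 : Meas fun s y => θ s y - θ' s y := Measurable.sub hz.meas_θ hz'.meas_θ
  have a : ∀ A : ℝ, 0 ≤ A → Admissible 0 3 A := fun A hA => ⟨le_rfl, by norm_num, by norm_num, hA⟩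
  have p1 := hθ.prod_right hR hz.bd_u
  have p2 := hz'.bd_θ.prod_right hδ hu
  simp only
  rw [opBt_sub hz.meas_θ hz.meas_u hz'.meas_θ hz'.meas_u (a _ (by positivity))
    (hz.bd_θ.prod_right hR hz.bd_u) (hz'.bd_θ.prod_right hR hz.bd_u)
    (hz'.bd_θ.prod_right hR hz'.bd_u) (a _ (by positivity)) p1 (a _ (by positivity)) p2 ht x]
  have b1 := abs_opBt_wt_le m2 hz.meas_u (a _ (by positivity)) p1 ht x
  have b2 := abs_opBt_wt_le hz'.meas_θ m1 (a _ (by positivity)) p2 ht x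
  have b3 : opConst 3 * (R * δ) * wt 0 3 t x ≤ K * (R * δ) * wt 0 3 t x := by gcongr
  refine (norm_add_le _ _).trans ?_
  rw [Real.norm_eq_abs, Real.norm_eq_abs]
  linarith

end

/-! ### Invariance, contraction and the fixed point -/

/-- One Picard step for the velocity. -/
def stepU (L : ℝ → E3 → E3) (u : ℝ → E3 → E3) (θ : ℝ → E3 → ℝ) (t : ℝ) (x : E3) : E3 :=
  L t x + opB u u t x + opE u θ t x

/-- One Picard step for the temperature. -/
def stepΘ (Λ : ℝ → E3 → ℝ) (u : ℝ → E3 → E3) (θ : ℝ → E3 → ℝ) (t : ℝ) (x : E3) : ℝ :=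
  Λ t x + opBt θ u t x

section

variable {L u u' : ℝ → E3 → E3} {Λ θ θ' : ℝ → E3 → ℝ} {R K : ℝ}

/-- As K R ≤ 1/8, each bilinear term is at most B/4 when the arguments are at most 2B. Twice the
linear bound is therefore preserved, however large B is. -/
lemma bd_step (hz : Small R u θ) (hR : 0 ≤ R) (hKR : 8 * K * R ≤ 1) {κ m B : ℝ} (hκ : 0 ≤ κ)
    (hm : 0 ≤ m) (hm2 : m < 2) (hK : opConst m ≤ K) (hK' : opConst (m + 2) ≤ K) (hB : 0 ≤ B)
    (hL : Bd κ m B L) (hΛ : Bd κ (m + 2) B Λ) (hu : Bd κ m (2 * B) u)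
    (hθ : Bd κ (m + 2) (2 * B) θ) :
    Bd κ m (2 * B) (stepU L u θ) ∧ Bd κ (m + 2) (2 * B) (stepΘ Λ u θ) := by
  have h1 := bd_opB hz hR hκ hm (by linarith) hK (by positivity : 0 ≤ 2 * B) hu
  have h2 := bd_opE hz hR hκ hm hm2 hK' (by positivity : 0 ≤ 2 * B) hθ
  have h3 := bd_opBt hz hR hκ (by linarith) (by linarith) hK' (by positivity : 0 ≤ 2 * B) hθ
  have hc : K * R * (2 * B) ≤ B / 4 := by nlinarith
  constructor
  · intro t ht x
    have hw := wt_nonneg hκ m t x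
    refine (norm_add₃_le).trans ((add_le_add (add_le_add (hL t ht x) (h1 t ht x)) (h2 t ht x)).trans ?_)
    nlinarith
  · intro t ht x
    have hw := wt_nonneg hκ (m + 2) t x
    refine (norm_add_le _ _).trans ((add_le_add (hΛ t ht x) (h3 t ht x)).trans ?_)
    nlinarith

lemma admissible_zero {m A : ℝ} (hm : 0 ≤ m) (hm4 : m < 4) (hA : 0 ≤ A) : Admissible 0 m A :=
  ⟨le_rfl, hm, hm4, hA⟩

lemma small_step (hz : Small R u θ) (hR : 0 ≤ R) (hKR : 8 * K * R ≤ 1)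
    (hK : opConst 1 ≤ K) (hK' : opConst 3 ≤ K) (mL : Meas L) (mΛ : Meas Λ)
    (hL : Bd 0 1 (R / 2) L) (hΛ : Bd 0 3 (R / 2) Λ) : Small R (stepU L u θ) (stepΘ Λ u θ) := by
  have e : (1 : ℝ) + 2 = 3 := by norm_num
  have e2 : 2 * (R / 2) = R := by ring
  have h := bd_step (κ := 0) (m := 1) (B := R / 2) hz hR hKR le_rfl (by norm_num) (by norm_num) hK
    (by rwa [e]) (by positivity) hL (by rwa [e]) (by rw [e2]; exact hz.bd_u)
    (by rw [e, e2]; exact hz.bd_θ)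
  rw [e, e2] at h
  refine ⟨?_, ?_, h.1, h.2⟩
  · have m1 : Meas (opB u u) := by
      rw [opB_eq]
      exact Meas.opG hz.meas_u hz.meas_u (admissible_zero (by norm_num) (by norm_num) (by positivity))
        (hz.bd_u.prod_left hR hz.bd_u)
    have m2 : Meas (opE u θ) := by
      rw [opE_eq]
      exact Meas.opG hz.meas_θ.smul_e3 hz.meas_u
        (admissible_zero (by norm_num) (by norm_num) (by positivity))
        (hz.bd_θ.smul_e3.prod_right hR hz.bd_u)
    exact Measurable.add (Measurable.add mL m1) m2
  · have m3 : Meas (opBt θ u) := Meas.opBt hz.meas_θ hz.meas_u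
      (admissible_zero (by norm_num) (by norm_num) (by positivity))
      (hz.bd_θ.prod_right hR hz.bd_u)
    exact Measurable.add mΛ m3

/-- Each operator contributes at most 2 K R δ ≤ δ/4, and the velocity equation contains two of them:
the contraction factor is 1/2. -/
lemma bd_step_sub (hz : Small R u θ) (hz' : Small R u' θ') (hR : 0 ≤ R) (hKR : 8 * K * R ≤ 1)
    (hK : opConst 1 ≤ K) (hK' : opConst 3 ≤ K) {δ : ℝ} (hδ : 0 ≤ δ)
    (hu : Bd 0 1 δ fun s y => u s y - u' s y) (hθ : Bd 0 3 δ fun s y => θ s y - θ' s y) :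
    (Bd 0 1 (δ / 2) fun s y => stepU L u θ s y - stepU L u' θ' s y) ∧
      Bd 0 3 (δ / 2) fun s y => stepΘ Λ u θ s y - stepΘ Λ u' θ' s y := by
  have h1 := bd_opB_sub hz hz' hR hδ hK hu
  have h2 := bd_opE_sub hz hz' hR hδ hK' hu hθ
  have h3 := bd_opBt_sub hz hz' hR hδ hK' hu hθ
  have hc : 2 * K * R * δ ≤ δ / 4 := by nlinarith
  constructor
  · intro t ht x
    have hw := wt_nonneg le_rfl 1 t x
    have e : stepU L u θ t x - stepU L u' θ' t x =
        (opB u u t x - opB u' u' t x) + (opE u θ t x - opE u' θ' t x) := by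
      unfold stepU; abel
    simp only [e]
    refine (norm_add_le _ _).trans ((add_le_add (h1 t ht x) (h2 t ht x)).trans ?_)
    nlinarith
  · intro t ht x
    have hw := wt_nonneg le_rfl 3 t x
    have e : stepΘ Λ u θ t x - stepΘ Λ u' θ' t x = opBt θ u t x - opBt θ' u' t x := by
      unfold stepΘ; ring
    simp only [e]
    refine (h3 t ht x).trans ?_
    nlinarith

lemma bd_sub_zero {V : Type} [NormedAddCommGroup V] {m : ℝ} {u u' : ℝ → E3 → V} (hu : Bd 0 m R u)
    (hu' : Bd 0 m R u') : Bd 0 m (2 * R) fun s y => u s y - u' s y := fun s hs y => by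
  refine (norm_sub_le _ _).trans ?_
  linarith [hu s hs y, hu' s hs y]

/-- The difference, at most 2R to begin with, is halved by each application of the integral
equation. -/
lemma fixed_unique (hz : Small R u θ) (hz' : Small R u' θ') (hR : 0 ≤ R) (hKR : 8 * K * R ≤ 1)
    (hK : opConst 1 ≤ K) (hK' : opConst 3 ≤ K)
    (hu : ∀ t, 0 < t → ∀ x, u t x = stepU L u θ t x)
    (hθ : ∀ t, 0 < t → ∀ x, θ t x = stepΘ Λ u θ t x)
    (hu' : ∀ t, 0 < t → ∀ x, u' t x = stepU L u' θ' t x)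
    (hθ' : ∀ t, 0 < t → ∀ x, θ' t x = stepΘ Λ u' θ' t x) :
    ∀ t, 0 < t → ∀ x, u t x = u' t x ∧ θ t x = θ' t x := by
  have key : ∀ n : ℕ, (Bd 0 1 (2 * R * (1 / 2) ^ n) fun s y => u s y - u' s y) ∧
      Bd 0 3 (2 * R * (1 / 2) ^ n) fun s y => θ s y - θ' s y := by
    intro n
    induction n with
    | zero =>
      rw [pow_zero, mul_one]
      exact ⟨bd_sub_zero hz.bd_u hz'.bd_u, bd_sub_zero hz.bd_θ hz'.bd_θ⟩
    | succ n ih =>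
      have h := bd_step_sub (L := L) (Λ := Λ) hz hz' hR hKR hK hK' (by positivity) ih.1 ih.2
      have e : 2 * R * (1 / 2) ^ (n + 1) = 2 * R * (1 / 2) ^ n / 2 := by rw [pow_succ]; ring
      rw [e]
      constructor
      · intro s hs y
        have := h.1 s hs y
        simp only [← hu s hs y, ← hu' s hs y] at this
        exact this
      · intro s hs y
        have := h.2 s hs y
        simp only [← hθ s hs y, ← hθ' s hs y] at this
        exact this
  have lim : ∀ c : ℝ, Filter.Tendsto (fun n : ℕ => 2 * R * (1 / 2) ^ n * c) Filter.atTop (nhds 0) := by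
    intro c
    have := ((tendsto_pow_atTop_nhds_zero_of_lt_one (r := (1 / 2 : ℝ)) (by norm_num)
      (by norm_num)).const_mul (2 * R)).mul_const c
    simpa using this
  intro t ht x
  constructor
  · have := ge_of_tendsto' (lim (wt 0 1 t x)) fun n => (key n).1 t ht x
    exact sub_eq_zero.1 (norm_le_zero_iff.1 this)
  · have := ge_of_tendsto' (lim (wt 0 3 t x)) fun n => (key n).2 t ht x
    exact sub_eq_zero.1 (norm_le_zero_iff.1 this)

/-- The Picard iterates. -/
def picard (L : ℝ → E3 → E3) (Λ : ℝ → E3 → ℝ) : ℕ → (ℝ → E3 → E3) × (ℝ → E3 → ℝ)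
  | 0 => (fun _ _ => 0, fun _ _ => 0)
  | n + 1 => (stepU L (picard L Λ n).1 (picard L Λ n).2, stepΘ Λ (picard L Λ n).1 (picard L Λ n).2)

lemma bd_zero {V : Type} [NormedAddCommGroup V] {κ m A : ℝ} (hκ : 0 ≤ κ) (hA : 0 ≤ A) :
    Bd κ m A fun (_ : ℝ) (_ : E3) => (0 : V) := fun s _ y => by
  rw [norm_zero]; exact mul_nonneg hA (wt_nonneg hκ m s y)

/-- Increments decay geometrically at each point with t > 0, so pointwise limits suffice: they
preserve measurability, and summing the geometric tail gives the rate. Nonpositive times receive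
arbitrary values. -/
lemma exists_limit {V : Type} [NormedAddCommGroup V] [CompleteSpace V] [MeasurableSpace V]
    [BorelSpace V] {m : ℝ} {v : ℕ → ℝ → E3 → V} (hv : ∀ n, Meas (v n))
    (hd : ∀ n, Bd 0 m (2 * R * (1 / 2) ^ n) fun s y => v (n + 1) s y - v n s y) :
    ∃ u : ℝ → E3 → V, Meas u ∧
      (∀ t, 0 < t → ∀ x, Filter.Tendsto (fun n => v n t x) Filter.atTop (nhds (u t x))) ∧
      ∀ n, Bd 0 m (4 * R * (1 / 2) ^ n) fun s y => v n s y - u s y := by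
  have hd' : ∀ t, 0 < t → ∀ x n, dist (v n t x) (v (n + 1) t x) ≤
      2 * R * wt 0 m t x * (1 / 2) ^ n := fun t ht x n => by
    rw [dist_comm, dist_eq_norm]
    exact (hd n t ht x).trans (le_of_eq (by ring))
  have hc : ∀ t x, ∃ l, 0 < t → Filter.Tendsto (fun n => v n t x) Filter.atTop (nhds l) := by
    intro t x
    by_cases ht : 0 < t
    · obtain ⟨l, hl⟩ := cauchySeq_tendsto_of_complete
        (cauchySeq_of_le_geometric (1 / 2) _ (by norm_num) (hd' t ht x))
      exact ⟨l, fun _ => hl⟩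
    · exact ⟨0, fun h => absurd h ht⟩
  choose u hu using hc
  refine ⟨u, ?_, fun t ht x => hu t x ht, fun n t ht x => ?_⟩
  · refine measurable_of_tendsto_metrizable hv (tendsto_pi_nhds.2 fun p => hu p.1 p.2 p.1.2)
  · have := dist_le_of_le_geometric_of_tendsto (1 / 2) _ (by norm_num) (hd' t ht x) (hu t x ht) n
    rw [dist_eq_norm] at this
    refine this.trans (le_of_eq ?_)
    ring

lemma exists_fixed (hR : 0 ≤ R) (hKR : 8 * K * R ≤ 1)
    (hK : opConst 1 ≤ K) (hK' : opConst 3 ≤ K) (mL : Meas L) (mΛ : Meas Λ)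
    (hL : Bd 0 1 (R / 2) L) (hΛ : Bd 0 3 (R / 2) Λ) :
    ∃ (u : ℝ → E3 → E3) (θ : ℝ → E3 → ℝ), Small R u θ ∧
      (∀ t, 0 < t → ∀ x, u t x = stepU L u θ t x) ∧
      (∀ t, 0 < t → ∀ x, θ t x = stepΘ Λ u θ t x) ∧
      ∀ κ m B : ℝ, 0 ≤ κ → 0 ≤ m → m < 2 → opConst m ≤ K → opConst (m + 2) ≤ K → 0 ≤ B →
        Bd κ m B L → Bd κ (m + 2) B Λ → Bd κ m (2 * B) u ∧ Bd κ (m + 2) (2 * B) θ := by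
  have hs : ∀ n, Small R (picard L Λ n).1 (picard L Λ n).2 := by
    intro n
    induction n with
    | zero => exact ⟨measurable_const, measurable_const, bd_zero le_rfl hR, bd_zero le_rfl hR⟩
    | succ n ih => exact small_step ih hR hKR hK hK' mL mΛ hL hΛ
  have hd : ∀ n : ℕ, (Bd 0 1 (2 * R * (1 / 2) ^ n) fun s y =>
        (picard L Λ (n + 1)).1 s y - (picard L Λ n).1 s y) ∧
      Bd 0 3 (2 * R * (1 / 2) ^ n) fun s y =>
        (picard L Λ (n + 1)).2 s y - (picard L Λ n).2 s y := by
    intro n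
    induction n with
    | zero =>
      rw [pow_zero, mul_one]
      exact ⟨bd_sub_zero (hs 1).bd_u (hs 0).bd_u, bd_sub_zero (hs 1).bd_θ (hs 0).bd_θ⟩
    | succ n ih =>
      have h := bd_step_sub (L := L) (Λ := Λ) (hs (n + 1)) (hs n) hR hKR hK hK' (by positivity)
        ih.1 ih.2
      have e : 2 * R * (1 / 2) ^ (n + 1) = 2 * R * (1 / 2) ^ n / 2 := by rw [pow_succ]; ring
      rw [e]
      exact h
  obtain ⟨u, mu, tu, du⟩ := exists_limit (fun n => (hs n).meas_u) fun n => (hd n).1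
  obtain ⟨θ, mθ, tθ, dθ⟩ := exists_limit (fun n => (hs n).meas_θ) fun n => (hd n).2
  have hz : Small R u θ := ⟨mu, mθ,
    fun s hs' y => le_of_tendsto' (tu s hs' y).norm fun n => (hs n).bd_u s hs' y,
    fun s hs' y => le_of_tendsto' (tθ s hs' y).norm fun n => (hs n).bd_θ s hs' y⟩
  have hst : ∀ n, (Bd 0 1 (4 * R * (1 / 2) ^ n / 2) fun s y =>
        (picard L Λ (n + 1)).1 s y - stepU L u θ s y) ∧
      Bd 0 3 (4 * R * (1 / 2) ^ n / 2) fun s y => (picard L Λ (n + 1)).2 s y - stepΘ Λ u θ s y :=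
    fun n => bd_step_sub (hs n) hz hR hKR hK hK' (by positivity) (du n) (dθ n)
  have lim : ∀ c : ℝ,
      Filter.Tendsto (fun n : ℕ => 4 * R * (1 / 2) ^ n / 2 * c) Filter.atTop (nhds 0) := by
    intro c
    have := (((tendsto_pow_atTop_nhds_zero_of_lt_one (r := (1 / 2 : ℝ)) (by norm_num)
      (by norm_num)).const_mul (4 * R)).div_const 2).mul_const c
    simpa using this
  refine ⟨u, θ, hz, fun t ht x => ?_, fun t ht x => ?_, fun κ m B hκ hm hm2 h1 h2 hB bL bΛ => ?_⟩
  · refine tendsto_nhds_unique ((tu t ht x).comp (Filter.tendsto_add_atTop_nat 1)) ?_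
    rw [tendsto_iff_norm_sub_tendsto_zero]
    exact squeeze_zero (fun _ => norm_nonneg _) (fun n => (hst n).1 t ht x) (lim _)
  · refine tendsto_nhds_unique ((tθ t ht x).comp (Filter.tendsto_add_atTop_nat 1)) ?_
    rw [tendsto_iff_norm_sub_tendsto_zero]
    exact squeeze_zero (fun _ => norm_nonneg _) (fun n => (hst n).2 t ht x) (lim _)
  -- Persistence is proved along the iterates, which start from 0, and passes to the pointwise
  -- limit; nothing about the decay of the solution has to be known beforehand.
  · have hb : ∀ n, Bd κ m (2 * B) (picard L Λ n).1 ∧ Bd κ (m + 2) (2 * B) (picard L Λ n).2 := by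
      intro n
      induction n with
      | zero => exact ⟨bd_zero hκ (by positivity), bd_zero hκ (by positivity)⟩
      | succ n ih => exact bd_step (hs n) hR hKR hκ hm hm2 h1 h2 hB bL bΛ ih.1 ih.2
    exact ⟨fun s hs' y => le_of_tendsto' (tu s hs' y).norm fun n => (hb n).1 s hs' y,
      fun s hs' y => le_of_tendsto' (tθ s hs' y).norm fun n => (hb n).2 s hs' y⟩

end

/-! ### Far and near sources -/

lemma splitBound_rpow {f : ℝ → E3 → ℝ} {t Γ A α β : ℝ} (ht : 0 < t) (x : E3) (hΓ : 0 ≤ Γ) (hA : 0 ≤ A)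
    (hα : α < 2) (hβ : β < 3)
    (hfar : ∀ s, 0 < s → s < t → ∀ y, (√t + ‖x‖) / 4 ≤ √s + ‖y‖ → |f s y| ≤ Γ)
    (hnear : ∀ s, 0 < s → ∀ y, y ≠ 0 → |f s y| ≤ A * (√s ^ (-α) * ‖y‖ ^ (-β))) :
    SplitBound f t x Γ (fun s => A * √s ^ (-α)) fun y => ‖y‖ ^ (-β) := by
  have hst := Real.sqrt_pos.2 ht
  have hρ : 0 < √t + ‖x‖ := by positivity
  refine ⟨hΓ, fun s => by positivity, fun y => by positivity,
    (integral_sqrt_rpow ht hα).1.const_mul A, (integrableOn_ball_norm_rpow hβ hρ).1,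
    fun s hs hst y _ h => hfar s hs hst y h, fun s hs _ y hy _ => ?_⟩
  rw [mul_assoc]; exact hnear s hs y hy

/-- Far and near bounds on the source are independent here. In a bootstrap the far bound carries the
best decay known so far, while the near bound only has to be integrable, whence α < 2 and β < 3. -/
lemma duh_rpow_le (N α β : ℝ) (hα : α < 2) (hβ : β < 3) : ∃ C', 0 ≤ C' ∧
    ∀ {k f : ℝ → E3 → ℝ} {e : ℕ} {C t Γ A : ℝ} {x : E3}, KernelBound k e N C → 0 < t → 0 ≤ Γ → 0 ≤ A →
    (∀ s, 0 < s → s < t → ∀ y, (√t + ‖x‖) / 4 ≤ √s + ‖y‖ → |f s y| ≤ Γ) →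
    (∀ s, 0 < s → ∀ y, y ≠ 0 → |f s y| ≤ A * (√s ^ (-α) * ‖y‖ ^ (-β))) →
    |duh k f t x| ≤ C * C' * t ^ e * (Γ * √t +
      A * (√t ^ (N - 2 - α) * (√t + ‖x‖) ^ (3 - N - β))) := by
  have hB := ballConst_nonneg β
  have hD := duhConst_pos N
  have h2 : 0 < 2 - α := by linarith
  refine ⟨duhConst N * (1 + 2 / (2 - α) * ballConst β), by positivity, ?_⟩
  intro k f e C t Γ A x hk ht hΓ hA hfar hnear
  have hst := Real.sqrt_pos.2 ht
  have hρ : 0 < √t + ‖x‖ := by positivity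
  have hC := hk.pos
  refine (duh_le hk ht (splitBound_rpow ht x hΓ hA hα hβ hfar hnear)).trans ?_
  rw [intervalIntegral.integral_const_mul, (integral_sqrt_rpow ht hα).2,
    (integrableOn_ball_norm_rpow hβ hρ).2]
  have e1 : √t ^ (N - 2 - α) = √t ^ (N - 4) * √t ^ (2 - α) := by
    rw [← Real.rpow_add hst]; congr 1; ring
  have e2 : (√t + ‖x‖) ^ (3 - N - β) = (√t + ‖x‖) ^ (-N) * (√t + ‖x‖) ^ (3 - β) := by
    rw [← Real.rpow_add hρ]; congr 1; ring
  rw [e1, e2]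
  set X := √t ^ (N - 4) * √t ^ (2 - α) * ((√t + ‖x‖) ^ (-N) * (√t + ‖x‖) ^ (3 - β))
  have hX : 0 ≤ X := by positivity
  calc _ = C * duhConst N * t ^ e * (Γ * √t * 1 + A * X * (2 / (2 - α) * ballConst β)) := by ring
    _ ≤ C * duhConst N * t ^ e * (Γ * √t * (1 + 2 / (2 - α) * ballConst β) +
          A * X * (1 + 2 / (2 - α) * ballConst β)) := by
        have : 0 ≤ 2 / (2 - α) * ballConst β := by positivity
        gcongr <;> linarith
    _ = _ := by ring

lemma integral_one_add_rpow {t : ℝ} (ht : 0 < t) :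
    IntervalIntegrable (fun s : ℝ => (1 + s) ^ (-(9 / 8) : ℝ)) volume 0 t ∧
      ∫ s in (0 : ℝ)..t, (1 + s) ^ (-(9 / 8) : ℝ) ≤ 8 := by
  have h0 : (0 : ℝ) ∉ Set.uIcc 1 (1 + t) := by
    rw [Set.uIcc_of_le (by linarith)]; simp
  constructor
  · refine ContinuousOn.intervalIntegrable ?_
    rw [Set.uIcc_of_le ht.le]
    refine ContinuousOn.rpow_const (by fun_prop) fun s hs => Or.inl ?_
    linarith [hs.1]
  · rw [intervalIntegral.integral_comp_add_left (fun s : ℝ => s ^ (-(9 / 8) : ℝ)) 1, add_zero,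
      integral_rpow (Or.inr ⟨by norm_num, h0⟩), Real.one_rpow]
    have : 0 ≤ (1 + t) ^ (-(9 / 8) + 1 : ℝ) := by positivity
    rw [div_le_iff_of_neg (by norm_num)]
    linarith

/-- A source of weight 11/2 > 5 has finite mass over all of space-time, so the near part is just a
constant times the kernel bound at (t, x). -/
lemma duh_int_le (N : ℝ) : ∃ C', 0 ≤ C' ∧
    ∀ {k f : ℝ → E3 → ℝ} {e : ℕ} {C t Γ A : ℝ} {x : E3}, KernelBound k e N C → 0 < t → 0 ≤ Γ → 0 ≤ A →
    (∀ s, 0 < s → s < t → ∀ y, (√t + ‖x‖) / 4 ≤ √s + ‖y‖ → |f s y| ≤ Γ) →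
    (∀ s, 0 < s → ∀ y, |f s y| ≤ A * wt 1 (11 / 2) s y) →
    |duh k f t x| ≤ C * C' * t ^ e * (Γ * √t + A * (√t ^ (N - 4) * (√t + ‖x‖) ^ (-N))) := by
  have hT := tailConst_nonneg (13 / 4)
  have hD := duhConst_pos N
  refine ⟨duhConst N * (1 + 8 * tailConst (13 / 4)), by positivity, ?_⟩
  intro k f e C t Γ A x hk ht hΓ hA hfar hnear
  have hst := Real.sqrt_pos.2 ht
  have hρ : 0 < √t + ‖x‖ := by positivity
  have hC := hk.pos
  obtain ⟨i1, j1⟩ := integral_one_add_rpow ht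
  obtain ⟨i2, j2⟩ := integrable_add_norm_rpow one_pos (by norm_num : (3 : ℝ) < 13 / 4)
  rw [Real.one_rpow, mul_one] at j2
  have j3 : ∫ y in Metric.ball (0 : E3) (√t + ‖x‖), (1 + ‖y‖) ^ (-(13 / 4) : ℝ) ≤
      tailConst (13 / 4) := by
    rw [← j2]
    exact setIntegral_le_integral i2 (Filter.Eventually.of_forall fun y => by positivity)
  -- The absolute value keeps g nonnegative for every real s, even where 1 + s is negative.
  have hs : SplitBound f t x Γ (fun s => A * |(1 + s) ^ (-(9 / 8) : ℝ)|)
      fun y => (1 + ‖y‖) ^ (-(13 / 4) : ℝ) := by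
    refine ⟨hΓ, fun s => by positivity, fun y => by positivity, i1.abs.const_mul A, i2.integrableOn,
      fun s hs hst y _ h => hfar s hs hst y h, fun s hs _ y _ _ => (hnear s hs y).trans ?_⟩
    rw [mul_assoc]
    refine mul_le_mul_of_nonneg_left ?_ hA
    have hs' := Real.sqrt_pos.2 hs
    -- The weight is divided as 11/2 = 9/4 + 13/4. Since √(1+s) ≤ 1 + √s + ‖y‖, the first part gives
    -- the power 9/8 > 1 of 1 + s, integrable in time; the second is integrable in space because
    -- 13/4 > 3.
    rw [abs_of_nonneg (by positivity), wt, show -(11 / 2 : ℝ) = -(9 / 4) + -(13 / 4) by norm_num,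
      Real.rpow_add (by positivity)]
    refine mul_le_mul ?_ ?_ (by positivity) (by positivity)
    · have : (1 + s) ^ (-(9 / 8) : ℝ) = (√(1 + s)) ^ (-(9 / 4) : ℝ) := by
        rw [Real.sqrt_eq_rpow, ← Real.rpow_mul (by positivity)]; norm_num
      rw [this]
      refine Real.rpow_le_rpow_of_nonpos (by positivity) ?_ (by norm_num)
      refine Real.sqrt_le_iff.2 ⟨by positivity, ?_⟩
      have := Real.sq_sqrt hs.le
      have hy := norm_nonneg y
      nlinarith [mul_nonneg hs'.le hy]
    · exact Real.rpow_le_rpow_of_nonpos (by positivity) (by linarith) (by norm_num)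
  refine (duh_le hk ht hs).trans ?_
  have e1 : ∫ s in (0 : ℝ)..t, A * |(1 + s) ^ (-(9 / 8) : ℝ)| ≤ A * 8 := by
    rw [intervalIntegral.integral_const_mul]
    refine mul_le_mul_of_nonneg_left ?_ hA
    refine le_trans (le_of_eq ?_) j1
    rw [intervalIntegral.integral_of_le ht.le, intervalIntegral.integral_of_le ht.le]
    refine setIntegral_congr_fun measurableSet_Ioc fun s hs => ?_
    have : 0 < s := hs.1
    exact abs_of_nonneg (by positivity)
  have e2 : 0 ≤ ∫ y in Metric.ball (0 : E3) (√t + ‖x‖), (1 + ‖y‖) ^ (-(13 / 4) : ℝ) :=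
    integral_nonneg fun y => by positivity
  set X := √t ^ (N - 4) * (√t + ‖x‖) ^ (-N)
  have hX : 0 ≤ X := by positivity
  calc _ ≤ C * duhConst N * t ^ e * (Γ * √t + X * (A * 8) * tailConst (13 / 4)) := by gcongr
    _ = C * duhConst N * t ^ e * (Γ * √t * 1 + A * X * (8 * tailConst (13 / 4))) := by ring
    _ ≤ C * duhConst N * t ^ e * (Γ * √t * (1 + 8 * tailConst (13 / 4)) +
          A * X * (1 + 8 * tailConst (13 / 4))) := by
        gcongr <;> linarith
    _ = _ := by ring

/-- Qualitative membership in the class where the bilinear operators are given by absolutely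
convergent integrals. -/
def Integrating {V W : Type} [NormedAddCommGroup V] [NormedAddCommGroup W] (w : ℝ → E3 → V)
    (v : ℝ → E3 → W) : Prop :=
  ∃ κ m A, Admissible κ m A ∧ ProdBound κ m A w v

lemma opG_rpow_le (e : ℕ) (α β : ℝ) (hα : α < 2) (hβ : β < 3) : ∃ C', 0 ≤ C' ∧
    ∀ {w v : ℝ → E3 → E3} {t Γ A : ℝ} {x : E3}, Meas w → Meas v → Integrating w v → 0 < t →
    0 ≤ Γ → 0 ≤ A →
    (∀ s, 0 < s → s < t → ∀ y, (√t + ‖x‖) / 4 ≤ √s + ‖y‖ → ‖w s y‖ * ‖v s y‖ ≤ Γ) →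
    (∀ s, 0 < s → ∀ y, y ≠ 0 → ‖w s y‖ * ‖v s y‖ ≤ A * (√s ^ (-α) * ‖y‖ ^ (-β))) →
    ‖opG e w v t x‖ ≤ C' * t ^ e * (Γ * √t + A * (√t ^ (2 - α) * (√t + ‖x‖) ^ (-1 - β))) := by
  obtain ⟨C', hC', h⟩ := duh_rpow_le 4 α β hα hβ
  have ho := oseenConst_pos
  refine ⟨27 * (oseenConst * C'), by positivity, ?_⟩
  intro w v t Γ A x hw hv ⟨κ, m, B, ha, hp⟩ ht hΓ hA hfar hnear
  refine (norm_opG_le hw hv ha hp ht x fun j i k => h (kernelBound_opKernel e j i k) ht hΓ hA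
    (fun s hs hst y hy => (abs_coord_mul_le _ _ _ _).trans (hfar s hs hst y hy))
    (fun s hs y hy => (abs_coord_mul_le _ _ _ _).trans (hnear s hs y hy))).trans (le_of_eq ?_)
  rw [show (4 : ℝ) - 2 - α = 2 - α by ring, show (3 : ℝ) - 4 - β = -1 - β by ring]; ring

lemma opG_int_le (e : ℕ) : ∃ C', 0 ≤ C' ∧
    ∀ {w v : ℝ → E3 → E3} {t Γ A : ℝ} {x : E3}, Meas w → Meas v → Integrating w v → 0 < t →
    0 ≤ Γ → 0 ≤ A →
    (∀ s, 0 < s → s < t → ∀ y, (√t + ‖x‖) / 4 ≤ √s + ‖y‖ → ‖w s y‖ * ‖v s y‖ ≤ Γ) →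
    (∀ s, 0 < s → ∀ y, ‖w s y‖ * ‖v s y‖ ≤ A * wt 1 (11 / 2) s y) →
    ‖opG e w v t x‖ ≤ C' * t ^ e * (Γ * √t + A * (√t + ‖x‖) ^ (-4 : ℝ)) := by
  obtain ⟨C', hC', h⟩ := duh_int_le 4
  have ho := oseenConst_pos
  refine ⟨27 * (oseenConst * C'), by positivity, ?_⟩
  intro w v t Γ A x hw hv ⟨κ, m, B, ha, hp⟩ ht hΓ hA hfar hnear
  refine (norm_opG_le hw hv ha hp ht x fun j i k => h (kernelBound_opKernel e j i k) ht hΓ hA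
    (fun s hs hst y hy => (abs_coord_mul_le _ _ _ _).trans (hfar s hs hst y hy))
    (fun s hs y => (abs_coord_mul_le _ _ _ _).trans (hnear s hs y))).trans (le_of_eq ?_)
  rw [sub_self, Real.rpow_zero, one_mul]; ring

lemma abs_mul_coord_le (c : ℝ) (v : E3) (h : Fin 3) : |c * v h| ≤ ‖c‖ * ‖v‖ := by
  rw [abs_mul]
  exact mul_le_mul_of_nonneg_left (abs_coord_le v h) (abs_nonneg _)

lemma opBt_rpow_le (N α β : ℝ) (hN : 4 ≤ N) (hα : α < 2) (hβ : β < 3) : ∃ C', 0 ≤ C' ∧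
    ∀ {θ : ℝ → E3 → ℝ} {v : ℝ → E3 → E3} {t Γ A : ℝ} {x : E3}, Meas θ → Meas v → Integrating θ v →
    0 < t → 0 ≤ Γ → 0 ≤ A →
    (∀ s, 0 < s → s < t → ∀ y, (√t + ‖x‖) / 4 ≤ √s + ‖y‖ → ‖θ s y‖ * ‖v s y‖ ≤ Γ) →
    (∀ s, 0 < s → ∀ y, y ≠ 0 → ‖θ s y‖ * ‖v s y‖ ≤ A * (√s ^ (-α) * ‖y‖ ^ (-β))) →
    |opBt θ v t x| ≤ C' * (Γ * √t + A * (√t ^ (N - 2 - α) * (√t + ‖x‖) ^ (3 - N - β))) := by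
  obtain ⟨C', hC', h⟩ := duh_rpow_le N α β hα hβ
  refine ⟨3 * (Real.exp ((N + 1) ^ 2) * C'), by positivity, ?_⟩
  intro θ v t Γ A x hθ hv ⟨κ, m, B, ha, hp⟩ ht hΓ hA hfar hnear
  refine (abs_opBt_le hθ hv ha hp ht x fun i => h (kernelBound_heatKernel₁ i hN) ht hΓ hA
    (fun s hs hst y hy => (abs_mul_coord_le _ _ _).trans (hfar s hs hst y hy))
    (fun s hs y hy => (abs_mul_coord_le _ _ _).trans (hnear s hs y hy))).trans (le_of_eq ?_)
  rw [pow_zero]; ring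

lemma opBt_int_le (N : ℝ) (hN : 4 ≤ N) : ∃ C', 0 ≤ C' ∧
    ∀ {θ : ℝ → E3 → ℝ} {v : ℝ → E3 → E3} {t Γ A : ℝ} {x : E3}, Meas θ → Meas v → Integrating θ v →
    0 < t → 0 ≤ Γ → 0 ≤ A →
    (∀ s, 0 < s → s < t → ∀ y, (√t + ‖x‖) / 4 ≤ √s + ‖y‖ → ‖θ s y‖ * ‖v s y‖ ≤ Γ) →
    (∀ s, 0 < s → ∀ y, ‖θ s y‖ * ‖v s y‖ ≤ A * wt 1 (11 / 2) s y) →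
    |opBt θ v t x| ≤ C' * (Γ * √t + A * (√t ^ (N - 4) * (√t + ‖x‖) ^ (-N))) := by
  obtain ⟨C', hC', h⟩ := duh_int_le N
  refine ⟨3 * (Real.exp ((N + 1) ^ 2) * C'), by positivity, ?_⟩
  intro θ v t Γ A x hθ hv ⟨κ, m, B, ha, hp⟩ ht hΓ hA hfar hnear
  refine (abs_opBt_le hθ hv ha hp ht x fun i => h (kernelBound_heatKernel₁ i hN) ht hΓ hA
    (fun s hs hst y hy => (abs_mul_coord_le _ _ _).trans (hfar s hs hst y hy))
    (fun s hs y => (abs_mul_coord_le _ _ _).trans (hnear s hs y))).trans (le_of_eq ?_)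
  rw [pow_zero]; ring

/-! ### Propagation of spatial decay -/

/-- `|u(t,x)| ≤ A (1 + √t)^μ (1 + √t + |x|)^{-ν}` in the region `√t + |x| ≥ r`. -/
def DecOn {V : Type} [NormedAddCommGroup V] (r μ ν : ℝ) (u : ℝ → E3 → V) : Prop :=
  ∃ A, 0 ≤ A ∧ ∀ t, 0 < t → ∀ x, r ≤ √t + ‖x‖ → ‖u t x‖ ≤ A * ((1 + √t) ^ μ * wt 1 ν t x)

/-- Since 1 + √t ≤ 1 + √t + ‖x‖, spatial decay can be exchanged for decay in time: the rate ν may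
drop as long as the total degree μ - ν does not. -/
lemma sqrt_rpow_mul_le {t μ ν μ' ν' : ℝ} (x : E3) (hν : ν' ≤ ν)
    (hμ : μ - ν ≤ μ' - ν') :
    (1 + √t) ^ μ * wt 1 ν t x ≤ (1 + √t) ^ μ' * wt 1 ν' t x := by
  have hst := Real.sqrt_nonneg t
  have hx := norm_nonneg x
  have hτ : 0 < 1 + √t := by positivity
  have hw : 0 < 1 + (√t + ‖x‖) := by positivity
  have h1 : (1 + (√t + ‖x‖)) ^ (ν' - ν) ≤ (1 + √t) ^ (ν' - ν) :=
    Real.rpow_le_rpow_of_nonpos hτ (by linarith) (by linarith)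
  have h2 : (1 + √t) ^ (μ - μ' + (ν' - ν)) ≤ 1 :=
    Real.rpow_le_one_of_one_le_of_nonpos (by linarith) (by linarith)
  have e1 : (1 + √t) ^ μ = (1 + √t) ^ μ' * (1 + √t) ^ (μ - μ') := by
    rw [← Real.rpow_add hτ]; congr 1; ring
  have e2 : wt 1 ν t x = wt 1 ν' t x * (1 + (√t + ‖x‖)) ^ (ν' - ν) := by
    rw [wt, wt, ← Real.rpow_add hw]; congr 1; ring
  have hwt := wt_nonneg zero_le_one ν' t x
  rw [e1, e2]
  calc _ = (1 + √t) ^ μ' * wt 1 ν' t x *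
        ((1 + √t) ^ (μ - μ') * (1 + (√t + ‖x‖)) ^ (ν' - ν)) := by ring
    _ ≤ (1 + √t) ^ μ' * wt 1 ν' t x * ((1 + √t) ^ (μ - μ') * (1 + √t) ^ (ν' - ν)) := by gcongr
    _ ≤ (1 + √t) ^ μ' * wt 1 ν' t x * 1 := by
        rw [← Real.rpow_add hτ]; gcongr
    _ = _ := mul_one _

section

variable {V W : Type} [NormedAddCommGroup V] [NormedAddCommGroup W] {r μ ν μ' ν' : ℝ}
  {u v : ℝ → E3 → V}

lemma DecOn.weaken (h : DecOn r μ ν u) (hν : ν' ≤ ν) (hμ : μ - ν ≤ μ' - ν') : DecOn r μ' ν' u := by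
  obtain ⟨A, hA, h⟩ := h
  exact ⟨A, hA, fun t ht x hx => (h t ht x hx).trans
    (mul_le_mul_of_nonneg_left (sqrt_rpow_mul_le x hν hμ) hA)⟩

lemma DecOn.restrict (h : DecOn r μ ν u) {r' : ℝ} (hr : r ≤ r') : DecOn r' μ ν u := by
  obtain ⟨A, hA, h⟩ := h
  exact ⟨A, hA, fun t ht x hx => h t ht x (hr.trans hx)⟩

lemma DecOn.add (h : DecOn r μ ν u) (h' : DecOn r μ ν v) :
    DecOn r μ ν fun t x => u t x + v t x := by
  obtain ⟨A, hA, h⟩ := h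
  obtain ⟨B, hB, h'⟩ := h'
  refine ⟨A + B, by positivity, fun t ht x hx => (norm_add_le _ _).trans ?_⟩
  rw [add_mul]
  exact add_le_add (h t ht x hx) (h' t ht x hx)

lemma DecOn.congr (h : DecOn r μ ν u) (e : ∀ t, 0 < t → ∀ x, v t x = u t x) : DecOn r μ ν v := by
  obtain ⟨A, hA, h⟩ := h
  exact ⟨A, hA, fun t ht x hx => by rw [e t ht x]; exact h t ht x hx⟩

lemma DecOn.mul {w : ℝ → E3 → W} (h : DecOn r μ ν u) (h' : DecOn r μ' ν' w) :
    DecOn r (μ + μ') (ν + ν') fun t x => ‖u t x‖ * ‖w t x‖ := by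
  obtain ⟨A, hA, h⟩ := h
  obtain ⟨B, hB, h'⟩ := h'
  refine ⟨A * B, by positivity, fun t ht x hx => ?_⟩
  have hst := Real.sqrt_nonneg t
  have hn := norm_nonneg x
  have hw := wt_nonneg zero_le_one ν t x
  have e : wt 1 (ν + ν') t x = wt 1 ν t x * wt 1 ν' t x := by
    rw [wt, wt, wt, ← Real.rpow_add (by positivity)]; congr 1; ring
  rw [norm_mul, norm_norm, norm_norm, e, Real.rpow_add (by positivity)]
  calc _ ≤ (A * ((1 + √t) ^ μ * wt 1 ν t x)) * (B * ((1 + √t) ^ μ' * wt 1 ν' t x)) :=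
        mul_le_mul (h t ht x hx) (h' t ht x hx) (norm_nonneg _) (by positivity)
    _ = _ := by ring

lemma Bd.decOn {A : ℝ} (hA : 0 ≤ A) (h : Bd 1 ν A u) : DecOn 0 0 ν u :=
  ⟨A, hA, fun t ht x _ => by rw [Real.rpow_zero, one_mul]; exact h t ht x⟩

lemma DecOn.smul_e3 {θ : ℝ → E3 → ℝ} (h : DecOn r μ ν θ) : DecOn r μ ν fun s y => θ s y • e3 := by
  obtain ⟨A, hA, h⟩ := h
  exact ⟨A, hA, fun t ht x hx => by rw [norm_smul_e3]; exact h t ht x hx⟩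

/-- A function on which decay is known for `√t + |x| ≥ 1` decays globally as soon as it is
bounded. -/
lemma DecOn.glue (h : DecOn 1 μ ν u) (h0 : DecOn 0 0 0 u) : DecOn 0 μ ν u := by
  obtain ⟨A, hA, h⟩ := h
  obtain ⟨B, hB, h0⟩ := h0
  refine ⟨A + B * 2 ^ (|μ| + |ν|), by positivity, fun t ht x _ => ?_⟩
  have hst := Real.sqrt_nonneg t
  have hn := norm_nonneg x
  have hw := wt_nonneg zero_le_one ν t x
  have hX : 0 ≤ (1 + √t) ^ μ * wt 1 ν t x := by positivity
  rcases le_total 1 (√t + ‖x‖) with h1 | h1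
  · refine (h t ht x h1).trans (mul_le_mul_of_nonneg_right ?_ hX)
    have : 0 ≤ B * 2 ^ (|μ| + |ν|) := by positivity
    linarith
  · have hb := h0 t ht x (by positivity)
    rw [wt, neg_zero, Real.rpow_zero, Real.rpow_zero, mul_one, mul_one] at hb
    have aux : ∀ z q : ℝ, 1 ≤ z → z ≤ 2 → 1 ≤ 2 ^ |q| * z ^ q := by
      intro z q hz hz2
      have hz0 : 0 < z := by linarith
      calc (1 : ℝ) = z ^ |q| * z ^ (-|q|) := by rw [← Real.rpow_add hz0]; simp
        _ ≤ 2 ^ |q| * z ^ q := mul_le_mul (Real.rpow_le_rpow hz0.le hz2 (abs_nonneg _))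
            (Real.rpow_le_rpow_of_exponent_le hz (neg_abs_le q)) (by positivity) (by positivity)
    have a1 := aux (1 + √t) μ (by linarith) (by linarith)
    have a2 := aux (1 + (√t + ‖x‖)) (-ν) (by linarith) (by linarith)
    rw [abs_neg] at a2
    have a3 : 1 ≤ 2 ^ (|μ| + |ν|) * ((1 + √t) ^ μ * wt 1 ν t x) := by
      rw [Real.rpow_add two_pos, wt]
      calc (1 : ℝ) ≤ (2 ^ |μ| * (1 + √t) ^ μ) * (2 ^ |ν| * (1 + (√t + ‖x‖)) ^ (-ν)) :=
            one_le_mul_of_one_le_of_one_le a1 a2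
        _ = _ := by ring
    calc ‖u t x‖ ≤ B := hb
      _ ≤ B * (2 ^ (|μ| + |ν|) * ((1 + √t) ^ μ * wt 1 ν t x)) := le_mul_of_one_le_right hB a3
      _ ≤ _ := by
        rw [add_mul, mul_assoc B]
        have : 0 ≤ A * ((1 + √t) ^ μ * wt 1 ν t x) := by positivity
        linarith

/-- Two powers of the weight suffice for an admissible product bound with κ = m = 1. Only
convergence of the integrals is drawn from this. -/
lemma DecOn.integrating {m : ℝ} {w : ℝ → E3 → W} (hm : 2 ≤ m)
    (h : DecOn 0 0 m fun t x => ‖u t x‖ * ‖w t x‖) : Integrating u w := by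
  obtain ⟨A, hA, h⟩ := h
  refine ⟨1, 1, A, ⟨zero_le_one, zero_le_one, by norm_num, hA⟩, fun s hs y => ?_⟩
  have hst := Real.sqrt_pos.2 hs
  have hn := norm_nonneg y
  have h1 := (Real.le_norm_self _).trans (h s hs y (by positivity))
  rw [Real.rpow_zero, one_mul] at h1
  refine h1.trans (mul_le_mul_of_nonneg_left ?_ hA)
  unfold wt
  calc (1 + (√s + ‖y‖)) ^ (-m) ≤ (1 + (√s + ‖y‖)) ^ (-1 + -1 : ℝ) :=
        Real.rpow_le_rpow_of_exponent_le (by linarith) (by linarith)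
    _ = (1 + (√s + ‖y‖)) ^ (-1 : ℝ) * (1 + (√s + ‖y‖)) ^ (-1 : ℝ) := Real.rpow_add (by positivity) _ _
    _ ≤ _ := by
        gcongr ?_ * _
        exact Real.rpow_le_rpow_of_nonpos (by positivity) (by linarith) (by norm_num)

end

section

variable {f : ℝ → E3 → ℝ}

/-- In the far region the decay at (s, y) is transferred to (t, x) up to 4^ν; μ ≥ 0 lets the time
factor be evaluated at t instead of s. -/
lemma DecOn.far {μ ν : ℝ} (hμ : 0 ≤ μ) (hν : 0 ≤ ν) (h : DecOn 0 μ ν f) :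
    ∃ A, 0 ≤ A ∧ ∀ t, 0 < t → ∀ x : E3, ∀ s, 0 < s → s < t → ∀ y, (√t + ‖x‖) / 4 ≤ √s + ‖y‖ →
      f s y ≤ A * ((1 + √t) ^ μ * (√t + ‖x‖) ^ (-ν)) := by
  obtain ⟨A, hA, h⟩ := h
  refine ⟨A * 4 ^ ν, by positivity, fun t ht x s hs hst y hy => ?_⟩
  have h0 := Real.sqrt_pos.2 ht
  have h1 := Real.sqrt_pos.2 hs
  have hx := norm_nonneg x
  have hy0 := norm_nonneg y
  have e : 4 ^ ν * (√t + ‖x‖) ^ (-ν) = ((√t + ‖x‖) / 4) ^ (-ν) := by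
    rw [Real.div_rpow (by positivity) (by norm_num), Real.rpow_neg (by norm_num : (0 : ℝ) ≤ 4),
      div_inv_eq_mul, mul_comm]
  calc f s y ≤ A * ((1 + √s) ^ μ * wt 1 ν s y) := (Real.le_norm_self _).trans (h s hs y (by positivity))
    _ ≤ A * ((1 + √t) ^ μ * ((√t + ‖x‖) / 4) ^ (-ν)) := by
        refine mul_le_mul_of_nonneg_left (mul_le_mul ?_ ?_ (wt_nonneg zero_le_one _ _ _)
          (by positivity)) hA
        · exact Real.rpow_le_rpow (by positivity) (by linarith [Real.sqrt_le_sqrt hst.le]) hμ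
        · exact Real.rpow_le_rpow_of_nonpos (by positivity) (by linarith) (by linarith)
    _ = _ := by rw [← e]; ring

lemma DecOn.near {m α β : ℝ} (hα : 0 ≤ α) (hβ : 0 ≤ β) (hm : α + β ≤ m) (h : DecOn 0 0 m f) :
    ∃ A, 0 ≤ A ∧ ∀ s, 0 < s → ∀ y, y ≠ 0 → f s y ≤ A * (√s ^ (-α) * ‖y‖ ^ (-β)) := by
  obtain ⟨A, hA, h⟩ := h
  refine ⟨A, hA, fun s hs y hy => ?_⟩
  have h1 := Real.sqrt_pos.2 hs
  have hy0 := norm_pos_iff.2 hy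
  refine ((Real.le_norm_self _).trans (h s hs y (by positivity))).trans ?_
  rw [Real.rpow_zero, one_mul]
  refine mul_le_mul_of_nonneg_left ?_ hA
  unfold wt
  calc (1 + (√s + ‖y‖)) ^ (-m) ≤ (1 + (√s + ‖y‖)) ^ (-α + -β : ℝ) :=
        Real.rpow_le_rpow_of_exponent_le (by linarith) (by linarith)
    _ = (1 + (√s + ‖y‖)) ^ (-α) * (1 + (√s + ‖y‖)) ^ (-β) := Real.rpow_add (by positivity) _ _
    _ ≤ _ := mul_le_mul (Real.rpow_le_rpow_of_nonpos h1 (by linarith) (by linarith))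
        (Real.rpow_le_rpow_of_nonpos hy0 (by linarith) (by linarith)) (by positivity) (by positivity)

lemma DecOn.near_int {m : ℝ} (hm : 11 / 2 ≤ m) (h : DecOn 0 0 m f) :
    ∃ A, 0 ≤ A ∧ ∀ s, 0 < s → ∀ y, f s y ≤ A * wt 1 (11 / 2) s y := by
  obtain ⟨A, hA, h⟩ := h.weaken (μ' := 0) (ν' := 11 / 2) hm (by linarith)
  refine ⟨A, hA, fun s hs y => ?_⟩
  have := (Real.le_norm_self _).trans (h s hs y (by positivity))
  rwa [Real.rpow_zero, one_mul] at this

/-- For `√t + |x| ≥ 1` the weight `(√t + |x|)^{-β}` may be replaced by `(1 + √t + |x|)^{-ν'}`. -/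
lemma sqrt_rpow_mul_rpow_le {α β μ' ν' t : ℝ} {x : E3} (hβ : 0 ≤ β)
    (hν : ν' ≤ β) (hμ : α - β ≤ μ' - ν') (hx : 1 ≤ √t + ‖x‖) :
    (1 + √t) ^ α * (√t + ‖x‖) ^ (-β) ≤ 2 ^ β * ((1 + √t) ^ μ' * wt 1 ν' t x) := by
  have h0 := Real.sqrt_nonneg t
  have e : (√t + ‖x‖) ^ (-β) ≤ 2 ^ β * wt 1 β t x := by
    have : (2 : ℝ) ^ β * wt 1 β t x = ((1 + (√t + ‖x‖)) / 2) ^ (-β) := by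
      rw [wt, Real.div_rpow (by linarith) (by norm_num), Real.rpow_neg (by norm_num : (0 : ℝ) ≤ 2),
        div_inv_eq_mul, mul_comm]
    rw [this]
    exact Real.rpow_le_rpow_of_nonpos (by linarith) (by linarith) (by linarith)
  calc _ ≤ (1 + √t) ^ α * (2 ^ β * wt 1 β t x) := by gcongr
    _ = 2 ^ β * ((1 + √t) ^ α * wt 1 β t x) := by ring
    _ ≤ _ := mul_le_mul_of_nonneg_left (sqrt_rpow_mul_le x hν hμ) (by positivity)

end

/-- Assembles decay from an estimate by a far and a near contribution. -/
lemma DecOn.of_le {V : Type} [NormedAddCommGroup V] {g : ℝ → E3 → V} {C A B α₁ β₁ α₂ β₂ μ' ν' : ℝ}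
    (hC : 0 ≤ C) (hA : 0 ≤ A) (hB : 0 ≤ B)
    (hβ₁ : 0 ≤ β₁) (hβ₂ : 0 ≤ β₂) (h1 : ν' ≤ β₁) (h2 : α₁ - β₁ ≤ μ' - ν')
    (h3 : ν' ≤ β₂) (h4 : α₂ - β₂ ≤ μ' - ν')
    (h : ∀ t, 0 < t → ∀ x, ‖g t x‖ ≤ C * (A * ((1 + √t) ^ α₁ * (√t + ‖x‖) ^ (-β₁)) +
      B * ((1 + √t) ^ α₂ * (√t + ‖x‖) ^ (-β₂)))) : DecOn 1 μ' ν' g := by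
  refine ⟨C * (A * 2 ^ β₁ + B * 2 ^ β₂), by positivity, fun t ht x hx => (h t ht x).trans ?_⟩
  have b1 := sqrt_rpow_mul_rpow_le (μ' := μ') hβ₁ h1 h2 hx
  have b2 := sqrt_rpow_mul_rpow_le (μ' := μ') hβ₂ h3 h4 hx
  calc _ ≤ C * (A * (2 ^ β₁ * ((1 + √t) ^ μ' * wt 1 ν' t x)) +
        B * (2 ^ β₂ * ((1 + √t) ^ μ' * wt 1 ν' t x))) := by gcongr
    _ = _ := by ring

lemma pow_mul_sqrt_rpow_le {t q : ℝ} (e : ℕ) (ht : 0 < t) (hq : 0 ≤ q) :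
    t ^ e * √t ^ q ≤ (1 + √t) ^ (2 * e + q) := by
  have h0 := Real.sqrt_pos.2 ht
  have : t ^ e = √t ^ (2 * e : ℝ) := by
    nth_rw 1 [← Real.sq_sqrt ht.le]
    rw [← pow_mul, ← Real.rpow_natCast]; push_cast; rfl
  rw [this, ← Real.rpow_add h0]
  exact Real.rpow_le_rpow h0.le (by linarith) (by positivity)

section

variable {w v : ℝ → E3 → E3} {θ : ℝ → E3 → ℝ} {μ ν m μ' ν' : ℝ}

/-- The conditions `h1` and `h2` compare spatial rate and total degree for the far part, `h3` and
`h4` for the near part. The near rate 1 + β < 4 reflects the decay of the Oseen kernel. -/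
lemma decOn_opG {e : ℕ} (α β : ℝ) (hw : Meas w) (hv : Meas v)
    (hf : DecOn 0 μ ν fun t x => ‖w t x‖ * ‖v t x‖) (hn : DecOn 0 0 m fun t x => ‖w t x‖ * ‖v t x‖)
    (hm : 2 ≤ m) (hμ0 : 0 ≤ μ) (hν0 : 0 ≤ ν) (hα : 0 ≤ α) (hα2 : α < 2) (hβ : 0 ≤ β) (hβ3 : β < 3)
    (hαβ : α + β ≤ m) (h1 : ν' ≤ ν) (h2 : 2 * e + μ + 1 - ν ≤ μ' - ν') (h3 : ν' ≤ 1 + β)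
    (h4 : 2 * e + 1 - α - β ≤ μ' - ν') : DecOn 1 μ' ν' (opG e w v) := by
  obtain ⟨C, hC, h⟩ := opG_rpow_le e α β hα2 hβ3
  obtain ⟨A, hA, hA'⟩ := hf.far hμ0 hν0
  obtain ⟨B, hB, hB'⟩ := hn.near hα hβ hαβ
  refine DecOn.of_le (α₁ := 2 * e + 1 + μ) (β₁ := ν) (α₂ := 2 * e + (2 - α)) (β₂ := 1 + β)
    hC hA hB hν0 (by positivity)
    h1 (by linarith) h3 (by linarith) fun t ht x => ?_
  have h0 := Real.sqrt_pos.2 ht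
  have hx := norm_nonneg x
  refine (h hw hv (hn.integrating hm) ht (by positivity) hB (hA' t ht x) hB').trans ?_
  have b1 := pow_mul_sqrt_rpow_le (q := 1) e ht zero_le_one
  rw [Real.rpow_one] at b1
  have b2 := pow_mul_sqrt_rpow_le (q := 2 - α) e ht (by linarith)
  rw [Real.rpow_add (by positivity) (2 * e + 1 : ℝ) μ, show -1 - β = -(1 + β) by ring]
  calc _ = C * (A * ((t ^ e * √t) * (1 + √t) ^ μ * (√t + ‖x‖) ^ (-ν)) +
        B * ((t ^ e * √t ^ (2 - α)) * (√t + ‖x‖) ^ (-(1 + β)))) := by ring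
    _ ≤ _ := by gcongr

lemma decOn_opG_int {e : ℕ} (hw : Meas w) (hv : Meas v)
    (hn : DecOn 0 0 m fun t x => ‖w t x‖ * ‖v t x‖)
    (hm : 11 / 2 ≤ m) (h1 : ν' ≤ 4) (h2 : 2 * e - 4 ≤ μ' - ν') : DecOn 1 μ' ν' (opG e w v) := by
  obtain ⟨C, hC, h⟩ := opG_int_le e
  obtain ⟨A, hA, hA'⟩ := hn.far le_rfl (by linarith)
  obtain ⟨B, hB, hB'⟩ := hn.near_int hm
  refine DecOn.of_le (α₁ := 2 * e + 1) (β₁ := m) (α₂ := 2 * e) (β₂ := 4)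
    hC hA hB (by linarith) (by positivity)
    (by linarith) (by linarith) h1 (by linarith) fun t ht x => ?_
  have h0 := Real.sqrt_pos.2 ht
  have hx := norm_nonneg x
  refine (h hw hv (hn.integrating (by linarith)) ht (by positivity) hB (hA' t ht x) hB').trans ?_
  have b1 := pow_mul_sqrt_rpow_le (q := 1) e ht zero_le_one
  have b2 := pow_mul_sqrt_rpow_le (q := 0) e ht le_rfl
  rw [Real.rpow_one] at b1
  rw [Real.rpow_zero, mul_one, add_zero] at b2
  calc _ = C * (A * ((t ^ e * √t) * (√t + ‖x‖) ^ (-m)) +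
        B * (t ^ e * (√t + ‖x‖) ^ (-4 : ℝ))) := by rw [Real.rpow_zero]; ring
    _ ≤ _ := by gcongr

/-- In contrast to `decOn_opG`, the order N is free, so that with N large the near part does not
limit the spatial rate. -/
lemma decOn_opBt (N α β : ℝ) (hθ : Meas θ) (hv : Meas v)
    (hf : DecOn 0 μ ν fun t x => ‖θ t x‖ * ‖v t x‖) (hn : DecOn 0 0 m fun t x => ‖θ t x‖ * ‖v t x‖)
    (hm : 2 ≤ m) (hμ0 : 0 ≤ μ) (hν0 : 0 ≤ ν) (hN : 4 ≤ N) (hα : 0 ≤ α) (hα2 : α < 2) (hβ : 0 ≤ β)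
    (hβ3 : β < 3) (hαβ : α + β ≤ m) (h1 : ν' ≤ ν) (h2 : μ + 1 - ν ≤ μ' - ν') (h3 : ν' ≤ N + β - 3)
    (h4 : 1 - α - β ≤ μ' - ν') : DecOn 1 μ' ν' (opBt θ v) := by
  obtain ⟨C, hC, h⟩ := opBt_rpow_le N α β hN hα2 hβ3
  obtain ⟨A, hA, hA'⟩ := hf.far hμ0 hν0
  obtain ⟨B, hB, hB'⟩ := hn.near hα hβ hαβ
  refine DecOn.of_le (α₁ := 1 + μ) (β₁ := ν) (α₂ := N - 2 - α) (β₂ := N + β - 3)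
    hC hA hB hν0 (by linarith)
    h1 (by linarith) h3 (by linarith) fun t ht x => ?_
  have h0 := Real.sqrt_pos.2 ht
  have hx := norm_nonneg x
  refine (h hθ hv (hn.integrating hm) ht (by positivity) hB (hA' t ht x) hB').trans ?_
  have b2 : √t ^ (N - 2 - α) ≤ (1 + √t) ^ (N - 2 - α) :=
    Real.rpow_le_rpow h0.le (by linarith) (by linarith)
  rw [Real.rpow_add (by positivity) 1 μ, Real.rpow_one, show 3 - N - β = -(N + β - 3) by ring]
  calc _ = C * (A * (√t * (1 + √t) ^ μ * (√t + ‖x‖) ^ (-ν)) +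
        B * (√t ^ (N - 2 - α) * (√t + ‖x‖) ^ (-(N + β - 3)))) := by ring
    _ ≤ _ := by gcongr; linarith

lemma decOn_opBt_int (hθ : Meas θ) (hv : Meas v)
    (hf : DecOn 0 μ ν fun t x => ‖θ t x‖ * ‖v t x‖) (hn : DecOn 0 0 m fun t x => ‖θ t x‖ * ‖v t x‖)
    (hm : 11 / 2 ≤ m) (hμ0 : 0 ≤ μ) (hν0 : 0 ≤ ν) (hν' : 4 ≤ ν') (h1 : ν' ≤ ν)
    (h2 : μ + 1 - ν ≤ μ' - ν') (h3 : -4 ≤ μ' - ν') : DecOn 1 μ' ν' (opBt θ v) := by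
  obtain ⟨C, hC, h⟩ := opBt_int_le ν' hν'
  obtain ⟨A, hA, hA'⟩ := hf.far hμ0 hν0
  obtain ⟨B, hB, hB'⟩ := hn.near_int hm
  refine DecOn.of_le (α₁ := 1 + μ) (β₁ := ν) (α₂ := ν' - 4) (β₂ := ν')
    hC hA hB hν0 (by linarith)
    h1 (by linarith) le_rfl (by linarith) fun t ht x => ?_
  have h0 := Real.sqrt_pos.2 ht
  have hx := norm_nonneg x
  refine (h hθ hv (hn.integrating (by linarith)) ht (by positivity) hB (hA' t ht x) hB').trans ?_
  have b2 : √t ^ (ν' - 4) ≤ (1 + √t) ^ (ν' - 4) :=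
    Real.rpow_le_rpow h0.le (by linarith) (by linarith)
  rw [Real.rpow_add (by positivity) 1 μ, Real.rpow_one]
  calc _ = C * (A * (√t * (1 + √t) ^ μ * (√t + ‖x‖) ^ (-ν)) +
        B * (√t ^ (ν' - 4) * (√t + ‖x‖) ^ (-ν'))) := by ring
    _ ≤ _ := by gcongr; linarith

end

/-! ### Bootstrap of the decay of small solutions -/

section

variable {L u : ℝ → E3 → E3} {Λ θ : ℝ → E3 → ℝ} {a b : ℝ}

lemma DecOn.stepU {μ ν : ℝ} (hu : ∀ t, 0 < t → ∀ x, u t x = stepU L u θ t x)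
    (hL : DecOn 0 μ ν L) (h1 : DecOn 1 μ ν (opB u u)) (h2 : DecOn 1 μ ν (opE u θ))
    (h0 : DecOn 0 0 0 u) : DecOn 0 μ ν u :=
  ((((hL.restrict zero_le_one).add h1).add h2).congr hu).glue h0

lemma DecOn.stepΘ {μ ν : ℝ} (hθ : ∀ t, 0 < t → ∀ x, θ t x = stepΘ Λ u θ t x)
    (hΛ : DecOn 0 μ ν Λ) (h1 : DecOn 1 μ ν (opBt θ u)) (h0 : DecOn 0 0 0 θ) : DecOn 0 μ ν θ :=
  (((hΛ.restrict zero_le_one).add h1).congr hθ).glue h0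

/-- Spatial decay of small solutions without cancellation in the initial temperature. -/
theorem decOn_of_fixed (mu : Meas u) (mθ : Meas θ)
    (hu : ∀ t, 0 < t → ∀ x, u t x = Boussinesq.stepU L u θ t x)
    (hθ : ∀ t, 0 < t → ∀ x, θ t x = Boussinesq.stepΘ Λ u θ t x)
    (bu : DecOn 0 0 1 u) (bθ : DecOn 0 0 3 θ)
    (hΛ : DecOn 0 (b - 3) b Λ) (hb : 3 ≤ b) :
    (1 ≤ a → a < 3 → DecOn 0 (a - 1) a L → DecOn 0 (a - 1) a u) ∧ DecOn 0 (b - 3) b θ := by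
  have u0 : DecOn 0 0 0 u := bu.weaken (by norm_num) (by norm_num)
  have θ0 : DecOn 0 0 0 θ := bθ.weaken (by norm_num) (by norm_num)
  constructor
  · intro ha1 ha3 hL
    -- One pass gains one power: in the far region u ⊗ u has the rate k of one factor plus 1 from
    -- the other. Near the origin its weight 2 is put entirely on y (α = 0, β = 2), which allows
    -- rates up to 3; two passes, through min a 2, reach a.
    have step : ∀ k l : ℝ, 1 ≤ k → 1 ≤ l → l ≤ k + 1 → l ≤ a → DecOn 0 (k - 1) k u →
        DecOn 0 (l - 1) l u := by
      intro k l hk hl hlk hla h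
      refine DecOn.stepU hu (hL.weaken hla (by linarith)) ?_ ?_ u0
      · rw [opB_eq]
        exact decOn_opG 0 2 mu mu (h.mul bu) (bu.mul bu |>.weaken (ν' := 2) (by norm_num) (by norm_num))
          le_rfl (by linarith) (by linarith) le_rfl (by norm_num) (by norm_num) (by norm_num)
          (by norm_num) (by linarith) (by push_cast; linarith) (by linarith) (by push_cast; linarith)
      · rw [opE_eq]
        -- The weight 4 = 3 + 1 of θu is divided into 3/2 < 2 for time and 5/2 < 3 for space.
        exact decOn_opG (3 / 2) (5 / 2) mθ.smul_e3 mu (bθ.smul_e3.mul bu)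
          (bθ.smul_e3.mul bu |>.weaken (ν' := 4) (by norm_num) (by norm_num))
          (by norm_num) (by linarith) (by linarith) (by norm_num) (by norm_num) (by norm_num)
          (by norm_num) (by norm_num) (by linarith) (by push_cast; linarith) (by linarith)
          (by push_cast; linarith)
    have h1 := step 1 (min a 2) le_rfl (le_min ha1 (by norm_num))
      ((min_le_right _ _).trans (by norm_num)) (min_le_left _ _) (by rwa [sub_self])
    refine step (min a 2) a (le_min ha1 (by norm_num)) ha1 ?_ le_rfl h1
    rcases min_cases a 2 with h | h <;> linarith [h.1]
  -- The target b is arbitrary, so the heat kernel is used at order l + 1 and unit gains are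
  -- repeated until b is reached.
  · have step : ∀ k l : ℝ, 3 ≤ k → 3 ≤ l → l ≤ k + 1 → l ≤ b → DecOn 0 (k - 3) k θ →
        DecOn 0 (l - 3) l θ := by
      intro k l hk hl hlk hlb h
      refine DecOn.stepΘ hθ (hΛ.weaken hlb (by linarith)) ?_ θ0
      exact decOn_opBt (l + 1) (3 / 2) (5 / 2) mθ mu (h.mul bu)
        (bθ.mul bu |>.weaken (ν' := 4) (by norm_num) (by norm_num))
        (by norm_num) (by linarith) (by linarith) (by linarith) (by norm_num) (by norm_num)
        (by norm_num) (by norm_num) (by norm_num) (by linarith) (by linarith) (by linarith)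
        (by linarith)
    have key : ∀ n : ℕ, DecOn 0 (min b (3 + n) - 3) (min b (3 + n)) θ := by
      intro n
      induction n with
      | zero => simpa [min_eq_right hb] using bθ
      | succ n ih =>
        have hn : (0 : ℝ) ≤ n := n.cast_nonneg
        refine step _ _ (le_min hb (by linarith)) (le_min hb (by push_cast; linarith)) ?_
          (min_le_left _ _) ih
        rw [← min_add_add_right]
        exact min_le_min (by linarith) (by push_cast; linarith)
    obtain ⟨n, hn⟩ := exists_nat_ge b
    have := key n
    rwa [min_eq_left (by linarith)] at this

/-- Spatial decay of small solutions with mean zero initial temperature. -/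
theorem decOn_of_fixed_of_mean_zero (mu : Meas u) (mθ : Meas θ)
    (hu : ∀ t, 0 < t → ∀ x, u t x = Boussinesq.stepU L u θ t x)
    (hθ : ∀ t, 0 < t → ∀ x, θ t x = Boussinesq.stepΘ Λ u θ t x)
    (bu : DecOn 0 0 (7 / 4) u) (bθ : DecOn 0 0 (15 / 4) θ)
    (ha : 2 ≤ a) (ha4 : a < 4) (hb : 4 ≤ b)
    (hL : DecOn 0 (a - 2) a L) (hΛ : DecOn 0 (b - 4) b Λ) :
    DecOn 0 (a - 2) a u ∧ DecOn 0 (b - 4) b θ := by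
  have u0 : DecOn 0 0 0 u := bu.weaken (by norm_num) (by norm_num)
  have θ0 : DecOn 0 0 0 θ := bθ.weaken (by norm_num) (by norm_num)
  -- Here 7/4 + 15/4 = 11/2 exceeds the parabolic dimension 5, so θu is integrable over space-time
  -- and both terms containing it inherit the decay of their kernels.
  have bE : DecOn 0 0 (11 / 2) fun t x => ‖θ t x • e3‖ * ‖u t x‖ :=
    (bθ.smul_e3.mul bu).weaken (by norm_num) (by norm_num)
  have bB : DecOn 0 0 (11 / 2) fun t x => ‖θ t x‖ * ‖u t x‖ :=
    (bθ.mul bu).weaken (by norm_num) (by norm_num)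
  have hE : ∀ l : ℝ, l ≤ 4 → DecOn 1 (l - 2) l (opE u θ) := by
    intro l hl
    rw [opE_eq]
    exact decOn_opG_int mθ.smul_e3 mu bE le_rfl hl (by push_cast; linarith)
  have u2 : DecOn 0 0 2 u := by
    refine DecOn.stepU hu (hL.weaken ha (by linarith)) ?_ (by simpa using hE 2 (by norm_num)) u0
    rw [opB_eq]
    have p := (bu.mul bu).weaken (μ' := 0) (ν' := 7 / 2) (by norm_num) (by norm_num)
    exact decOn_opG 1 2 mu mu p p (by norm_num) le_rfl (by norm_num) (by norm_num) (by norm_num)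
      (by norm_num) (by norm_num) (by norm_num) (by norm_num) (by norm_num) (by norm_num)
      (by norm_num)
  have θ4 : DecOn 0 0 4 θ := by
    refine DecOn.stepΘ hθ (hΛ.weaken hb (by linarith)) ?_ θ0
    exact decOn_opBt_int mθ mu bB bB le_rfl le_rfl (by norm_num) le_rfl (by norm_num) (by norm_num)
      (by norm_num)
  constructor
  · refine DecOn.stepU hu hL ?_ (hE a ha4.le) u0
    rw [opB_eq]
    have p := (u2.mul u2).weaken (μ' := 0) (ν' := 4) (by norm_num) (by norm_num)
    have m1 : a ≤ max a 3 := le_max_left _ _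
    have m2 : 3 ≤ max a 3 := le_max_right _ _
    have m3 : max a 3 < 4 := max_lt ha4 (by norm_num)
    -- The near part has spatial rate 1 + β and total degree -β. With β = max a 3 - 1 the rate is at
    -- least a, the degree at most -2, and β < 3 because a < 4.
    exact decOn_opG 1 (max a 3 - 1) mu mu p p (by norm_num) le_rfl (by norm_num) (by norm_num)
      (by norm_num) (by linarith) (by linarith) (by linarith) ha4.le (by push_cast; linarith)
      (by linarith) (by push_cast; linarith)
  · have step : ∀ k l : ℝ, 4 ≤ k → 4 ≤ l → l ≤ k + 1 → l ≤ b → DecOn 0 (k - 4) k θ →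
        DecOn 0 (l - 4) l θ := by
      intro k l hk hl hlk hlb h
      refine DecOn.stepΘ hθ (hΛ.weaken hlb (by linarith)) ?_ θ0
      exact decOn_opBt_int mθ mu (h.mul u2) bB le_rfl (by linarith) (by linarith) hl (by linarith)
        (by linarith) (by linarith)
    have key : ∀ n : ℕ, DecOn 0 (min b (4 + n) - 4) (min b (4 + n)) θ := by
      intro n
      induction n with
      | zero => simpa [min_eq_right hb] using θ4
      | succ n ih =>
        have hn : (0 : ℝ) ≤ n := n.cast_nonneg
        refine step _ _ (le_min hb (by linarith)) (le_min hb (by push_cast; linarith)) ?_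
          (min_le_left _ _) ih
        rw [← min_add_add_right]
        exact min_le_min (by linarith) (by push_cast; linarith)
    obtain ⟨n, hn⟩ := exists_nat_ge b
    have := key n
    rwa [min_eq_left (by linarith)] at this

end

/-! ### The linear evolution of the data -/

lemma one_add_norm_rpow_le {a c : ℝ} {y : E3} (hy : y ≠ 0) (hc : 0 ≤ c) (hca : c ≤ a) :
    (1 + ‖y‖) ^ (-a) ≤ ‖y‖ ^ (-c) := by
  have hn := norm_pos_iff.2 hy
  exact (Real.rpow_le_rpow_of_exponent_le (by linarith) (by linarith)).trans
    (Real.rpow_le_rpow_of_nonpos hn (by linarith) (by linarith))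

lemma one_add_norm_rpow_le_one {a : ℝ} (y : E3) (ha : 0 ≤ a) : (1 + ‖y‖) ^ (-a) ≤ 1 :=
  Real.rpow_le_one_of_one_le_of_nonpos (by linarith [norm_nonneg y]) (by linarith)

lemma MomentBound.mono {θ : E3 → ℝ} {j A B : ℝ} (h : MomentBound θ j A) (hAB : A ≤ B) :
    MomentBound θ j B where
  meas := h.meas
  j_nonneg := h.j_nonneg
  j_le := h.j_le
  A_nonneg := h.A_nonneg.trans hAB
  bdd y := (h.bdd y).trans hAB
  decay y hy := (h.decay y hy).trans (by gcongr)
  moment R hR := (h.moment R hR).trans (by gcongr)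
  mean R hR := (h.mean R hR).trans (by gcongr)

lemma one_add_sqrt_rpow_le (t : ℝ) {q : ℝ} (hq : 0 ≤ q) : 1 + √t ^ q ≤ 2 * (1 + √t) ^ q := by
  have h0 := Real.sqrt_nonneg t
  have h1 := Real.one_le_rpow (x := 1 + √t) (by linarith) hq
  have h2 : √t ^ q ≤ (1 + √t) ^ q := Real.rpow_le_rpow h0 (by linarith) hq
  linarith

/-- The homogeneous bound degenerates at the space-time origin; the uniform bound takes over for √t
+ ‖x‖ ≤ 1. -/
lemma DecOn.of_linear_le {V : Type} [NormedAddCommGroup V] {g : ℝ → E3 → V} {A B q a : ℝ}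
    (hA : 0 ≤ A) (hB : 0 ≤ B) (ha : 0 ≤ a)
    (h : ∀ t, 0 < t → ∀ x, ‖g t x‖ ≤ A * ((1 + √t) ^ q * (√t + ‖x‖) ^ (-a)))
    (h0 : ∀ t, 0 < t → ∀ x, ‖g t x‖ ≤ B) : DecOn 0 q a g := by
  refine DecOn.glue ?_ ⟨B, hB, fun t ht x _ => ?_⟩
  · refine DecOn.of_le (A := 1) (B := 0) hA zero_le_one le_rfl ha ha le_rfl le_rfl le_rfl le_rfl
      fun t ht x => (h t ht x).trans (le_of_eq ?_)
    ring
  · simpa [wt] using h0 t ht x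

/-- The parameter β fixes the total degree: β = 1 serves the general case and β = 2 the mean zero
case. -/
lemma decOn_heat {V : Type} [NormedAddCommGroup V] [NormedSpace ℝ V] {f : E3 → V} {a β C₀ : ℝ}
    (hβ : 0 ≤ β) (hβ3 : β < 3) (hβa : β ≤ a) (hC : 0 ≤ C₀) (hf : ∀ x, ‖f x‖ ≤ C₀ * (1 + ‖x‖) ^ (-a)) :
    DecOn 0 (a - β) a fun t x => heat t f x := by
  have h1 := heatDecayConst_pos a β
  have h2 := heatDecayConst_pos 0 0
  refine DecOn.of_linear_le (A := heatDecayConst a β * C₀ * 2) (B := heatDecayConst 0 0 * C₀ * 2)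
    (by positivity) (by positivity) (by linarith) (fun t ht x => ?_) fun t ht x => ?_
  · refine (norm_heat_decay_le ht x (by linarith) hβ3 hβa hC
      (fun y hy => (hf y).trans
        (mul_le_mul_of_nonneg_left (one_add_norm_rpow_le hy (by linarith) le_rfl) hC))
      (fun y hy => (hf y).trans (by gcongr; exact one_add_norm_rpow_le hy hβ hβa))).trans ?_
    have := one_add_sqrt_rpow_le t (sub_nonneg.2 hβa)
    calc _ ≤ heatDecayConst a β * C₀ * ((2 * (1 + √t) ^ (a - β)) * (√t + ‖x‖) ^ (-a)) := by gcongr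
      _ = _ := by ring
  · have hb : ∀ y : E3, y ≠ 0 → ‖f y‖ ≤ C₀ * ‖y‖ ^ (-0 : ℝ) := fun y _ => by
      rw [neg_zero, Real.rpow_zero]
      exact (hf y).trans (by gcongr; exact one_add_norm_rpow_le_one y (by linarith))
    refine (norm_heat_decay_le ht x le_rfl (by norm_num) le_rfl hC hb hb).trans (le_of_eq ?_)
    simp only [sub_self, neg_zero, Real.rpow_zero]
    ring

section

variable {θ : E3 → ℝ} {j A C₀ : ℝ}

lemma decOn_heatLeray {a : ℝ} (h : MomentBound θ j A) (hC : 0 ≤ C₀)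
    (hθ : ∀ x, |θ x| ≤ C₀ * (1 + ‖x‖) ^ (-3 : ℝ)) (ha : 1 + j ≤ a) (haj : a < 3 + j) :
    DecOn 0 (a - (1 + j)) a fun t x => t • heatLeray t (fun y => θ y • e3) x := by
  have hj := h.j_nonneg
  have hA := h.A_nonneg
  refine DecOn.of_linear_le (A := 3 * (|oseenMomentConst a j| * A)) (B := 3 * (|oseenBddConst| * C₀))
    (by positivity) (by positivity) (by linarith) (fun t ht x => ?_) fun t ht x => ?_
  · have h0 := Real.sqrt_pos.2 ht
    have hx := norm_nonneg x
    have e : t * √t ^ (a - (3 + j)) = √t ^ (a - (1 + j)) := by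
      nth_rw 1 [← Real.sq_sqrt ht.le]
      rw [← Real.rpow_two, ← Real.rpow_add h0]; congr 1; ring
    have h1 : √t ^ (a - (1 + j)) ≤ (1 + √t) ^ (a - (1 + j)) :=
      Real.rpow_le_rpow h0.le (by linarith) (by linarith)
    rw [norm_smul, Real.norm_of_nonneg ht.le]
    calc _ ≤ t * (3 * (|oseenMomentConst a j| * A * (√t ^ (a - (3 + j)) * (√t + ‖x‖) ^ (-a)))) := by
          gcongr
          refine norm_heatLeray_le x fun i =>
            (abs_oseen_moment_le h ht x (by linarith) haj i 2).trans ?_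
          gcongr
          exact le_abs_self _
      _ = 3 * (|oseenMomentConst a j| * A) *
          ((t * √t ^ (a - (3 + j))) * (√t + ‖x‖) ^ (-a)) := by ring
      _ ≤ _ := by rw [e]; gcongr
  · rw [norm_smul, Real.norm_of_nonneg ht.le]
    calc _ ≤ t * (3 * (|oseenBddConst| * C₀ / t)) := by
          gcongr
          refine norm_heatLeray_le x fun i => ?_
          rw [le_div_iff₀ ht]
          have := abs_oseen_bdd_le ht x hC hθ i 2
          rw [abs_mul, abs_of_pos ht, mul_comm] at this
          refine this.trans ?_
          gcongr
          exact le_abs_self _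
      _ = _ := by field_simp

lemma decOn_heat_moment {b : ℝ} (h : MomentBound θ j A) (hC : 0 ≤ C₀)
    (hθ : ∀ x, |θ x| ≤ C₀ * (1 + ‖x‖) ^ (-b)) (hb : 3 + j ≤ b) :
    DecOn 0 (b - (3 + j)) b fun t x => heat t θ x := by
  have hj := h.j_nonneg
  have hA := h.A_nonneg
  have h' := h.mono (le_max_left A C₀)
  obtain ⟨B, hB, h0⟩ := decOn_heat (β := 0) le_rfl (by norm_num) le_rfl hC
    (f := θ) (a := 0) fun x => (hθ x).trans (by
      rw [neg_zero, Real.rpow_zero]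
      exact mul_le_mul_of_nonneg_left (one_add_norm_rpow_le_one x (by linarith)) hC)
  refine DecOn.of_linear_le (A := |heatMomentConst b j| * (max A C₀) * 2) (B := B)
    (by positivity) hB (by linarith) (fun t ht x => ?_) fun t ht x => ?_
  · refine (abs_heat_moment_le h' ht x hb fun y hy => (hθ y).trans ?_).trans ?_
    · refine mul_le_mul (le_max_right _ _) (one_add_norm_rpow_le hy (by linarith) le_rfl)
        (by positivity) (by positivity)
    · have := one_add_sqrt_rpow_le t (sub_nonneg.2 hb)
      calc _ ≤ |heatMomentConst b j| * (max A C₀) *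
            ((2 * (1 + √t) ^ (b - (3 + j))) * (√t + ‖x‖) ^ (-b)) := by
            gcongr; exact le_abs_self _
        _ = _ := by ring
  · have := h0 t ht x (by positivity)
    simpa [wt] using this

/-- Decay alone gives ‖y‖|θ| = O(‖y‖^{-2}), hence truncated moments of order R. It does not bound
the partial integrals when b = 3; these come from the heat flow at the origin. -/
lemma momentBound_zero {b ε : ℝ} (hm : AEStronglyMeasurable θ volume) (hC : 0 ≤ C₀) (hb : 3 ≤ b)
    (hθ : ∀ x, |θ x| ≤ C₀ * (1 + ‖x‖) ^ (-b)) (hY : ∀ t, 0 < t → √t ^ 3 * |heat t θ 0| ≤ ε) :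
    ∃ A, MomentBound θ 0 A := by
  have hB := ballConst_nonneg 2
  have hd : ∀ y, y ≠ 0 → |θ y| ≤ C₀ * ‖y‖ ^ (-3 : ℝ) := fun y hy => (hθ y).trans (by
    gcongr; exact one_add_norm_rpow_le hy (by norm_num) hb)
  have hbd : ∀ y, |θ y| ≤ C₀ := fun y => (hθ y).trans
    (mul_le_of_le_one_right hC (one_add_norm_rpow_le_one y (by linarith)))
  have hmo : ∀ R, 0 < R → ∫ y in Metric.ball 0 R, ‖y‖ * |θ y| ≤ C₀ * ballConst 2 * R := by
    intro R hR
    obtain ⟨i1, j1⟩ := integrableOn_ball_norm_rpow (β := 2) (by norm_num) hR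
    calc _ ≤ ∫ y in Metric.ball (0 : E3) R, C₀ * ‖y‖ ^ (-2 : ℝ) := by
          refine integral_mono_of_nonneg (Filter.Eventually.of_forall fun y => by positivity)
            (i1.const_mul C₀) (Filter.Eventually.of_forall fun y => ?_)
          rcases eq_or_ne y 0 with rfl | hy
          · simp only [norm_zero, zero_mul]; positivity
          · have hn := norm_pos_iff.2 hy
            calc ‖y‖ * |θ y| ≤ ‖y‖ * (C₀ * ‖y‖ ^ (-3 : ℝ)) := by gcongr; exact hd y hy
              _ = C₀ * (‖y‖ ^ (1 : ℝ) * ‖y‖ ^ (-3 : ℝ)) := by rw [Real.rpow_one]; ring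
              _ = C₀ * ‖y‖ ^ (-2 : ℝ) := by rw [← Real.rpow_add hn]; norm_num
      _ = _ := by
          rw [integral_const_mul, j1, show (3 : ℝ) - 2 = 1 by norm_num, Real.rpow_one]; ring
  have hA : 0 ≤ C₀ + C₀ * ballConst 2 := by positivity
  obtain ⟨A', hA'⟩ := exists_mean_le (A := C₀ + C₀ * ballConst 2) hm hA hbd
    (fun y hy => (hd y hy).trans (by gcongr; linarith [mul_nonneg hC hB]))
    (fun R hR => (hmo R hR).trans (by gcongr; linarith)) hY
  have h1 : 0 ≤ C₀ * ballConst 2 := by positivity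
  have h2 : 0 ≤ |A'| := abs_nonneg _
  refine ⟨C₀ + C₀ * ballConst 2 + |A'|, ⟨hm, le_rfl, zero_le_one, by positivity,
    fun y => (hbd y).trans (by linarith), fun y hy => ?_, fun R hR => ?_, fun R hR => ?_⟩⟩
  · rw [add_zero]
    exact (hd y hy).trans (by gcongr; linarith)
  · rw [sub_zero, Real.rpow_one]
    exact (hmo R hR).trans (by gcongr; linarith)
  · rw [neg_zero, Real.rpow_zero, mul_one]
    linarith [hA' R hR, le_abs_self A']

/-- Zero mean turns the integral over a ball into minus that over the complement, where |θ| ≤ R^{-1}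
‖y‖ |θ|. -/
lemma momentBound_one {b : ℝ} (hm : AEStronglyMeasurable θ volume) (hC : 0 ≤ C₀) (hb : 4 ≤ b)
    (hθ : ∀ x, |θ x| ≤ C₀ * (1 + ‖x‖) ^ (-b)) (hi : Integrable fun y => ‖y‖ * θ y)
    (h0 : ∫ y, θ y = 0) : ∃ A, MomentBound θ 1 A := by
  have hi' : Integrable fun y => ‖y‖ * |θ y| := by
    refine hi.norm.congr (Filter.Eventually.of_forall fun y => ?_)
    simp [norm_mul]
  have iθ : Integrable θ := by
    refine ((integrable_add_norm_rpow one_pos (by linarith : (3 : ℝ) < b)).1.const_mul C₀).mono' hm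
      (Filter.Eventually.of_forall fun y => hθ y)
  set I := ∫ y, ‖y‖ * |θ y|
  have hI : 0 ≤ I := integral_nonneg fun y => by positivity
  have hd : ∀ y, y ≠ 0 → |θ y| ≤ C₀ * ‖y‖ ^ (-4 : ℝ) := fun y hy => (hθ y).trans (by
    gcongr; exact one_add_norm_rpow_le hy (by norm_num) hb)
  have hbd : ∀ y, |θ y| ≤ C₀ := fun y => (hθ y).trans
    (mul_le_of_le_one_right hC (one_add_norm_rpow_le_one y (by linarith)))
  refine ⟨C₀ + I, ⟨hm, zero_le_one, le_rfl, by positivity, fun y => (hbd y).trans (by linarith),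
    fun y hy => ?_, fun R hR => ?_, fun R hR => ?_⟩⟩
  · rw [show (3 : ℝ) + 1 = 4 by norm_num]
    exact (hd y hy).trans (by gcongr; linarith)
  · rw [sub_self, Real.rpow_zero, mul_one]
    refine (setIntegral_le_integral hi' (Filter.Eventually.of_forall fun y => ?_)).trans
      (by linarith)
    simp only [Pi.zero_apply]; positivity
  · have hB : MeasurableSet (Metric.ball (0 : E3) R) := Metric.isOpen_ball.measurableSet
    have e : ∫ y in Metric.ball 0 R, θ y = -∫ y in (Metric.ball (0 : E3) R)ᶜ, θ y := by
      have := integral_add_compl hB iθ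
      rw [h0] at this
      linarith
    rw [e, abs_neg, Real.rpow_neg_one]
    calc _ ≤ ∫ y in (Metric.ball (0 : E3) R)ᶜ, |θ y| := abs_integral_le_integral_abs
      _ ≤ ∫ y in (Metric.ball (0 : E3) R)ᶜ, R⁻¹ * (‖y‖ * |θ y|) := by
          refine setIntegral_mono_on iθ.abs.integrableOn (hi'.const_mul _).integrableOn hB.compl
            fun y hy => ?_
          have hy' : R ≤ ‖y‖ := by simpa using hy
          rw [← mul_assoc]
          refine le_mul_of_one_le_left (abs_nonneg _) ?_
          rwa [inv_mul_eq_div, one_le_div hR]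
      _ ≤ ∫ y, R⁻¹ * (‖y‖ * |θ y|) :=
          setIntegral_le_integral (hi'.const_mul _) (Filter.Eventually.of_forall fun y => by
            simp only [Pi.zero_apply]; positivity)
      _ = I * R⁻¹ := by rw [integral_const_mul, mul_comm]
      _ ≤ _ := by gcongr; linarith

end

/-! ### Norms and final form of the decay -/

lemma normX_le_iff {u : ℝ → E3 → E3} {r : ℝ} (hr : 0 ≤ r) :
    normX u ≤ ENNReal.ofReal r ↔ Bd 0 1 r u := by
  simp only [normX, iSup_le_iff, ENNReal.ofReal_le_ofReal_iff hr, Bd]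
  refine forall₂_congr fun t ht => forall_congr' fun x => ?_
  have h0 := Real.sqrt_pos.2 ht
  have hp : 0 < √t + ‖x‖ := by positivity
  rw [wt, zero_add, Real.rpow_neg_one, ← div_eq_mul_inv, le_div_iff₀ hp, mul_comm]

lemma normY_le_iff {θ : ℝ → E3 → ℝ} {r : ℝ} (hr : 0 ≤ r) :
    normY θ ≤ ENNReal.ofReal r ↔ Bd 0 3 r θ := by
  simp only [normY, iSup_le_iff, ENNReal.ofReal_le_ofReal_iff hr, Bd]
  refine forall₂_congr fun t ht => forall_congr' fun x => ?_
  have h0 := Real.sqrt_pos.2 ht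
  have hp : 0 < √t + ‖x‖ := by positivity
  have e : (√t + ‖x‖) ^ (-3 : ℝ) = ((√t + ‖x‖) ^ 3)⁻¹ := by
    rw [Real.rpow_neg hp.le]; norm_cast
  rw [wt, zero_add, e, ← div_eq_mul_inv, le_div_iff₀ (by positivity), mul_comm, Real.norm_eq_abs]

lemma DecOn.bd {V : Type} [NormedAddCommGroup V] {ν : ℝ} {u : ℝ → E3 → V} (h : DecOn 0 0 ν u) :
    ∃ A, 0 ≤ A ∧ Bd 1 ν A u := by
  obtain ⟨A, hA, h⟩ := h
  refine ⟨A, hA, fun t ht x => ?_⟩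
  simpa using h t ht x (by positivity)

lemma Bd.mono {V : Type} [NormedAddCommGroup V] {κ m A B : ℝ} {u : ℝ → E3 → V} (hκ : 0 ≤ κ)
    (h : Bd κ m A u) (hAB : A ≤ B) : Bd κ m B u := fun t ht x =>
  (h t ht x).trans (mul_le_mul_of_nonneg_right hAB (wt_nonneg hκ m t x))

/-- This is 1 + t ≤ (1 + √t)² ≤ 2(1 + t). The bound c on the exponents makes the constant uniform,
so that one constant serves every η. -/
lemma one_add_sqrt_rpow_le_one_add {t q c : ℝ} (ht : 0 ≤ t) (hc : 0 ≤ c) (hq : q ≤ c) :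
    (1 + √t) ^ q ≤ 2 ^ c * (1 + t) ^ (q / 2) := by
  have h0 := Real.sqrt_nonneg t
  have hs := Real.sq_sqrt ht
  have e : (1 + √t) ^ q = ((1 + √t) ^ 2) ^ (q / 2) := by
    rw [← Real.rpow_natCast, ← Real.rpow_mul (by positivity)]; congr 1; push_cast; ring
  have h2 : (1 : ℝ) ≤ 2 ^ c := Real.one_le_rpow one_le_two hc
  rw [e]
  rcases le_total 0 q with hq0 | hq0
  · calc _ ≤ (2 * (1 + t)) ^ (q / 2) := by
          refine Real.rpow_le_rpow (by positivity) ?_ (by linarith)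
          nlinarith [sq_nonneg (1 - √t)]
      _ = 2 ^ (q / 2) * (1 + t) ^ (q / 2) := Real.mul_rpow (by norm_num) (by linarith)
      _ ≤ _ := by
          gcongr
          · norm_num
          · linarith
  · calc _ ≤ (1 + t) ^ (q / 2) :=
          Real.rpow_le_rpow_of_nonpos (by linarith) (by nlinarith) (by linarith)
      _ ≤ _ := le_mul_of_one_le_left (by positivity) h2

/-- The single estimate at the extreme rate contains the whole family: the a - η unused powers of 1
+ √t + ‖x‖ are given up for powers of 1 + √t. -/
lemma DecOn.interpolate {V : Type} [NormedAddCommGroup V] {a p : ℝ} {u : ℝ → E3 → V}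
    (hp : 0 ≤ p) (ha : 0 ≤ a) (h : DecOn 0 (a - p) a u) :
    ∃ C, 0 ≤ C ∧ ∀ t, 0 < t → ∀ x, ∀ η, 0 ≤ η → η ≤ a →
      (1 + ‖x‖) ^ η * ‖u t x‖ ≤ C * (1 + t) ^ ((η - p) / 2) := by
  obtain ⟨A, hA, h⟩ := h
  refine ⟨A * 2 ^ a, by positivity, fun t ht x η hη hηa => ?_⟩
  have h0 := Real.sqrt_nonneg t
  have hx := norm_nonneg x
  have hw : 0 < 1 + (√t + ‖x‖) := by positivity
  calc _ ≤ (1 + (√t + ‖x‖)) ^ η * (A * ((1 + √t) ^ (a - p) * wt 1 a t x)) := by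
        refine mul_le_mul (Real.rpow_le_rpow (by positivity) (by linarith) hη)
          (h t ht x (by positivity)) (norm_nonneg _) (by positivity)
    _ = A * ((1 + √t) ^ (a - p) * wt 1 (a - η) t x) := by
        have : wt 1 (a - η) t x = (1 + (√t + ‖x‖)) ^ η * wt 1 a t x := by
          rw [wt, wt, ← Real.rpow_add hw]; congr 1; ring
        rw [this]; ring
    _ ≤ A * ((1 + √t) ^ (η - p) * wt 1 0 t x) := by
        gcongr A * ?_
        exact sqrt_rpow_mul_le x (by linarith) (by linarith)
    _ = A * (1 + √t) ^ (η - p) := by rw [wt, neg_zero, Real.rpow_zero, mul_one]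
    _ ≤ A * (2 ^ a * (1 + t) ^ ((η - p) / 2)) := by
        gcongr
        exact one_add_sqrt_rpow_le_one_add ht.le ha (by linarith)
    _ = _ := by ring

lemma norm_heat_le_of_inv {f : E3 → E3} {ε t : ℝ} (ht : 0 < t) (x : E3) (hε : 0 ≤ ε)
    (hf : ∀ y, ‖y‖ * ‖f y‖ ≤ ε) : ‖heat t f x‖ ≤ 2 * heatDecayConst 1 1 * ε * wt 0 1 t x := by
  have hb : ∀ y : E3, y ≠ 0 → ‖f y‖ ≤ ε * ‖y‖ ^ (-1 : ℝ) := fun y hy => by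
    rw [Real.rpow_neg_one, ← div_eq_mul_inv, le_div_iff₀ (norm_pos_iff.2 hy), mul_comm]
    exact hf y
  refine (norm_heat_decay_le ht x zero_le_one (by norm_num) le_rfl hε hb hb).trans (le_of_eq ?_)
  rw [sub_self, Real.rpow_zero, wt, zero_add]; ring

end

end Boussinesq

/-! ### Choice of the constants and proof of the theorem -/

theorem theorem3p2 :
    ∃ ε : ℝ, 0 < ε ∧ ∃ M : ℝ, 0 < M ∧
      ∀ (u₀ : Boussinesq.E3 → Boussinesq.E3) (θ₀ : Boussinesq.E3 → ℝ),
        Boussinesq.SmallData ε u₀ θ₀ →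
        ∀ a b C₀ : ℝ, 1 ≤ a → 3 ≤ b → 0 < C₀ →
          (∀ x, ‖u₀ x‖ ≤ C₀ * (1 + ‖x‖) ^ (-a)) →
          (∀ x, |θ₀ x| ≤ C₀ * (1 + ‖x‖) ^ (-b)) →
          ∃ (u : ℝ → Boussinesq.E3 → Boussinesq.E3) (θ : ℝ → Boussinesq.E3 → ℝ),
            -- `(u, θ)` is the unique mild solution with norms at most `M ε`
            Boussinesq.IsSmallMildSolution (M * ε) u₀ θ₀ u θ ∧
            (∀ (v : ℝ → Boussinesq.E3 → Boussinesq.E3) (ϑ : ℝ → Boussinesq.E3 → ℝ),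
              Boussinesq.IsSmallMildSolution (M * ε) u₀ θ₀ v ϑ →
              ∀ t : ℝ, 0 < t → ∀ x, v t x = u t x ∧ ϑ t x = θ t x) ∧
            -- part (i)
            (a < 3 →
              ∃ C : ℝ, 0 < C ∧ ∀ t : ℝ, 0 < t → ∀ x,
                (∀ η : ℝ, 0 ≤ η → η ≤ a →
                  ‖x‖ ^ η * ‖u t x‖ ≤ C * (1 + t) ^ ((η - 1) / 2)) ∧
                (∀ η : ℝ, 0 ≤ η → η ≤ b →
                  ‖x‖ ^ η * |θ t x| ≤ C * (1 + t) ^ ((η - 3) / 2))) ∧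
            -- part (ii)
            (2 ≤ a → a < 4 → a ≠ 3 → 4 ≤ b →
              MeasureTheory.Integrable (fun y => ‖y‖ * θ₀ y) →
              ∫ y, θ₀ y = 0 →
              ∃ C : ℝ, 0 < C ∧ ∀ t : ℝ, 0 < t → ∀ x,
                (∀ η : ℝ, 0 ≤ η → η ≤ a →
                  ‖u t x‖ ≤ C * ((1 + ‖x‖) ^ (-η) * (1 + t) ^ ((η - 2) / 2))) ∧
                (∀ η : ℝ, 0 ≤ η → η ≤ b →
                  |θ t x| ≤ C * ((1 + ‖x‖) ^ (-η) * (1 + t) ^ ((η - 4) / 2)))) := by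
  have k1 := Boussinesq.opConst_pos (m := 1) (by norm_num)
  have k3 := Boussinesq.opConst_pos (m := 3) (by norm_num)
  have k7 := Boussinesq.opConst_pos (m := 7 / 4) (by norm_num)
  have k15 := Boussinesq.opConst_pos (m := 15 / 4) (by norm_num)
  have hD := Boussinesq.heatDecayConst_pos 1 1
  set D := Boussinesq.heatDecayConst 1 1
  -- K dominates the operator constants at the only weights used in the iteration: 1 and 3 for 𝒳 ×
  -- 𝒴, 7/4 and 15/4 for the mean zero case. The rates a and b enter only where no smallness is
  -- required.
  obtain ⟨K, hK⟩ : ∃ K, K = Boussinesq.opConst 1 + Boussinesq.opConst 3 +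
    Boussinesq.opConst (7 / 4) + Boussinesq.opConst (15 / 4) := ⟨_, rfl⟩
  have hK0 : 0 < K := by linarith
  have hε0 : 0 < 1 / (8 * K * (4 * D + 2)) := by positivity
  -- With M = 4D + 2 and R = Mε, the linear velocity is bounded by 2Dε + ε = R/2, and this ε is the
  -- value with 8KR = 1.
  refine ⟨1 / (8 * K * (4 * D + 2)), hε0, 4 * D + 2, by positivity, ?_⟩
  set ε := 1 / (8 * K * (4 * D + 2)) with hε
  have hKR : 8 * K * ((4 * D + 2) * ε) ≤ 1 := by
    rw [hε, ← mul_assoc]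
    exact le_of_eq (mul_one_div_cancel (by positivity))
  have hR : 0 ≤ (4 * D + 2) * ε := by positivity
  set R := (4 * D + 2) * ε with hRdef
  intro u₀ θ₀ hs a b C₀ ha hb hC hu₀ hθ₀
  set L : ℝ → Boussinesq.E3 → Boussinesq.E3 := fun t x =>
    Boussinesq.heat t u₀ x + t • Boussinesq.heatLeray t (fun y => θ₀ y • Boussinesq.e3) x with hL
  set Λ : ℝ → Boussinesq.E3 → ℝ := fun t x => Boussinesq.heat t θ₀ x with hΛ
  have bX := (Boussinesq.normX_le_iff hε0.le).1 hs.small_X.le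
  have bY := (Boussinesq.normY_le_iff hε0.le).1 hs.small_Y.le
  have bu : ∀ y, ‖y‖ * ‖u₀ y‖ ≤ ε := by
    have h := hs.small_u.le
    simp only [iSup_le_iff, ENNReal.ofReal_le_ofReal_iff hε0.le] at h
    exact h
  have bL : Boussinesq.Bd 0 1 (R / 2) L := fun t ht x => by
    have h1 := Boussinesq.norm_heat_le_of_inv ht x hε0.le bu
    have h2 := bX t ht x
    refine (norm_add_le _ _).trans ((add_le_add h1 h2).trans (le_of_eq ?_))
    rw [hRdef]; ring
  have bΛ : Boussinesq.Bd 0 3 (R / 2) Λ := bY.mono le_rfl (by rw [hRdef]; nlinarith)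
  have mL : Boussinesq.Meas L :=
    Measurable.add (Boussinesq.meas_heat hs.meas_u) (Boussinesq.meas_heatLeray hs.meas_θ)
  have mΛ : Boussinesq.Meas Λ := Boussinesq.meas_heat hs.meas_θ
  obtain ⟨u, θ, hz, eu, eθ, pers⟩ := Boussinesq.exists_fixed hR hKR (by linarith) (by linarith)
    mL mΛ bL bΛ
  have persist : ∀ m : ℝ, 0 ≤ m → m < 2 → Boussinesq.opConst m ≤ K →
      Boussinesq.opConst (m + 2) ≤ K → Boussinesq.DecOn 0 0 m L → Boussinesq.DecOn 0 0 (m + 2) Λ →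
      Boussinesq.DecOn 0 0 m u ∧ Boussinesq.DecOn 0 0 (m + 2) θ := by
    intro m hm hm2 h1 h2 dL dΛ
    obtain ⟨A, hA, dL⟩ := dL.bd
    obtain ⟨B, hB, dΛ⟩ := dΛ.bd
    have hAB : 0 ≤ max A B := hA.trans (le_max_left _ _)
    obtain ⟨r1, r2⟩ := pers 1 m (max A B) zero_le_one hm hm2 h1 h2 hAB
      (dL.mono zero_le_one (le_max_left _ _)) (dΛ.mono zero_le_one (le_max_right _ _))
    exact ⟨r1.decOn (by positivity), r2.decOn (by positivity)⟩
  have hθ₃ : ∀ x, |θ₀ x| ≤ C₀ * (1 + ‖x‖) ^ (-3 : ℝ) := fun x => (hθ₀ x).trans (by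
    gcongr
    linarith [norm_nonneg x])
  refine ⟨u, θ, ⟨⟨hz.meas_u, hz.meas_θ, eu, eθ⟩, (Boussinesq.normX_le_iff hR).2 hz.bd_u,
    (Boussinesq.normY_le_iff hR).2 hz.bd_θ⟩, ?_, ?_, ?_⟩
  · intro v ϑ hv
    exact Boussinesq.fixed_unique (L := L) (Λ := Λ)
      ⟨hv.meas_u, hv.meas_θ, (Boussinesq.normX_le_iff hR).1 hv.normX_le,
        (Boussinesq.normY_le_iff hR).1 hv.normY_le⟩ hz hR hKR (by linarith) (by linarith)
      hv.eq_u hv.eq_θ eu eθ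
  · intro ha3
    obtain ⟨A, hA⟩ := Boussinesq.momentBound_zero (ε := ε) hs.meas_θ hC.le hb hθ₀ fun t ht => by
      have h := bY t ht 0
      have h0 := Real.sqrt_pos.2 ht
      rw [Boussinesq.wt, norm_zero, zero_add, add_zero, Real.rpow_neg h0.le,
        ← div_eq_mul_inv, le_div_iff₀ (by positivity), mul_comm, Real.norm_eq_abs] at h
      exact_mod_cast h
    have d1 := Boussinesq.decOn_heat (β := 1) zero_le_one (by norm_num) ha hC.le hu₀
    have d2 := Boussinesq.decOn_heatLeray (a := a) hA hC.le hθ₃ (by linarith) (by linarith)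
    have d3 := Boussinesq.decOn_heat_moment hA hC.le hθ₀ (by linarith)
    rw [add_zero] at d2 d3
    have dL : Boussinesq.DecOn 0 (a - 1) a L := d1.add d2
    obtain ⟨q1, q2⟩ := persist 1 zero_le_one (by norm_num) (by linarith)
      (by rw [show (1 : ℝ) + 2 = 3 by norm_num]; linarith) (dL.weaken ha (by linarith))
      (d3.weaken (by linarith) (by linarith))
    rw [show (1 : ℝ) + 2 = 3 by norm_num] at q2
    obtain ⟨f1, f2⟩ := Boussinesq.decOn_of_fixed (a := a) hz.meas_u hz.meas_θ eu eθ q1 q2 d3 hb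
    obtain ⟨c1, hc1, g1⟩ := (f1 ha ha3 dL).interpolate zero_le_one (by linarith)
    obtain ⟨c2, hc2, g2⟩ := f2.interpolate (by norm_num) (by linarith)
    refine ⟨c1 + c2 + 1, by positivity, fun t ht x => ⟨fun η h0 h1 => ?_, fun η h0 h1 => ?_⟩⟩
    · calc _ ≤ (1 + ‖x‖) ^ η * ‖u t x‖ := by gcongr; linarith
        _ ≤ _ := g1 t ht x η h0 h1
        _ ≤ _ := by gcongr; linarith
    · calc _ ≤ (1 + ‖x‖) ^ η * |θ t x| := by gcongr; linarith
        _ ≤ _ := g2 t ht x η h0 h1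
        _ ≤ _ := by gcongr; linarith
  · intro ha2 ha4 _ hb4 hi hm
    obtain ⟨A, hA⟩ := Boussinesq.momentBound_one hs.meas_θ hC.le hb4 hθ₀ hi hm
    have d1 := Boussinesq.decOn_heat (β := 2) zero_le_two (by norm_num) ha2 hC.le hu₀
    have d2 := Boussinesq.decOn_heatLeray (a := a) hA hC.le hθ₃ (by linarith) (by linarith)
    have d3 := Boussinesq.decOn_heat_moment hA hC.le hθ₀ (by linarith)
    rw [show (1 : ℝ) + 1 = 2 by norm_num] at d2
    rw [show (3 : ℝ) + 1 = 4 by norm_num] at d3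
    have dL : Boussinesq.DecOn 0 (a - 2) a L := d1.add d2
    have e : (7 / 4 : ℝ) + 2 = 15 / 4 := by norm_num
    -- A weight m must satisfy m + 2 < 4 for the iteration and m + (m + 2) > 5 for integrability of
    -- θu; 7/4 lies midway between 3/2 and 2.
    obtain ⟨q1, q2⟩ := persist (7 / 4) (by norm_num) (by norm_num) (by linarith)
      (by rw [e]; linarith) (dL.weaken (by linarith) (by linarith))
      (d3.weaken (by linarith) (by linarith))
    rw [e] at q2
    obtain ⟨f1, f2⟩ := Boussinesq.decOn_of_fixed_of_mean_zero hz.meas_u hz.meas_θ eu eθ q1 q2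
      ha2 ha4 hb4 dL d3
    obtain ⟨c1, hc1, g1⟩ := f1.interpolate zero_le_two (by linarith)
    obtain ⟨c2, hc2, g2⟩ := f2.interpolate (by norm_num) (by linarith)
    have conv : ∀ (x : Boussinesq.E3) (η y c s : ℝ), (1 + ‖x‖) ^ η * y ≤ c * s →
        c ≤ c1 + c2 + 1 → 0 ≤ s → y ≤ (c1 + c2 + 1) * ((1 + ‖x‖) ^ (-η) * s) := by
      intro x η y c s h hc hs0
      have hp : 0 < (1 + ‖x‖) ^ η := by positivity
      rw [Real.rpow_neg (by positivity), mul_left_comm, ← div_eq_inv_mul, le_div_iff₀ hp, mul_comm]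
      exact h.trans (by gcongr)
    refine ⟨c1 + c2 + 1, by positivity, fun t ht x => ⟨fun η h0 h1 => ?_, fun η h0 h1 => ?_⟩⟩
    · exact conv x η _ c1 _ (g1 t ht x η h0 h1) (by linarith) (by positivity)
    · exact conv x η _ c2 _ (g2 t ht x η h0 h1) (by linarith) (by positivity)
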